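/- **Conventions.** The connected Dynkin diagrams are $A_n$ ($n\ge1$), $B_n$ ($n\ge2$), $C_n$ ($n\ge3$), $D_n$ ($n\ge4$), $E_6,E_7,E_8,F_4,G_2$; the types $A,D,E$ are called ADE. The Coxeter adjacency matrix of a diagram with Cartan matrix $C$ is $2I-C$. On the path $1-2-\cdots-n$ the Coxeter adjacency matrix $M$ of $B_n$ has $M_{n,n-1}=2$, $M_{n-1,n}=1$, and that of $C_n$ is its transpose; that of $F_4$, on the path $1-2-3-4$, has $M_{23}=2$, $M_{32}=1$; that of $G_2$ has $M_{12}=3$, $M_{21}=1$; in all remaining cases the two entries belonging to an edge of a diagram are $1$. We also allow $D_3=A_3$ and write $C_2$ for $B_2$ with the transposed matrix. A *Coxeter adjacency matrix* in general is one which, up to simultaneous permutation of rows and columns, is a block sum of Coxeter adjacency matrices of connected Dynkin diagrams (its components). A *Dynkin biagram* is a pair $(\Gamma,\Delta)$ of Coxeter adjacency matrices on the same finite vertex set such that $\Gamma+\Delta$ is bipartite and $\Gamma,\Delta$ share no nonzero entries. It is *ADE* if all components of $\Gamma$ and of $\Delta$ are ADE, and *non-ADE* otherwise. It is *admissible* if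 $2I-\Gamma$ and $2I-\Delta$ commute. It is a *binding* if $\Gamma$ has exactly two components $\Gamma_1,\Gamma_2$ and every edge of $\Delta$ connects $\Gamma_1$ to $\Gamma_2$; it is a *double binding* if both $(\Gamma,\Delta)$ and $(\Delta,\Gamma)$ are bindings. Biagrams are considered up to relabelling of the vertices. **Constructions.** For Coxeter adjacency matrices $M,N$ of connected diagrams $\Lambda,\Lambda'$, the tensor product $\Lambda\otimes\Lambda'$ is $(M\otimes I,\ I\otimes N)$, and the parallel bindings are $(\Lambda\equiv\Lambda)=\Lambda\otimes A_2$, $(\Lambda\equiv_2\Lambda)=\Lambda\otimes B_2$, $(\Lambda\equiv_3\Lambda)=\Lambda\otimes G_2$. The twist $\Lambda\times\Lambda$ is $\left(\begin{pmatrix}M&0\\0&M\end{pmatrix},\begin{pmatrix}0&M\\M&0\end{pmatrix}\right)$. The flip of $(\Gamma,\Delta)$ is $(\Gamma^\top,\Delta^\top)$. Folding $(\Gamma,\Delta)$ along an automorphism replaces the vertices by its orbits, with $\Gamma'_{IJ}=\sum_{i\in I}\Gamma_{ij}$ and $\Delta'_{IJ}=\sum_{i\in I}\Delta_{ij}$ for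 any $j\in J$. Define: - $B_n\ltimes D_{n+1}$ ($n\ge2$): the twist $D_{n+1}\times D_{n+1}$ folded along the automorphism exchanging two leaves at the branch vertex (for $n=2$, the two leaves of $D_3=A_3$) in the first copy and fixing all other vertices; $C_n\ltimes D_{n+1}$ is its flip. - $B_n\bowtie C_n$ ($n\ge3$): $C_n\ltimes D_{n+1}$ folded along the automorphism exchanging two leaves at the branch vertex of the component $D_{n+1}$ of $\Gamma$ (for $n=3$, any two of the three leaves). - $G_2\ltimes_1D_4$: the twist $D_4\times D_4$ folded along the automorphism cyclically permuting the three leaves of the first copy; $G_2\ltimes_2D_4$ is its flip. - $B_3\bowtie_iG_2$ ($i=1,2$): $G_2\ltimes_iD_4$ folded along the automorphism exchanging two leaves of the component $D_4$ of $\Gamma$. - $C_3\bowtie_1G_2$: $C_3\ltimes D_4$ folded along the automorphism cyclically permuting the three leaves of the component $D_4$ of $\Gamma$; $C_3\bowtie_2G_2$ is the flip of $B_3\bowtie_1G_2$. - $B_4\boxtimes C_4$: let $D_5\boxtimes A_7$ be the ADE bigraph with $\Gamma=D_5\sqcup A_7$, where $D_5$ has edges $u_0u_1,u_1u_2,u_2u_3,u_2u_4$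 and $A_7$ is the path $w_0w_1\cdots w_6$, and with $\Delta$-edges $u_0w_3$, $u_1w_2$, $u_1w_4$, $u_2w_1$, $u_2w_3$, $u_2w_5$, $u_3w_0$, $u_3w_4$, $u_4w_2$, $u_4w_6$; fold it along the automorphism exchanging $u_3,u_4$ and $w_k,w_{6-k}$. **Theorem.** Up to isomorphism, the admissible non-ADE double bindings are exactly the following Dynkin biagrams: - (a) the parallel bindings $\Lambda\equiv\Lambda$ for $\Lambda\in\{B_2,G_2\}$, and $\Lambda\equiv_2\Lambda$, $\Lambda\equiv_3\Lambda$ for $\Lambda\in\{A_2,B_2,G_2\}$; - (b) the twists $\Lambda\times\Lambda$ for $\Lambda$ a connected non-ADE Dynkin diagram; - (c) $B_n\ltimes D_{n+1}$ and $C_n\ltimes D_{n+1}$ for $n\ge2$, $B_n\bowtie C_n$ for $n\ge3$, $G_2\ltimes_1D_4$, $G_2\ltimes_2D_4$, $B_3\bowtie_1G_2$, $B_3\bowtie_2G_2$, $C_3\bowtie_1G_2$, $C_3\bowtie_2G_2$; - (d) the exceptional binding $B_4\boxtimes C_4$. -/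

import Mathlib

open Matrix
open scoped Kronecker

/-- The Coxeter adjacency matrix `2 I - C` attached to a Cartan matrix `C`. -/
def coxeterAdj {V : Type*} [DecidableEq V] (C : Matrix V V ℤ) : Matrix V V ℤ :=
  (2 : ℤ) • (1 : Matrix V V ℤ) - C

/-- The (connected) Dynkin diagrams, each isomorphism class exactly once. -/
inductive DynkinType : Type
  | A (n : ℕ) (hn : 1 ≤ n)
  | B (n : ℕ) (hn : 2 ≤ n)
  | C (n : ℕ) (hn : 3 ≤ n)
  | D (n : ℕ) (hn : 4 ≤ n)
  | E₆
  | E₇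
  | E₈
  | F₄
  | G₂

namespace DynkinType

/-- The number of vertices. -/
def rank : DynkinType → ℕ
  | A n _ => n
  | B n _ => n
  | C n _ => n
  | D n _ => n
  | E₆ => 6
  | E₇ => 7
  | E₈ => 8
  | F₄ => 4
  | G₂ => 2

/-- The Cartan matrix. The convention is that the entry of `B_n` in row "last vertex", column
"last but one vertex" is `-2` (and the transposed entry is `-1`); for `C_n` it is the other way
round. This is the transpose of Mathlib's convention for `B_n` and `C_n`. (The diagrams of
`F₄` and `G₂` are isomorphic to the diagrams of their transposes.) -/
def cartan : (X : DynkinType) → Matrix (Fin X.rank) (Fin X.rank) ℤ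
  | A n _ => CartanMatrix.A n
  | B n _ => (CartanMatrix.B n)ᵀ
  | C n _ => (CartanMatrix.C n)ᵀ
  | D n _ => CartanMatrix.D n
  | E₆ => CartanMatrix.E₆
  | E₇ => CartanMatrix.E₇
  | E₈ => CartanMatrix.E₈
  | F₄ => CartanMatrix.F₄
  | G₂ => CartanMatrix.G₂

/-- The Coxeter adjacency matrix of a connected Dynkin diagram. -/
def adj (X : DynkinType) : Matrix (Fin X.rank) (Fin X.rank) ℤ :=
  coxeterAdj X.cartan

/-- The simply laced types. -/
def IsADE : DynkinType → Prop
  | A _ _ => True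
  | B _ _ => False
  | C _ _ => False
  | D _ _ => True
  | E₆ => True
  | E₇ => True
  | E₈ => True
  | F₄ => False
  | G₂ => False

end DynkinType

/-- `M` is, up to relabelling the vertices, a disjoint union of finitely many connected Dynkin
diagrams all of whose types lie in `S`. -/
def IsUnionOfDynkin {V : Type*} (S : Set DynkinType) (M : Matrix V V ℤ) : Prop :=
  ∃ (k : ℕ) (t : Fin k → DynkinType) (e : V ≃ (Σ i, Fin (t i).rank)),
    (∀ i, t i ∈ S) ∧ M = (blockDiagonal' fun i => (t i).adj).submatrix e e

/-- A Coxeter adjacency matrix, not necessarily irreducible. -/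
def IsCoxeterAdj {V : Type*} (M : Matrix V V ℤ) : Prop :=
  IsUnionOfDynkin Set.univ M

/-- A pair of square integer matrices `(Γ, Δ)` on the same vertex set;
`red` is `Γ` and `blue` is `Δ`. -/
structure Biagram (V : Type*) where
  red : Matrix V V ℤ
  blue : Matrix V V ℤ

namespace Biagram

/-- Isomorphism: a relabelling of the vertices that respects both matrices. -/
def Iso {V W : Type*} (P : Biagram V) (Q : Biagram W) : Prop :=
  ∃ e : V ≃ W, P.red = Q.red.submatrix e e ∧ P.blue = Q.blue.submatrix e e

/-- The dual `(Δ, Γ)`. -/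
def dual {V : Type*} (P : Biagram V) : Biagram V := ⟨P.blue, P.red⟩

/-- The global flip `(Γᵀ, Δᵀ)`. -/
def flip {V : Type*} (P : Biagram V) : Biagram V := ⟨P.redᵀ, P.blueᵀ⟩

/-- Dynkin biagrams: two Coxeter adjacency matrices whose sum is bipartite and which share no
nonzero entries. -/
structure IsDynkin {V : Type*} (P : Biagram V) : Prop where
  red_coxeter : IsCoxeterAdj P.red
  blue_coxeter : IsCoxeterAdj P.blue
  bipartite : ∃ ε : V → Bool, ∀ i j, (P.red + P.blue) i j ≠ 0 → ε i ≠ ε j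
  disjoint : ∀ i j, P.red i j = 0 ∨ P.blue i j = 0

/-- All connected components of `Γ` and of `Δ` are simply laced. -/
def IsADE {V : Type*} (P : Biagram V) : Prop :=
  IsUnionOfDynkin {X | X.IsADE} P.red ∧ IsUnionOfDynkin {X | X.IsADE} P.blue

/-- Admissibility: the Cartan matrices `2 I - Γ` and `2 I - Δ` commute. -/
def IsAdmissible {V : Type*} [Fintype V] [DecidableEq V] (P : Biagram V) : Prop :=
  Commute ((2 : ℤ) • (1 : Matrix V V ℤ) - P.red) ((2 : ℤ) • (1 : Matrix V V ℤ) - P.blue)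

/-- `(Γ, Δ)` is a binding: `Γ` is the disjoint union of two connected Dynkin diagrams `Γ₁`, `Γ₂`,
and every edge of `Δ` connects `Γ₁` to `Γ₂`. -/
def IsBinding {V : Type*} (P : Biagram V) : Prop :=
  ∃ (X Y : DynkinType) (e : V ≃ Fin X.rank ⊕ Fin Y.rank),
    P.red = (fromBlocks X.adj 0 0 Y.adj).submatrix e e ∧
    ∀ i j, P.blue i j ≠ 0 → (e i).isLeft ≠ (e j).isLeft

/-- `(Γ, Δ)` and `(Δ, Γ)` are both bindings. -/
def IsDoubleBinding {V : Type*} (P : Biagram V) : Prop :=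
  P.IsBinding ∧ P.dual.IsBinding

/-! ### Constructions -/

/-- The tensor product: the red matrix is `M ⊗ I`, the blue matrix is `I ⊗ N`. -/
def tensor {V W : Type*} [DecidableEq V] [DecidableEq W]
    (M : Matrix V V ℤ) (N : Matrix W W ℤ) : Biagram (V × W) :=
  ⟨M ⊗ₖ (1 : Matrix W W ℤ), (1 : Matrix V V ℤ) ⊗ₖ N⟩

/-- The parallel binding `Λ ≡ Λ`, that is `Λ ⊗ A₂`. -/
def parallel (X : DynkinType) :=
  tensor X.adj (DynkinType.A 2 one_le_two).adj

/-- The parallel binding `Λ ≡₂ Λ`, that is `Λ ⊗ B₂`. -/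
def parallel₂ (X : DynkinType) :=
  tensor X.adj (DynkinType.B 2 le_rfl).adj

/-- The parallel binding `Λ ≡₃ Λ`, that is `Λ ⊗ G₂`. -/
def parallel₃ (X : DynkinType) :=
  tensor X.adj DynkinType.G₂.adj

/-- The twist `Λ × Λ` of the diagram with Coxeter adjacency matrix `M`. -/
def twist {V : Type*} (M : Matrix V V ℤ) : Biagram (V ⊕ V) :=
  ⟨fromBlocks M 0 0 M, fromBlocks 0 M M 0⟩

/-- Folding along a bicolored automorphism `f` of the biagram whose set of orbits is identified with `W`:
`π v` is the orbit of the vertex `v`, and `σ J` is a chosen vertex of the orbit `J`. The folded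
matrices have entries `∑ i ∈ I, M i j` at orbits `I`, `J`, where `j` is any vertex of `J`
(the choice does not matter). -/
def fold {V W : Type*} [Fintype V] [DecidableEq W] (P : Biagram V) (π : V → W) (σ : W → V) :
    Biagram W :=
  ⟨Matrix.of fun I J => ∑ i with π i = I, P.red i (σ J),
   Matrix.of fun I J => ∑ i with π i = I, P.blue i (σ J)⟩

/-- The orbits of the automorphism of `D_{n+1}` that exchanges the last two vertices. These are
the two leaves at the branch vertex (for `n = 2`, the two leaves of `D₃ = A₃`). -/
def orbD (n : ℕ) (hn : 2 ≤ n) : Fin (n + 1) → Fin n :=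
  fun i => ⟨min i.val (n - 1), by omega⟩

/-- The orbits of the automorphism of `D₄` that permutes the three leaves `0`, `2`, `3`
cyclically and fixes the central vertex `1`. -/
def orbTri : Fin 4 → Fin 2 := ![0, 1, 0, 0]

/-- Representatives for `orbTri`. -/
def repTri : Fin 2 → Fin 4 := ![0, 1]

/-- `B_n ⋉ D_{n+1}`: one side of the twist `D_{n+1} × D_{n+1}` is folded to `B_n`. -/
def bLtimesD (n : ℕ) (hn : 2 ≤ n) : Biagram (Fin n ⊕ Fin (n + 1)) :=
  (twist (coxeterAdj (CartanMatrix.D (n + 1)))).fold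
    (Sum.map (orbD n hn) id) (Sum.map Fin.castSucc id)

/-- `C_n ⋉ D_{n+1}`, the global flip of `B_n ⋉ D_{n+1}`. -/
def cLtimesD (n : ℕ) (hn : 2 ≤ n) : Biagram (Fin n ⊕ Fin (n + 1)) :=
  (bLtimesD n hn).flip

/-- `B_n ⋈ C_n`: the component `D_{n+1}` of `C_n ⋉ D_{n+1}` is folded to `B_n`. -/
def bBowtieC (n : ℕ) (hn : 3 ≤ n) : Biagram (Fin n ⊕ Fin n) :=
  (cLtimesD n (by omega)).fold (Sum.map id (orbD n (by omega))) (Sum.map id Fin.castSucc)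

/-- `G₂ ⋉₁ D₄`: one side of the twist `D₄ × D₄` is folded to `G₂`. -/
def gLtimesD₁ : Biagram (Fin 2 ⊕ Fin 4) :=
  (twist (coxeterAdj (CartanMatrix.D 4))).fold (Sum.map orbTri id) (Sum.map repTri id)

/-- `G₂ ⋉₂ D₄`, the global flip of `G₂ ⋉₁ D₄`. -/
def gLtimesD₂ : Biagram (Fin 2 ⊕ Fin 4) := gLtimesD₁.flip

/-- `B₃ ⋈₁ G₂`: the component `D₄` of `G₂ ⋉₁ D₄` is folded to `B₃`. -/
def bBowtieG₁ : Biagram (Fin 2 ⊕ Fin 3) :=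
  gLtimesD₁.fold (Sum.map id (orbD 3 (by norm_num))) (Sum.map id Fin.castSucc)

/-- `B₃ ⋈₂ G₂`: the component `D₄` of `G₂ ⋉₂ D₄` is folded to `B₃`. -/
def bBowtieG₂ : Biagram (Fin 2 ⊕ Fin 3) :=
  gLtimesD₂.fold (Sum.map id (orbD 3 (by norm_num))) (Sum.map id Fin.castSucc)

/-- `C₃ ⋈₁ G₂`: the component `D₄` of `C₃ ⋉ D₄` is folded to `G₂`. -/
def cBowtieG₁ : Biagram (Fin 3 ⊕ Fin 2) :=
  (cLtimesD 3 (by norm_num)).fold (Sum.map id orbTri) (Sum.map id repTri)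

/-- `C₃ ⋈₂ G₂`, the global flip of `B₃ ⋈₁ G₂`. -/
def cBowtieG₂ : Biagram (Fin 2 ⊕ Fin 3) := bBowtieG₁.flip

/-- The blue edges of `D₅ ⊠ A₇`; the vertices of `D₅` are `0 - 1 - 2`, `2 - 3`, `2 - 4` and
those of `A₇` are `0 - 1 - ⋯ - 6`. -/
def boxEdges : Matrix (Fin 5) (Fin 7) ℤ :=
  !![0, 0, 0, 1, 0, 0, 0;
     0, 0, 1, 0, 1, 0, 0;
     0, 1, 0, 1, 0, 1, 0;
     1, 0, 0, 0, 1, 0, 0;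
     0, 0, 1, 0, 0, 0, 1]

/-- The exceptional ADE bigraph `D₅ ⊠ A₇`. -/
def dBoxA : Biagram (Fin 5 ⊕ Fin 7) :=
  ⟨fromBlocks (coxeterAdj (CartanMatrix.D 5)) 0 0 (coxeterAdj (CartanMatrix.A 7)),
   fromBlocks 0 boxEdges boxEdgesᵀ 0⟩

/-- `B₄ ⊠ C₄`: the bigraph `D₅ ⊠ A₇` folded along the automorphism that exchanges the vertices
`3`, `4` of `D₅` and reverses `A₇`. -/
def bBoxC : Biagram (Fin 4 ⊕ Fin 4) :=
  dBoxA.fold (Sum.map (orbD 4 (by norm_num)) ![0, 1, 2, 3, 2, 1, 0])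
    (Sum.map Fin.castSucc ![0, 1, 2, 3])

end Biagram

/-!
Relabelling the vertices brings a double binding into block form: the red matrix is `diag(X, Y)`
with connected `X` and `Y`, and the blue matrix has off-diagonal blocks `A` and `B`. It is
admissible if and only if `X A = A Y` and `Y B = B X` (`Biagram.Intertwine`), and then `A B`
commutes with `X`. The two blue components define a colouring of the vertices which is constant
along blue edges and, as every red edge joins the two blue components, changes along red edges.

Up to duality, that is, exchanging red and blue, a red component `X` is not simply laced.

*Rank at least three.* Up to a flip, `X` is `B_n` with `n ≥ 3` or `F₄`. The blue matrix has finite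
type, so its square stretches no nonzero nonnegative vector by a factor of at least `4`. Applied to
the Perron eigenvector of `B_n`, whose entries are `sin (k π / 2n)`, this leaves so little room for
the first row of `A B` that `A B = X²` (`HasComponents.mul_eq_sq_B`, `HasComponents.mul_eq_sq_F₄`).
Hence the inner products of the rows of `A` with the columns of `B` are known: they are `1` for the
first row, so that this row is a single vertex `y` of `Y`. The other rows follow from it by the
recursion `X A = A Y`, and their inner products determine `Y` step by step from `y` on
(`IsPathRep.classify`, `exists_equiv_F₄`): for `B_n` the pair `(Y, y)` is `D_{n+1}`, `B_n` or `C_n`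
with the second vertex, or `G₂` if `n = 3`, or `C₄` with its last vertex if `n = 4`. An intertwiner
out of a path is determined by its first row (`eq_zero_of_row_zero`), so `(Y, y)` determines the
biagram (`Biagram.iso_of_first_row`), and the cases are `B_n ⋉ D_{n+1}`, the twist, `B_n ⋈ C_n`,
`B₃ ⋈ᵢ G₂` and `B₄ ⊠ C₄`.

*Rank two.* If all components that are not simply laced have rank two, then `A B` is a scalar
(`DoubleBlocks.exists_degree`), and at each vertex of `X` the blue component is a single edge or a
star with simple edges. Two single edges give a parallel binding or a twist, an edge and a star
give `B₂ ⋉ D₃`, `C₂ ⋉ D₃` or `G₂ ⋉ᵢ D₄`, and two stars with several edges are excluded by the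
connectedness of `Y`.

Conversely, a twist is admissible and self-dual, by exchanging its two copies on one colour class
of the vertices. Both properties pass to the foldings (`Biagram.Intertwine.fold_left`,
`Biagram.IsoVia.fold`), and a self-dual binding is a double binding. For the remaining biagrams
the conditions are checked on explicit matrices.
-/

/-! ### Coxeter adjacency matrices of finite type -/

/-- The features of the Coxeter adjacency matrix of a connected Dynkin diagram that the
classification uses: nonnegative entries with symmetric support, connectedness (a set of vertices
closed under adjacency is empty or everything), and finite type in the form of a positive weight
`ℓ` with `ℓ M < 2 ℓ`. The weights used below are quadratic along the path in the classical series
and are the coefficients of the sum of the positive roots in the exceptional types. -/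
structure IsConnectedFiniteType {W : Type*} [Fintype W] (M : Matrix W W ℤ) : Prop where
  nonneg : ∀ i j, 0 ≤ M i j
  symm : ∀ i j, M i j = 0 → M j i = 0
  conn : ∀ S : Set W, (∀ i ∈ S, ∀ j, M i j ≠ 0 → j ∈ S) → ∀ i ∈ S, ∀ j, j ∈ S
  weight : ∃ ℓ : W → ℤ, (∀ i, 0 < ℓ i) ∧ ∀ j, ∑ i, ℓ i * M i j < 2 * ℓ j

/-- A matrix is connected as soon as every vertex but a root is adjacent to one of smaller
height. -/
lemma connected_of_parent {W : Type*} (M : Matrix W W ℤ) (ρ : W → ℕ) (r : W)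
    (h : ∀ i, i ≠ r → ∃ j, ρ j < ρ i ∧ M i j ≠ 0 ∧ M j i ≠ 0) (S : Set W)
    (hS : ∀ i ∈ S, ∀ j, M i j ≠ 0 → j ∈ S) (i : W) (hi : i ∈ S) (j : W) : j ∈ S := by
  have down : ∀ k : ℕ, ∀ i, ρ i = k → i ∈ S → r ∈ S := by
    intro k
    induction k using Nat.strong_induction_on with
    | _ k ih =>
      intro i hk hi
      by_cases h0 : i = r
      · exact h0 ▸ hi
      · obtain ⟨j, hj, h1, -⟩ := h i h0
        exact ih (ρ j) (hk ▸ hj) j rfl (hS i hi j h1)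
  have h0 : r ∈ S := down (ρ i) i rfl hi
  have up : ∀ k : ℕ, ∀ j, ρ j = k → j ∈ S := by
    intro k
    induction k using Nat.strong_induction_on with
    | _ k ih =>
      intro j hk
      by_cases hj0 : j = r
      · exact hj0 ▸ h0
      · obtain ⟨l, hl, -, h1⟩ := h j hj0
        exact hS l (ih (ρ l) (hk ▸ hl) l rfl) j h1
  exact up (ρ j) j rfl

/-- A matrix on `Fin r` is connected as soon as every vertex but `0` is adjacent to a smaller
one. -/
lemma connected_of_parent_fin {r : ℕ} (M : Matrix (Fin r) (Fin r) ℤ)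
    (h : ∀ i : Fin r, i.val ≠ 0 → ∃ j < i, M i j ≠ 0 ∧ M j i ≠ 0) (S : Set (Fin r))
    (hS : ∀ i ∈ S, ∀ j, M i j ≠ 0 → j ∈ S) (i : Fin r) (hi : i ∈ S) (j : Fin r) : j ∈ S :=
  connected_of_parent M Fin.val ⟨0, i.pos⟩
    (fun k hk => h k fun h0 => hk (Fin.ext h0)) S hS i hi j

section Entries

variable {n : ℕ} (i j : Fin n)

lemma coxeterAdj_A : coxeterAdj (CartanMatrix.A n) i j =
    if i.val + 1 = j.val ∨ j.val + 1 = i.val then 1 else 0 := by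
  simp only [coxeterAdj, CartanMatrix.A, Matrix.sub_apply, Matrix.smul_apply, Matrix.one_apply,
    of_apply, smul_eq_mul]
  grind

/-- On the path `0 - 1 - ⋯ - (n - 1)` the entry `2` of the matrix of `B_n` stands in the last
row. -/
lemma coxeterAdj_B : coxeterAdj (CartanMatrix.B n)ᵀ i j =
    if i.val + 1 = j.val then 1
    else if j.val + 1 = i.val then if i.val + 1 = n then 2 else 1 else 0 := by
  simp only [coxeterAdj, CartanMatrix.B, Matrix.sub_apply, Matrix.smul_apply, Matrix.one_apply,
    of_apply, smul_eq_mul, transpose_apply]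
  grind

lemma coxeterAdj_C : coxeterAdj (CartanMatrix.C n)ᵀ i j =
    if j.val + 1 = i.val then 1
    else if i.val + 1 = j.val then if j.val + 1 = n then 2 else 1 else 0 := by
  simp only [coxeterAdj, CartanMatrix.C, Matrix.sub_apply, Matrix.smul_apply, Matrix.one_apply,
    of_apply, smul_eq_mul, transpose_apply]
  grind

lemma coxeterAdj_D (hn : 3 ≤ n) : coxeterAdj (CartanMatrix.D n) i j =
    if i.val + 1 = j.val ∧ j.val + 2 < n ∨ j.val + 1 = i.val ∧ i.val + 2 < n ∨
      i.val + 3 = n ∧ (j.val + 2 = n ∨ j.val + 1 = n) ∨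
      j.val + 3 = n ∧ (i.val + 2 = n ∨ i.val + 1 = n) then 1 else 0 := by
  simp only [coxeterAdj, CartanMatrix.D, Matrix.sub_apply, Matrix.smul_apply, Matrix.one_apply,
    of_apply, smul_eq_mul]
  grind

end Entries

/-- On a path a weighted row or column sum has at most the two terms next to the diagonal. -/
lemma sum_path {R : Type*} [AddCommMonoid R] {n : ℕ} (f : Fin n → R) (F : ℕ → R) (j : Fin n)
    (hf : ∀ i : Fin n, f i = if i.val + 1 = j.val ∨ j.val + 1 = i.val then F i.val else 0) :
    ∑ i, f i = (if 1 ≤ j.val then F (j.val - 1) else 0) +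
      (if j.val + 1 < n then F (j.val + 1) else 0) := by
  have h1 : ∀ i : Fin n, f i = (if i.val = j.val - 1 ∧ 1 ≤ j.val then F i.val else 0) +
      (if i.val = j.val + 1 then F i.val else 0) := by
    intro i; rw [hf]; grind
  simp only [h1, Finset.sum_add_distrib]
  congr 1
  · split_ifs with h
    · rw [Finset.sum_eq_single ⟨j.val - 1, by omega⟩]
      · simp [h]
      · intro b _ hb
        rw [if_neg]
        intro hc
        exact hb (Fin.ext hc.1)
      · simp
    · exact Finset.sum_eq_zero (fun i _ => by simp [h])
  · split_ifs with h
    · rw [Finset.sum_eq_single ⟨j.val + 1, h⟩]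
      · simp
      · intro b _ hb
        rw [if_neg]
        intro hc
        exact hb (Fin.ext hc)
      · simp
    · refine Finset.sum_eq_zero (fun i _ => ?_)
      rw [if_neg]
      have := i.isLt
      omega

lemma isConnectedFiniteType_A (n : ℕ) :
    IsConnectedFiniteType (coxeterAdj (CartanMatrix.A n)) where
  nonneg i j := by rw [coxeterAdj_A]; split_ifs <;> simp
  symm i j h := by rw [coxeterAdj_A] at h ⊢; grind
  conn := by
    refine connected_of_parent_fin _ (fun i hi => ⟨⟨i.val - 1, by omega⟩, ?_, ?_⟩)
    · rw [Fin.lt_def]; simp; omega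
    · rw [coxeterAdj_A, coxeterAdj_A]; simp; omega
  weight := by
    refine ⟨fun i => (i.val + 1) * (n - i.val), fun i => ?_, fun j => ?_⟩
    · have := i.isLt
      have h : (i.val : ℤ) < n := by exact_mod_cast this
      exact mul_pos (by positivity) (by linarith)
    · rw [sum_path (R := ℤ) _ (fun k => (k + 1) * (n - k)) j (fun i => by rw [coxeterAdj_A]; grind)]
      have := j.isLt
      split_ifs with h1 h2 h2 <;> push_cast [h1]
      · nlinarith
      · have : (n : ℤ) = j.val + 1 := by omega
        rw [this]; nlinarith
      · have : (j.val : ℤ) = 0 := by omega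
        rw [this]; nlinarith
      · have : (j.val : ℤ) = 0 := by omega
        have : (n : ℤ) = 1 := by omega
        simp [*]

lemma isConnectedFiniteType_B (n : ℕ) :
    IsConnectedFiniteType (coxeterAdj (CartanMatrix.B n)ᵀ) where
  nonneg i j := by rw [coxeterAdj_B]; split_ifs <;> simp
  symm i j h := by rw [coxeterAdj_B] at h ⊢; grind
  conn := by
    refine connected_of_parent_fin _ (fun i hi => ⟨⟨i.val - 1, by omega⟩, ?_, ?_⟩)
    · rw [Fin.lt_def]; simp; omega
    · rw [coxeterAdj_B, coxeterAdj_B]; grind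
  weight := by
    refine ⟨fun i => if i.val + 1 = n then n ^ 2 else 2 * ((i.val + 1) * (2 * n - i.val - 1)),
      fun i => ?_, fun j => ?_⟩
    · have := i.isLt
      have h : (i.val : ℤ) < n := by exact_mod_cast this
      dsimp only
      split_ifs
      · have : 0 < n := by omega
        positivity
      · exact mul_pos two_pos (mul_pos (by positivity) (by linarith))
    · rw [sum_path (R := ℤ) _ (fun k => if k + 1 = n then 2 * n ^ 2 else
        2 * ((k + 1) * (2 * n - k - 1))) j (fun i => by rw [coxeterAdj_B]; grind)]
      have := j.isLt
      have hn : 1 ≤ n := by omega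
      by_cases h1 : j.val = 0
      · have h1' : (j.val : ℤ) = 0 := by omega
        by_cases h2 : n = 1
        · subst h2; simp [h1]
        · by_cases h3 : n = 2
          · subst h3; simp [h1]
          · have : (3 : ℤ) ≤ n := by omega
            simp [h1]
            grind
      · have : 1 ≤ j.val := by omega
        obtain ⟨k, hk⟩ : ∃ k, j.val = k + 1 := ⟨j.val - 1, by omega⟩
        simp only [hk]
        by_cases h2 : k + 2 = n
        · have hn' : (n : ℤ) = k + 2 := by omega
          simp [h2, hn']
          grind
        · by_cases h3 : k + 3 = n
          · have hn' : (n : ℤ) = k + 3 := by omega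
            simp [h2, h3, hn', show k + 1 ≠ n by omega, show k + 2 < n by omega]
            nlinarith
          · simp [h2, show k + 1 + 1 ≠ n by omega, show k + 1 + 1 + 1 ≠ n by omega,
              show k + 1 ≠ n by omega, show k + 1 + 1 < n by omega]
            nlinarith

lemma isConnectedFiniteType_C (n : ℕ) :
    IsConnectedFiniteType (coxeterAdj (CartanMatrix.C n)ᵀ) where
  nonneg i j := by rw [coxeterAdj_C]; split_ifs <;> simp
  symm i j h := by rw [coxeterAdj_C] at h ⊢; grind
  conn := by
    refine connected_of_parent_fin _ (fun i hi => ⟨⟨i.val - 1, by omega⟩, ?_, ?_⟩)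
    · rw [Fin.lt_def]; simp; omega
    · rw [coxeterAdj_C, coxeterAdj_C]; grind
  weight := by
    refine ⟨fun i => (i.val + 1) * (2 * n - i.val - 1), fun i => ?_, fun j => ?_⟩
    · have := i.isLt
      have h : (i.val : ℤ) < n := by exact_mod_cast this
      exact mul_pos (by positivity) (by linarith)
    · have := j.isLt
      rw [sum_path (R := ℤ) _ (fun k => if j.val + 1 = n then 2 * ((k + 1) * (2 * n - k - 1)) else
        (k + 1) * (2 * n - k - 1)) j (fun i => by
          have := i.isLt
          rw [coxeterAdj_C]; grind)]
      by_cases h1 : j.val = 0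
      · have h1' : (j.val : ℤ) = 0 := by omega
        by_cases h2 : n = 1
        · subst h2; simp [h1]
        · have : (2 : ℤ) ≤ n := by omega
          simp [h1]
          grind
      · obtain ⟨k, hk⟩ : ∃ k, j.val = k + 1 := ⟨j.val - 1, by omega⟩
        simp only [hk]
        by_cases h2 : k + 2 = n
        · have hn' : (n : ℤ) = k + 2 := by omega
          simp [h2, hn']
          nlinarith
        · simp [h2, show k + 1 + 1 ≠ n by omega, show k + 1 + 1 < n by omega]
          nlinarith

lemma isConnectedFiniteType_D (n : ℕ) (hn : 3 ≤ n) :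
    IsConnectedFiniteType (coxeterAdj (CartanMatrix.D n)) where
  nonneg i j := by rw [coxeterAdj_D _ _ hn]; split_ifs <;> simp
  symm i j h := by rw [coxeterAdj_D _ _ hn] at h ⊢; grind
  conn := by
    refine connected_of_parent_fin _ (fun i hi =>
      ⟨⟨if i.val + 1 = n then n - 3 else i.val - 1, by grind⟩, ?_, ?_⟩)
    · rw [Fin.lt_def]; grind
    · rw [coxeterAdj_D _ _ hn, coxeterAdj_D _ _ hn]; grind
  weight := by
    let F : ℕ → ℤ := fun k => if n ≤ k + 2 then (n - 1) ^ 2 else 2 * ((k + 1) * (2 * n - k - 3))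
    refine ⟨fun i => F i.val, fun i => ?_, fun j => ?_⟩
    · simp only [F]
      split_ifs
      · have : 1 < (n : ℤ) := by omega
        have : 0 < (n : ℤ) - 1 := by linarith
        positivity
      · exact mul_pos two_pos (mul_pos (by positivity) (by omega))
    · have hj := j.isLt
      -- The edge to the last vertex is separated from the path through the other vertices.
      have key : ∀ i : Fin n, F i.val * coxeterAdj (CartanMatrix.D n) i j =
          (if i.val + 1 = j.val ∨ j.val + 1 = i.val then
            (if i.val + 1 = n ∨ j.val + 1 = n then 0 else F i.val) else 0) +
          ((if i.val = n - 1 then if j.val + 3 = n then F (n - 1) else 0 else 0) +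
          (if i.val = n - 3 then if j.val + 1 = n then F (n - 3) else 0 else 0)) := by
        intro i
        rw [coxeterAdj_D _ _ hn]
        have := i.isLt
        grind
      have hsum : ∀ m < n, ∀ c : ℤ, ∑ i : Fin n, (if i.val = m then c else 0) = c := by
        intro m hm c
        rw [Finset.sum_eq_single ⟨m, hm⟩]
        · simp
        · intro b _ hb
          rw [if_neg]
          intro hc
          exact hb (Fin.ext hc)
        · simp
      simp only [key, Finset.sum_add_distrib]
      rw [hsum _ (by omega), hsum _ (by omega),
        sum_path (R := ℤ) _ (fun k => if k + 1 = n ∨ j.val + 1 = n then 0 else F k) j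
          (fun i => rfl)]
      obtain ⟨m, rfl⟩ : ∃ m, n = m + 3 := ⟨n - 3, by omega⟩
      rcases (by omega : j.val = m + 2 ∨ j.val = m + 1 ∨ j.val = m ∨ j.val < m) with h | h | h | h
      · simp [h, F]; nlinarith
      · simp [h, F]; nlinarith
      · rcases Nat.eq_zero_or_pos m with rfl | hm
        · simp [h, F]
        · obtain ⟨l, rfl⟩ : ∃ l, m = l + 1 := ⟨m - 1, by omega⟩
          simp [h, F]
          nlinarith
      · rcases Nat.eq_zero_or_pos j.val with h0 | h0
        · simp [h0, F, show m ≠ 0 by omega]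
        · obtain ⟨l, hl⟩ : ∃ l, j.val = l + 1 := ⟨j.val - 1, by omega⟩
          rw [hl] at h ⊢
          simp [F, show ¬ m + 2 ≤ l by omega, show ¬ m + 3 ≤ l + 1 by omega,
            show l ≠ m + 1 by omega, show ¬ m + 3 ≤ l + 1 + 2 by omega, show l + 1 ≠ m by omega,
            show l ≠ m by omega, show l + 1 ≠ m + 1 by omega]
          split_ifs <;> first | omega | nlinarith

/-- The entry of a matrix as an application of a plain function, a form in which statements about
all entries of a concrete matrix are found to be decidable. -/
def entry {m n : ℕ} (M : Fin m → Fin n → ℤ) (i : Fin m) (j : Fin n) : ℤ := M i j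

lemma isConnectedFiniteType_E₆ : IsConnectedFiniteType (coxeterAdj CartanMatrix.E₆) where
  nonneg := show ∀ i j, 0 ≤ entry (coxeterAdj CartanMatrix.E₆) i j by decide
  symm := show ∀ i j, entry (coxeterAdj CartanMatrix.E₆) i j = 0 →
    entry (coxeterAdj CartanMatrix.E₆) j i = 0 by decide
  conn := connected_of_parent _ ![2, 1, 1, 0, 1, 2] 3 (show ∀ i : Fin 6, i ≠ 3 → ∃ j,
    ![2, 1, 1, 0, 1, 2] j < ![2, 1, 1, 0, 1, 2] i ∧
    entry (coxeterAdj CartanMatrix.E₆) i j ≠ 0 ∧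
      entry (coxeterAdj CartanMatrix.E₆) j i ≠ 0 by decide)
  weight := ⟨![16, 22, 30, 42, 30, 16], by decide, by decide⟩

lemma isConnectedFiniteType_E₇ : IsConnectedFiniteType (coxeterAdj CartanMatrix.E₇) where
  nonneg := show ∀ i j, 0 ≤ entry (coxeterAdj CartanMatrix.E₇) i j by decide
  symm := show ∀ i j, entry (coxeterAdj CartanMatrix.E₇) i j = 0 →
    entry (coxeterAdj CartanMatrix.E₇) j i = 0 by decide
  conn := connected_of_parent _ ![2, 1, 1, 0, 1, 2, 3] 3 (show ∀ i : Fin 7, i ≠ 3 → ∃ j,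
    ![2, 1, 1, 0, 1, 2, 3] j < ![2, 1, 1, 0, 1, 2, 3] i ∧
    entry (coxeterAdj CartanMatrix.E₇) i j ≠ 0 ∧
      entry (coxeterAdj CartanMatrix.E₇) j i ≠ 0 by decide)
  weight := ⟨![34, 49, 66, 96, 75, 52, 27], by decide, by decide⟩

lemma isConnectedFiniteType_E₈ : IsConnectedFiniteType (coxeterAdj CartanMatrix.E₈) where
  nonneg := show ∀ i j, 0 ≤ entry (coxeterAdj CartanMatrix.E₈) i j by decide
  symm := show ∀ i j, entry (coxeterAdj CartanMatrix.E₈) i j = 0 →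
    entry (coxeterAdj CartanMatrix.E₈) j i = 0 by decide
  conn := connected_of_parent _ ![2, 1, 1, 0, 1, 2, 3, 4] 3 (show ∀ i : Fin 8, i ≠ 3 → ∃ j,
    ![2, 1, 1, 0, 1, 2, 3, 4] j < ![2, 1, 1, 0, 1, 2, 3, 4] i ∧
    entry (coxeterAdj CartanMatrix.E₈) i j ≠ 0 ∧
      entry (coxeterAdj CartanMatrix.E₈) j i ≠ 0 by decide)
  weight := ⟨![92, 136, 182, 270, 220, 168, 114, 58], by decide, by decide⟩

lemma isConnectedFiniteType_F₄ : IsConnectedFiniteType (coxeterAdj CartanMatrix.F₄) where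
  nonneg := show ∀ i j, 0 ≤ entry (coxeterAdj CartanMatrix.F₄) i j by decide
  symm := show ∀ i j, entry (coxeterAdj CartanMatrix.F₄) i j = 0 →
    entry (coxeterAdj CartanMatrix.F₄) j i = 0 by decide
  conn := connected_of_parent_fin _ (show ∀ i : Fin 4, i.val ≠ 0 → ∃ j < i,
    entry (coxeterAdj CartanMatrix.F₄) i j ≠ 0 ∧
      entry (coxeterAdj CartanMatrix.F₄) j i ≠ 0 by decide)
  weight := ⟨![16, 30, 42, 22], by decide, by decide⟩

lemma isConnectedFiniteType_G₂ : IsConnectedFiniteType (coxeterAdj CartanMatrix.G₂) where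
  nonneg := show ∀ i j, 0 ≤ entry (coxeterAdj CartanMatrix.G₂) i j by decide
  symm := show ∀ i j, entry (coxeterAdj CartanMatrix.G₂) i j = 0 →
    entry (coxeterAdj CartanMatrix.G₂) j i = 0 by decide
  conn := connected_of_parent_fin _ (show ∀ i : Fin 2, i.val ≠ 0 → ∃ j < i,
    entry (coxeterAdj CartanMatrix.G₂) i j ≠ 0 ∧
      entry (coxeterAdj CartanMatrix.G₂) j i ≠ 0 by decide)
  weight := ⟨![6, 10], by decide, by decide⟩

namespace DynkinType

lemma isConnectedFiniteType_adj (X : DynkinType) : IsConnectedFiniteType X.adj := by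
  cases X with
  | A n hn => exact isConnectedFiniteType_A n
  | B n hn => exact isConnectedFiniteType_B n
  | C n hn => exact isConnectedFiniteType_C n
  | D n hn => exact isConnectedFiniteType_D n (by omega)
  | E₆ => exact isConnectedFiniteType_E₆
  | E₇ => exact isConnectedFiniteType_E₇
  | E₈ => exact isConnectedFiniteType_E₈
  | F₄ => exact isConnectedFiniteType_F₄
  | G₂ => exact isConnectedFiniteType_G₂

lemma adj_le_one {X : DynkinType} (hX : X.IsADE) (i j : Fin X.rank) : X.adj i j ≤ 1 := by
  cases X with
  | A n hn =>
    refine (coxeterAdj_A (n := n) i j).trans_le ?_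
    split_ifs <;> simp
  | B n hn => exact hX.elim
  | C n hn => exact hX.elim
  | D n hn =>
    refine (coxeterAdj_D (n := n) i j (by omega)).trans_le ?_
    split_ifs <;> simp
  | E₆ => exact (show ∀ i j, entry (coxeterAdj CartanMatrix.E₆) i j ≤ 1 by decide) i j
  | E₇ => exact (show ∀ i j, entry (coxeterAdj CartanMatrix.E₇) i j ≤ 1 by decide) i j
  | E₈ => exact (show ∀ i j, entry (coxeterAdj CartanMatrix.E₈) i j ≤ 1 by decide) i j
  | F₄ => exact hX.elim
  | G₂ => exact hX.elim

end DynkinType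

/-- A nonnegative finite type matrix has spectral radius below `2`: no nonzero nonnegative vector
is stretched by a factor of at least `4` under its square. -/
lemma IsConnectedFiniteType.eq_zero_of_four_le {W : Type*} [Fintype W] {M : Matrix W W ℤ}
    (hM : IsConnectedFiniteType M) (p : W → ℝ) (hp : ∀ i, 0 ≤ p i)
    (h : ∀ i, 4 * p i ≤ ∑ j, (M i j : ℝ) * ∑ k, (M j k : ℝ) * p k) (i : W) : p i = 0 := by
  obtain ⟨ℓ, hpos, hℓ⟩ := hM.weight
  -- Pairing with `ℓ` decreases strictly under `M / 2`, by at least half the sum of the entries.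
  have step : ∀ q : W → ℝ, (∀ i, 0 ≤ q i) →
      ∑ i, (ℓ i : ℝ) * ∑ j, (M i j : ℝ) * q j ≤ ∑ j, (2 * (ℓ j : ℝ) - 1) * q j := by
    intro q hq
    simp_rw [Finset.mul_sum]
    rw [Finset.sum_comm]
    refine Finset.sum_le_sum (fun j _ => ?_)
    simp_rw [← mul_assoc]
    rw [← Finset.sum_mul]
    refine mul_le_mul_of_nonneg_right ?_ (hq j)
    have := hℓ j
    have : ∑ i, ℓ i * M i j ≤ 2 * ℓ j - 1 := by omega
    exact_mod_cast this
  -- `q = (M + 2) p` satisfies `M q ≥ 2 q` because `M² p ≥ 4 p`.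
  let q : W → ℝ := fun i => ∑ j, (M i j : ℝ) * p j + 2 * p i
  have hq : ∀ i, 0 ≤ q i := fun i => add_nonneg
    (Finset.sum_nonneg fun j _ => mul_nonneg (by exact_mod_cast hM.nonneg i j) (hp j))
    (mul_nonneg two_pos.le (hp i))
  have hq2 : ∀ i, 2 * q i ≤ ∑ j, (M i j : ℝ) * q j := by
    intro i
    have h1 : ∑ j, (M i j : ℝ) * q j = ∑ j, (M i j : ℝ) * ∑ k, (M j k : ℝ) * p k +
        2 * ∑ j, (M i j : ℝ) * p j := by
      simp only [q, mul_add, Finset.sum_add_distrib, Finset.mul_sum]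
      congr 1
      exact Finset.sum_congr rfl fun j _ => by ring
    rw [h1]
    have := h i
    simp only [q]
    linarith
  have h2 : ∑ i, (ℓ i : ℝ) * (2 * q i) ≤ ∑ j, (2 * (ℓ j : ℝ) - 1) * q j :=
    (Finset.sum_le_sum fun i _ => mul_le_mul_of_nonneg_left (hq2 i)
      (by exact_mod_cast (hpos i).le)).trans (step q hq)
  have h3 : ∑ i, q i ≤ 0 := by
    have : ∑ j, (2 * (ℓ j : ℝ) - 1) * q j = ∑ i, (ℓ i : ℝ) * (2 * q i) - ∑ i, q i := by
      rw [← Finset.sum_sub_distrib]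
      exact Finset.sum_congr rfl fun j _ => by ring
    linarith
  have h4 : q i ≤ 0 := (Finset.single_le_sum (fun j _ => hq j) (Finset.mem_univ i)).trans h3
  have h5 : 0 ≤ ∑ j, (M i j : ℝ) * p j :=
    Finset.sum_nonneg fun j _ => mul_nonneg (by exact_mod_cast hM.nonneg i j) (hp j)
  have := hp i
  simp only [q] at h4
  linarith

/-! ### Paths that are cut out by an intertwiner -/

/-- Two nonnegative integer vectors with the same support, such as a row and the corresponding
column of a Coxeter adjacency matrix. -/
structure IsPair {W : Type*} (f g : W → ℤ) : Prop where
  left : ∀ w, 0 ≤ f w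
  right : ∀ w, 0 ≤ g w
  iff : ∀ w, f w = 0 ↔ g w = 0

namespace IsPair

variable {W : Type*} [Fintype W] [DecidableEq W] {f g : W → ℤ}

lemma dot_nonneg (h : IsPair f g) : 0 ≤ f ⬝ᵥ g :=
  Finset.sum_nonneg fun w _ => mul_nonneg (h.left w) (h.right w)

lemma eq_zero_of_dot (h : IsPair f g) (h0 : f ⬝ᵥ g = 0) : f = 0 ∧ g = 0 := by
  have h1 : ∀ w, f w * g w = 0 := fun w =>
    (Finset.sum_eq_zero_iff_of_nonneg fun w _ => mul_nonneg (h.left w) (h.right w)).1 h0 w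
      (Finset.mem_univ w)
  have h2 : ∀ w, f w = 0 := fun w => (mul_eq_zero.1 (h1 w)).elim id (h.iff w).2
  exact ⟨funext h2, funext fun w => (h.iff w).1 (h2 w)⟩

/-- The coordinate `y` of a pair can be split off. -/
lemma split (h : IsPair f g) (y : W) : ∃ f' g' : W → ℤ, IsPair f' g' ∧
    f' y = 0 ∧ g' y = 0 ∧ f = Pi.single y (f y) + f' ∧ g = Pi.single y (g y) + g' ∧
    f ⬝ᵥ g = f y * g y + f' ⬝ᵥ g' := by
  refine ⟨Function.update f y 0, Function.update g y 0, ⟨?_, ?_, ?_⟩, by simp, by simp,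
    ?_, ?_, ?_⟩
  · intro w
    by_cases hw : w = y
    · subst hw; simp
    · simp [hw, h.left w]
  · intro w
    by_cases hw : w = y
    · subst hw; simp
    · simp [hw, h.right w]
  · intro w
    by_cases hw : w = y
    · subst hw; simp
    · simp [hw, h.iff w]
  · ext w
    by_cases hw : w = y
    · subst hw; simp
    · simp [hw]
  · ext w
    by_cases hw : w = y
    · subst hw; simp
    · simp [hw]
  · simp only [dotProduct]
    rw [← Finset.add_sum_erase _ _ (Finset.mem_univ y),
      ← Finset.add_sum_erase (a := y) (s := Finset.univ)
        (f := fun w => Function.update f y 0 w * Function.update g y 0 w) (Finset.mem_univ y)]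
    simp only [Function.update_self, mul_zero, zero_add, add_right_inj]
    refine Finset.sum_congr rfl fun w hw => ?_
    simp [Finset.ne_of_mem_erase hw]

/-- A pair with positive inner product splits off a vertex of its support. -/
lemma peel (h : IsPair f g) (h0 : 0 < f ⬝ᵥ g) : ∃ (y : W) (f' g' : W → ℤ), IsPair f' g' ∧
    f' y = 0 ∧ g' y = 0 ∧ f = Pi.single y (f y) + f' ∧ g = Pi.single y (g y) + g' ∧
    1 ≤ f y ∧ 1 ≤ g y ∧ f ⬝ᵥ g = f y * g y + f' ⬝ᵥ g' := by
  obtain ⟨y, hy⟩ : ∃ y, f y ≠ 0 := by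
    by_contra! hc
    exact h0.ne' (Finset.sum_eq_zero fun w _ => by simp [hc w])
  have hy' : g y ≠ 0 := fun hg => hy ((h.iff y).2 hg)
  obtain ⟨f', g', h1, h2, h3, h4, h5, h6⟩ := h.split y
  have := h.left y
  have := h.right y
  exact ⟨y, f', g', h1, h2, h3, h4, h5, by omega, by omega, h6⟩

lemma dot_eq_one (h : IsPair f g) (h1 : f ⬝ᵥ g = 1) :
    ∃ y, f = Pi.single y 1 ∧ g = Pi.single y 1 := by
  obtain ⟨y, f', g', h', -, -, hf, hg, hfy, hgy, hd⟩ := h.peel (by omega)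
  have h2 := h'.dot_nonneg
  have h3 : f y * g y = 1 := by nlinarith
  obtain ⟨rfl, rfl⟩ := h'.eq_zero_of_dot (by omega)
  have h4 : f y = 1 := by nlinarith
  have h5 : g y = 1 := by nlinarith
  exact ⟨y, by rw [hf, h4, add_zero], by rw [hg, h5, add_zero]⟩

lemma dot_eq_two (h : IsPair f g) (h2 : f ⬝ᵥ g = 2) :
    (∃ y z, y ≠ z ∧ f = Pi.single y 1 + Pi.single z 1 ∧ g = Pi.single y 1 + Pi.single z 1) ∨
    ∃ y p q, p * q = 2 ∧ 1 ≤ p ∧ 1 ≤ q ∧ f = Pi.single y p ∧ g = Pi.single y q := by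
  obtain ⟨y, f', g', h', hf0, -, hf, hg, hfy, hgy, hd⟩ := h.peel (by omega)
  have h3 := h'.dot_nonneg
  have h4 : 1 ≤ f y * g y := by nlinarith
  rcases (by omega : f y * g y = 1 ∨ f y * g y = 2) with h5 | h5
  · left
    obtain ⟨z, hz, hz'⟩ := h'.dot_eq_one (by omega)
    have h6 : f y = 1 := by nlinarith
    have h7 : g y = 1 := by nlinarith
    refine ⟨y, z, ?_, by rw [hf, h6, hz], by rw [hg, h7, hz']⟩
    rintro rfl
    simp [hz] at hf0
  · right
    obtain ⟨rfl, rfl⟩ := h'.eq_zero_of_dot (by omega)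
    exact ⟨y, f y, g y, h5, hfy, hgy, by simpa using hf, by simpa using hg⟩

/-- Unlike `1` and `2`, the value `3` leaves several possibilities: only the dichotomy between a
place where both vectors are `1` and a single common place is recorded. -/
lemma dot_eq_three (h : IsPair f g) (h3 : f ⬝ᵥ g = 3) :
    (∃ y, f y = 1 ∧ g y = 1) ∨
    ∃ y p q, p * q = 3 ∧ 1 ≤ p ∧ 1 ≤ q ∧ f = Pi.single y p ∧ g = Pi.single y q := by
  obtain ⟨y, f', g', h', hf0, hg0, hf, hg, hfy, hgy, hd⟩ := h.peel (by omega)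
  have h3 := h'.dot_nonneg
  have h4 : 1 ≤ f y * g y := by nlinarith
  rcases (by omega : f y * g y = 1 ∨ f y * g y = 2 ∨ f y * g y = 3) with h5 | h5 | h5
  · exact Or.inl ⟨y, by nlinarith, by nlinarith⟩
  · left
    obtain ⟨z, hz, hz'⟩ := h'.dot_eq_one (by omega)
    have hzy : z ≠ y := by rintro rfl; simp [hz] at hf0
    exact ⟨z, by rw [hf, hz]; simp [hzy], by rw [hg, hz']; simp [hzy]⟩
  · right
    obtain ⟨rfl, rfl⟩ := h'.eq_zero_of_dot (by omega)
    exact ⟨y, f y, g y, h5, hfy, hgy, by simpa using hf, by simpa using hg⟩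

end IsPair

/-- A family of distinct vertices that is closed under adjacency and on which a connected matrix
`Y` restricts to `M` exhibits `Y` as a relabelling of `M`. -/
lemma IsConnectedFiniteType.exists_equiv {W : Type*} [Fintype W] {Y : Matrix W W ℤ}
    (hY : IsConnectedFiniteType Y) {r : ℕ} [NeZero r] (M : Matrix (Fin r) (Fin r) ℤ)
    (G : ℕ → W) (hG : ∀ i j : Fin r, G i = G j → i = j)
    (hM : ∀ i j : Fin r, Y (G i) (G j) = M i j)
    (hc : ∀ (i : Fin r) w, Y (G i) w ≠ 0 → ∃ j : Fin r, G j = w) :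
    ∃ φ : W ≃ Fin r, Y = M.submatrix φ φ ∧ ∀ i : Fin r, φ (G i) = i := by
  have hs : Function.Surjective (fun i : Fin r => G i) := by
    intro w
    refine hY.conn (Set.range fun i : Fin r => G i) ?_ (G (0 : Fin r)) ⟨0, rfl⟩ w
    rintro _ ⟨i, rfl⟩ w hw
    obtain ⟨j, hj⟩ := hc i w hw
    exact ⟨j, hj⟩
  let ψ : Fin r ≃ W := Equiv.ofBijective (fun i : Fin r => G i) ⟨fun i j h => hG i j h, hs⟩
  refine ⟨ψ.symm, ?_, fun i => ψ.symm_apply_apply i⟩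
  ext v w
  obtain ⟨i, rfl⟩ := ψ.surjective v
  obtain ⟨j, rfl⟩ := ψ.surjective w
  rw [submatrix_apply, ψ.symm_apply_apply, ψ.symm_apply_apply]
  exact hM i j

/-- The rows of an intertwiner out of `B_{m+2}`: `a k` is its `k`-th row, `b k` the `k`-th column
of the intertwiner in the opposite direction, except that the last column is doubled, so that
both sequences satisfy the Chebyshev recursion. The inner products say that the product of the
two intertwiners is the square of the Coxeter adjacency matrix of `B_{m+2}`. -/
structure IsPathRep {W : Type*} [Fintype W] [DecidableEq W] (Y : Matrix W W ℤ) (m : ℕ)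
    (a b : ℕ → W → ℤ) : Prop where
  conn : IsConnectedFiniteType Y
  diag : ∀ w, Y w w = 0
  pair : ∀ k ≤ m + 1, IsPair (a k) (b k)
  a_one : a 1 = a 0 ᵥ* Y
  b_one : b 1 = b 0 ᵥ* Yᵀ
  a_rec : ∀ k < m, a (k + 2) = a (k + 1) ᵥ* Y - a k
  b_rec : ∀ k < m, b (k + 2) = b (k + 1) ᵥ* Yᵀ - b k
  a_last : a (m + 1) ᵥ* Y = (2 : ℤ) • a m
  b_last : b (m + 1) ᵥ* Yᵀ = (2 : ℤ) • b m
  dot_zero : a 0 ⬝ᵥ b 0 = 1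
  dot_mid : ∀ k, 1 ≤ k → k < m → a k ⬝ᵥ b k = 2
  dot_branch : a m ⬝ᵥ b m = 3
  dot_last : a (m + 1) ⬝ᵥ b (m + 1) = 4
  even : ∀ w, 2 ∣ b (m + 1) w

/-- `g 0, …, g k` is a path in `Y` starting at a leaf, all of whose neighbours, except for those
of `g k`, lie on the path. -/
structure IsPathIn {W : Type*} [DecidableEq W] (Y : Matrix W W ℤ) (g : ℕ → W) (k : ℕ) : Prop where
  inj : ∀ i ≤ k, ∀ j ≤ k, g i = g j → i = j
  row : ∀ j < k, Y (g j) = (if 1 ≤ j then Pi.single (g (j - 1)) 1 else 0) + Pi.single (g (j + 1)) 1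
  col : ∀ j < k, Yᵀ (g j) =
    (if 1 ≤ j then Pi.single (g (j - 1)) 1 else 0) + Pi.single (g (j + 1)) 1

section Path

variable {W : Type*} [Fintype W] [DecidableEq W] {Y : Matrix W W ℤ}

lemma IsConnectedFiniteType.pair (hY : IsConnectedFiniteType Y) (z : W) : IsPair (Y z) (Yᵀ z) :=
  ⟨fun w => hY.nonneg z w, fun w => hY.nonneg w z, fun w => ⟨hY.symm z w, hY.symm w z⟩⟩

/-- At the end of a path with at least one edge, the neighbours off the path account for all of
the local degree but `1`. -/
lemma IsPathIn.remainder (hY : IsConnectedFiniteType Y) (hd : ∀ w, Y w w = 0) {g : ℕ → W} {k : ℕ}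
    (hg : IsPathIn Y g (k + 1)) : ∃ r s : W → ℤ, IsPair r s ∧
      Y (g (k + 1)) = Pi.single (g k) 1 + r ∧ Yᵀ (g (k + 1)) = Pi.single (g k) 1 + s ∧
      (∀ j ≤ k + 1, r (g j) = 0) ∧
      Y (g (k + 1)) ⬝ᵥ Yᵀ (g (k + 1)) = 1 + r ⬝ᵥ s := by
  have e1 : ∀ l ≤ k + 1, (Pi.single (g l) 1 : W → ℤ) (g (k + 1)) = if l = k + 1 then 1 else 0 := by
    intro l hl
    rw [Pi.single_apply]
    by_cases hlk : l = k + 1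
    · simp [hlk]
    · rw [if_neg, if_neg hlk]
      exact fun hc => hlk (hg.inj l hl (k + 1) le_rfl hc.symm)
  have e2 : ∀ j ≤ k, ((if 1 ≤ j then Pi.single (g (j - 1)) 1 else 0) + Pi.single (g (j + 1)) 1 :
      W → ℤ) (g (k + 1)) = if j = k then 1 else 0 := by
    intro j hj
    rw [Pi.add_apply, e1 _ (by omega)]
    have e3 : (if 1 ≤ j then Pi.single (g (j - 1)) 1 else 0 : W → ℤ) (g (k + 1)) = 0 := by
      split_ifs with h2
      · rw [e1 _ (by omega), if_neg (by omega)]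
      · rfl
    rw [e3, zero_add]
    simp
  have h1 : ∀ j ≤ k, Y (g (k + 1)) (g j) = if j = k then 1 else 0 := fun j hj => by
    rw [← e2 j hj, ← hg.col j (by omega), transpose_apply]
  have h2 : ∀ j ≤ k, Yᵀ (g (k + 1)) (g j) = if j = k then 1 else 0 := fun j hj => by
    rw [← e2 j hj, ← hg.row j (by omega), transpose_apply]
  have hp := hY.pair (g (k + 1))
  have f1 : Y (g (k + 1)) (g k) = 1 := by simpa using h1 k le_rfl
  have f2 : Yᵀ (g (k + 1)) (g k) = 1 := by simpa using h2 k le_rfl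
  obtain ⟨r, s, hrs, hr0, -, hr, hs, hdot⟩ := hp.split (g k)
  rw [f1] at hr hdot
  rw [f2] at hs hdot
  refine ⟨r, s, hrs, hr, hs, fun j hj => ?_, hdot⟩
  by_cases hjk : g j = g k
  · rw [hjk, hr0]
  · have h3 : Y (g (k + 1)) (g j) = 0 := by
      rcases Nat.lt_or_ge j (k + 1) with h | h
      · rw [h1 j (by omega), if_neg]
        rintro rfl
        exact hjk rfl
      · obtain rfl : j = k + 1 := by omega
        exact hd _
    rw [hr, Pi.add_apply, Pi.single_apply, if_neg hjk, zero_add] at h3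
    exact h3

namespace IsPathRep

variable {m : ℕ} {a b : ℕ → W → ℤ}

/-- If the first row of the intertwiner is supported at the neighbour `y` of a simple leaf `y₀`,
its rows are the rows of `Y` along a path that starts at `y₀`. -/
lemma exists_path (h : IsPathRep Y m a b) {y₀ y : W} (ha : a 0 = Pi.single y 1)
    (hb : b 0 = Pi.single y 1) (hr : Y y₀ = Pi.single y 1) (hc : Yᵀ y₀ = Pi.single y 1) :
    ∀ k, 1 ≤ k → k ≤ m → ∃ g : ℕ → W, g 1 = y ∧ IsPathIn Y g k ∧
      ∀ j ≤ k, a j = Y (g j) ∧ b j = Yᵀ (g j) := by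
  intro k hk1
  induction k, hk1 using Nat.le_induction with
  | base =>
    intro hm
    have hne : y₀ ≠ y := by
      rintro rfl
      have := h.diag y₀
      rw [hr] at this
      simp at this
    refine ⟨fun i => if i = 0 then y₀ else y, by simp, ⟨?_, ?_, ?_⟩, ?_⟩
    · intro i hi j hj hij
      rcases (by omega : i = 0 ∨ i = 1) with rfl | rfl <;>
        rcases (by omega : j = 0 ∨ j = 1) with rfl | rfl <;> simp_all [hne.symm]
    · intro j hj
      obtain rfl : j = 0 := by omega
      simpa using hr
    · intro j hj
      obtain rfl : j = 0 := by omega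
      simpa using hc
    · intro j hj
      rcases (by omega : j = 0 ∨ j = 1) with rfl | rfl
      · simp [ha, hb, hr, hc]
      · simp only [one_ne_zero, if_false]
        rw [h.a_one, h.b_one, ha, hb]
        simp [row_def]
  | succ k hk ih =>
    intro hm
    obtain ⟨g, hg1, hg, hab⟩ := ih (by omega)
    obtain ⟨l, rfl⟩ : ∃ l, k = l + 1 := ⟨k - 1, by omega⟩
    obtain ⟨r, s, hrs, hr', hs', hr0, hdot⟩ := hg.remainder h.conn h.diag
    have h2 := h.dot_mid (l + 1) (by omega) (by omega)
    rw [(hab (l + 1) le_rfl).1, (hab (l + 1) le_rfl).2, hdot] at h2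
    -- The inner product `2` of row and column leaves exactly one further neighbour.
    obtain ⟨z, rfl, rfl⟩ := hrs.dot_eq_one (by omega)
    have hz : ∀ j ≤ l + 1, g j ≠ z := by
      intro j hj hc
      have := hr0 j hj
      rw [hc] at this
      simp at this
    refine ⟨Function.update g (l + 2) z, by simp [hg1], ⟨?_, ?_, ?_⟩, ?_⟩
    · intro i hi j hj hij
      by_cases h1 : i = l + 2 <;> by_cases h2 : j = l + 2
      · omega
      · rw [h1, Function.update_self, Function.update_of_ne h2] at hij
        exact (hz j (by omega) hij.symm).elim
      · rw [h2, Function.update_self, Function.update_of_ne h1] at hij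
        exact (hz i (by omega) hij).elim
      · rw [Function.update_of_ne h1, Function.update_of_ne h2] at hij
        exact hg.inj i (by omega) j (by omega) hij
    · intro j hj
      by_cases h1 : j = l + 1
      · subst h1
        simpa using hr'
      · rw [Function.update_of_ne (by omega), Function.update_of_ne (by omega),
          Function.update_of_ne (by omega)]
        exact hg.row j (by omega)
    · intro j hj
      by_cases h1 : j = l + 1
      · subst h1
        simpa using hs'
      · rw [Function.update_of_ne (by omega), Function.update_of_ne (by omega),
          Function.update_of_ne (by omega)]
        exact hg.col j (by omega)
    · intro j hj
      by_cases h1 : j = l + 2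
      · subst h1
        rw [Function.update_self, h.a_rec l (by omega), h.b_rec l (by omega),
          (hab (l + 1) le_rfl).1, (hab (l + 1) le_rfl).2, hr', hs',
          (hab l (by omega)).1, (hab l (by omega)).2]
        simp [add_vecMul, row_def]
      · rw [Function.update_of_ne h1]
        exact hab j (by omega)

end IsPathRep

end Path

/-! ### Recognising `D`, `B` and `C` along a path -/

section Recognition

variable {W : Type*} [Fintype W] [DecidableEq W] {Y : Matrix W W ℤ}

lemma IsPair.eq_single {f g : W → ℤ} (h : IsPair f g) {w : W} (hw : f ⬝ᵥ g = f w * g w) :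
    f = Pi.single w (f w) ∧ g = Pi.single w (g w) := by
  have h1 : ∀ v, v ≠ w → f v * g v = 0 := by
    have h2 : ∑ v ∈ Finset.univ.erase w, f v * g v = 0 := by
      rw [dotProduct, ← Finset.add_sum_erase _ _ (Finset.mem_univ w)] at hw
      omega
    intro v hv
    exact (Finset.sum_eq_zero_iff_of_nonneg fun v _ => mul_nonneg (h.left v) (h.right v)).1 h2 v
      (Finset.mem_erase.2 ⟨hv, Finset.mem_univ v⟩)
  have h3 : ∀ v, v ≠ w → f v = 0 := fun v hv => (mul_eq_zero.1 (h1 v hv)).elim id (h.iff v).2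
  constructor
  · ext v
    by_cases hv : v = w
    · subst hv; simp
    · simp [hv, h3 v hv]
  · ext v
    by_cases hv : v = w
    · subst hv; simp
    · simp [hv, (h.iff v).1 (h3 v hv)]

lemma single_injective_apply {N : ℕ} {G : ℕ → W} (hG : ∀ i < N, ∀ j < N, G i = G j → i = j)
    (c : ℤ) : ∀ i < N, ∀ j < N, (Pi.single (G i) c : W → ℤ) (G j) = if i = j then c else 0 := by
  intro i hi j hj
  rw [Pi.single_apply]
  by_cases hij : i = j
  · simp [hij]
  · rw [if_neg hij, if_neg]
    exact fun hc => hij (hG j hj i hi hc).symm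

/-- A path that ends in two further leaves is a diagram `D`. -/
lemma exists_equiv_D (hY : IsConnectedFiniteType Y) {g : ℕ → W} {l : ℕ}
    (hg : IsPathIn Y g (l + 1)) {z z' : W} (hzz : z ≠ z') (hz : ∀ j ≤ l + 1, g j ≠ z)
    (hz' : ∀ j ≤ l + 1, g j ≠ z')
    (h1 : Y (g (l + 1)) = Pi.single (g l) 1 + (Pi.single z 1 + Pi.single z' 1))
    (h2 : Y z = Pi.single (g (l + 1)) 1) (h3 : Y z' = Pi.single (g (l + 1)) 1) :
    ∃ φ : W ≃ Fin (l + 4), Y = (coxeterAdj (CartanMatrix.D (l + 4))).submatrix φ φ ∧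
      (φ (g 1)).val = 1 := by
  let G : ℕ → W := fun k => if k ≤ l + 1 then g k else if k = l + 2 then z else z'
  have hG : ∀ i < l + 4, ∀ j < l + 4, G i = G j → i = j := by
    intro i hi j hj hij
    simp only [G] at hij
    split_ifs at hij with a1 a2 a3 a4 a5 a6 a7
    all_goals first
      | exact hg.inj _ a1 _ a2 hij
      | omega
      | exact absurd hij (hz _ (by assumption))
      | exact absurd hij (hz' _ (by assumption))
      | exact absurd hij.symm (hz _ (by assumption))
      | exact absurd hij.symm (hz' _ (by assumption))
      | exact absurd hij hzz
      | exact absurd hij.symm hzz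
  have hs := single_injective_apply hG 1
  have r1 : ∀ j < l + 1, Y (G j) =
      (if 1 ≤ j then Pi.single (G (j - 1)) 1 else 0) + Pi.single (G (j + 1)) 1 := by
    intro j hj
    simp only [G, if_pos (show j ≤ l + 1 by omega), if_pos (show j - 1 ≤ l + 1 by omega),
      if_pos (show j + 1 ≤ l + 1 by omega)]
    exact hg.row j hj
  have r2 : Y (G (l + 1)) =
      Pi.single (G l) 1 + (Pi.single (G (l + 2)) 1 + Pi.single (G (l + 3)) 1) := by
    simpa [G] using h1
  have r3 : Y (G (l + 2)) = Pi.single (G (l + 1)) 1 := by simpa [G] using h2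
  have r4 : Y (G (l + 3)) = Pi.single (G (l + 1)) 1 := by simpa [G] using h3
  have hM' : ∀ i j : Fin _, Y (G i) (G j) = (coxeterAdj (CartanMatrix.D (l + 4))) i j := by
    rintro ⟨i, hi⟩ ⟨j, hj⟩
    rw [coxeterAdj_D _ _ (by omega)]
    simp only
    rcases (by omega : i < l + 1 ∨ i = l + 1 ∨ i = l + 2 ∨ i = l + 3) with h | rfl | rfl | rfl
    · rw [r1 i h, Pi.add_apply, hs _ (by omega) _ hj]
      split_ifs <;> first | omega | (rw [hs _ (by omega) _ hj]; split_ifs <;> omega) | simp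
    · rw [r2, Pi.add_apply, Pi.add_apply, hs _ (by omega) _ hj, hs _ (by omega) _ hj,
        hs _ (by omega) _ hj]
      split_ifs <;> omega
    · rw [r3, hs _ (by omega) _ hj]
      split_ifs <;> omega
    · rw [r4, hs _ (by omega) _ hj]
      split_ifs <;> omega
  have hc' : ∀ (i : Fin (l + 4)) w, Y (G i) w ≠ 0 → ∃ j : Fin (l + 4), G j = w := by
    rintro ⟨i, hi⟩ w hw
    by_contra! hc
    have hs0 : ∀ k < l + 4, (Pi.single (G k) 1 : W → ℤ) w = 0 := fun k hk => by
      rw [Pi.single_apply, if_neg]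
      exact fun h => hc ⟨k, hk⟩ h.symm
    apply hw
    simp only
    rcases (by omega : i < l + 1 ∨ i = l + 1 ∨ i = l + 2 ∨ i = l + 3) with h | rfl | rfl | rfl
    · rw [r1 i h, Pi.add_apply, hs0 _ (by omega)]
      split_ifs
      · rw [hs0 _ (by omega), add_zero]
      · rfl
    · rw [r2, Pi.add_apply, Pi.add_apply, hs0 _ (by omega), hs0 _ (by omega), hs0 _ (by omega)]
      rfl
    · rw [r3, hs0 _ (by omega)]
    · rw [r4, hs0 _ (by omega)]
  obtain ⟨φ, hφ, hφ'⟩ := hY.exists_equiv (coxeterAdj (CartanMatrix.D (l + 4))) G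
    (fun i j h => Fin.ext (hG _ i.2 _ j.2 h)) hM' hc'
  refine ⟨φ, hφ, ?_⟩
  have := hφ' ⟨1, by omega⟩
  simp only [G, if_pos (show 1 ≤ l + 1 by omega)] at this
  rw [this]

/-- A path whose last edge carries the two entries `p` and `q`. -/
lemma exists_equiv_path (hY : IsConnectedFiniteType Y) {g : ℕ → W} {l : ℕ}
    (hg : IsPathIn Y g (l + 1)) {z : W} (hz : ∀ j ≤ l + 1, g j ≠ z) {p q : ℤ}
    (h1 : Y (g (l + 1)) = Pi.single (g l) 1 + Pi.single z p)
    (h2 : Y z = Pi.single (g (l + 1)) q) (M : Matrix (Fin (l + 3)) (Fin (l + 3)) ℤ)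
    (hM : ∀ i j, M i j = if i.val + 1 = j.val then if j.val = l + 2 then p else 1
      else if j.val + 1 = i.val then if i.val = l + 2 then q else 1 else 0) :
    ∃ φ : W ≃ Fin (l + 3), Y = M.submatrix φ φ ∧ (φ (g 1)).val = 1 := by
  let G : ℕ → W := fun k => if k ≤ l + 1 then g k else z
  have hG : ∀ i < l + 3, ∀ j < l + 3, G i = G j → i = j := by
    intro i hi j hj hij
    simp only [G] at hij
    split_ifs at hij with a1 a2 a3
    all_goals first
      | exact hg.inj _ a1 _ a2 hij
      | omega
      | exact absurd hij (hz _ (by assumption))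
      | exact absurd hij.symm (hz _ (by assumption))
  have hs := single_injective_apply hG
  have r1 : ∀ j < l + 1, Y (G j) =
      (if 1 ≤ j then Pi.single (G (j - 1)) 1 else 0) + Pi.single (G (j + 1)) 1 := by
    intro j hj
    simp only [G, if_pos (show j ≤ l + 1 by omega), if_pos (show j - 1 ≤ l + 1 by omega),
      if_pos (show j + 1 ≤ l + 1 by omega)]
    exact hg.row j hj
  have r2 : Y (G (l + 1)) = Pi.single (G l) 1 + Pi.single (G (l + 2)) p := by
    simpa [G] using h1
  have r3 : Y (G (l + 2)) = Pi.single (G (l + 1)) q := by simpa [G] using h2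
  have hM' : ∀ i j : Fin _, Y (G i) (G j) = M i j := by
    rintro ⟨i, hi⟩ ⟨j, hj⟩
    rw [hM]
    simp only
    rcases (by omega : i < l + 1 ∨ i = l + 1 ∨ i = l + 2) with h | rfl | rfl
    · rw [r1 i h, Pi.add_apply, hs _ _ (by omega) _ hj]
      split_ifs <;> first | omega | (rw [hs _ _ (by omega) _ hj]; split_ifs <;> omega) | simp
    · rw [r2, Pi.add_apply, hs _ _ (by omega) _ hj, hs _ _ (by omega) _ hj]
      split_ifs <;> omega
    · rw [r3, hs _ _ (by omega) _ hj]
      split_ifs <;> omega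
  have hc' : ∀ (i : Fin (l + 3)) w, Y (G i) w ≠ 0 → ∃ j : Fin (l + 3), G j = w := by
    rintro ⟨i, hi⟩ w hw
    by_contra! hc
    have hs0 : ∀ c, ∀ k < l + 3, (Pi.single (G k) c : W → ℤ) w = 0 := fun c k hk => by
      rw [Pi.single_apply, if_neg]
      exact fun h => hc ⟨k, hk⟩ h.symm
    apply hw
    simp only
    rcases (by omega : i < l + 1 ∨ i = l + 1 ∨ i = l + 2) with h | rfl | rfl
    · rw [r1 i h, Pi.add_apply, hs0 _ _ (by omega)]
      split_ifs
      · rw [hs0 _ _ (by omega), add_zero]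
      · rfl
    · rw [r2, Pi.add_apply, hs0 _ _ (by omega), hs0 _ _ (by omega)]
      rfl
    · rw [r3, hs0 _ _ (by omega)]
  obtain ⟨φ, hφ, hφ'⟩ := hY.exists_equiv M G
    (fun i j h => Fin.ext (hG _ i.2 _ j.2 h)) hM' hc'
  refine ⟨φ, hφ, ?_⟩
  have := hφ' ⟨1, by omega⟩
  simp only [G, if_pos (show 1 ≤ l + 1 by omega)] at this
  rw [this]

namespace IsPathRep

variable {m : ℕ} {a b : ℕ → W → ℤ}

/-- If the first row of the intertwiner is supported at the neighbour `y` of a simple leaf, then the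
path that starts at this leaf ends, `m` steps later, in a fork or in a double edge. -/
lemma equiv_of_leaf (h : IsPathRep Y m a b) (hm : 1 ≤ m) {y₀ y : W} (ha : a 0 = Pi.single y 1)
    (hb : b 0 = Pi.single y 1) (hr : Y y₀ = Pi.single y 1) (hc : Yᵀ y₀ = Pi.single y 1) :
    (∃ φ : W ≃ Fin (m + 3), Y = (coxeterAdj (CartanMatrix.D (m + 3))).submatrix φ φ ∧
      (φ y).val = 1) ∨
    (∃ φ : W ≃ Fin (m + 2), Y = (coxeterAdj (CartanMatrix.B (m + 2))ᵀ).submatrix φ φ ∧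
      (φ y).val = 1) ∨
    (∃ φ : W ≃ Fin (m + 2), Y = (coxeterAdj (CartanMatrix.C (m + 2))ᵀ).submatrix φ φ ∧
      (φ y).val = 1) := by
  obtain ⟨l, rfl⟩ : ∃ l, m = l + 1 := ⟨m - 1, by omega⟩
  obtain ⟨g, rfl, hg, hab⟩ := h.exists_path ha hb hr hc (l + 1) hm le_rfl
  obtain ⟨r, s, hrs, hr', hs', hr0, hdot⟩ := hg.remainder h.conn h.diag
  have h3 := h.dot_branch
  rw [(hab (l + 1) le_rfl).1, (hab (l + 1) le_rfl).2, hdot] at h3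
  have ea : a (l + 2) = r ᵥ* Y := by
    rw [h.a_rec l (by omega), (hab (l + 1) le_rfl).1, hr', (hab l (by omega)).1]
    simp [add_vecMul, row_def]
  have eb : b (l + 2) = s ᵥ* Yᵀ := by
    rw [h.b_rec l (by omega), (hab (l + 1) le_rfl).2, hs', (hab l (by omega)).2]
    simp [add_vecMul, row_def]
  have hp := h.pair (l + 2) le_rfl
  have h4 : a (l + 2) ⬝ᵥ b (l + 2) = 4 := h.dot_last
  have hne : ∀ z, r z ≠ 0 → ∀ j ≤ l + 1, g j ≠ z := by
    rintro _ hz j hj rfl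
    exact hz (hr0 j hj)
  rcases hrs.dot_eq_two (by omega) with ⟨z, z', hzz, rfl, rfl⟩ | ⟨z, p, q, hpq, hp1, hq1, rfl, rfl⟩
  · left
    have n1 := hne z (by simp [hzz])
    have n2 := hne z' (by simp [hzz])
    have v1 : Y z (g (l + 1)) = 1 := by
      rw [← transpose_apply Y, hs']; simp [hzz, (n1 l (by omega)).symm]
    have v2 : Y z' (g (l + 1)) = 1 := by
      rw [← transpose_apply Y, hs']; simp [hzz.symm, (n2 l (by omega)).symm]
    have v3 : Yᵀ z (g (l + 1)) = 1 := by
      rw [transpose_apply, hr']; simp [hzz, (n1 l (by omega)).symm]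
    have v4 : Yᵀ z' (g (l + 1)) = 1 := by
      rw [transpose_apply, hr']; simp [hzz.symm, (n2 l (by omega)).symm]
    have ea' : a (l + 2) = Y z + Y z' := by rw [ea]; simp [add_vecMul, row_def]
    have eb' : b (l + 2) = Yᵀ z + Yᵀ z' := by rw [eb]; simp [add_vecMul, row_def]
    -- The place `g (l + 1)` alone accounts for the inner product `4` of the last rows, so `z` and
    -- `z'` have no other neighbours.
    have h5 := (hp.eq_single (w := g (l + 1)) (by
      rw [h4, ea', eb', Pi.add_apply, Pi.add_apply, v1, v2, v3, v4]; norm_num)).1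
    have h6 : ∀ w, w ≠ g (l + 1) → Y z w = 0 ∧ Y z' w = 0 := by
      intro w hw
      have h7 := congrFun h5 w
      rw [ea', Pi.add_apply, Pi.single_apply, if_neg hw] at h7
      have := h.conn.nonneg z w
      have := h.conn.nonneg z' w
      omega
    refine exists_equiv_D h.conn hg hzz n1 n2 hr' ?_ ?_
    · ext w
      by_cases hw : w = g (l + 1)
      · rw [hw, v1]; simp
      · rw [(h6 w hw).1]; simp [hw]
    · ext w
      by_cases hw : w = g (l + 1)
      · rw [hw, v2]; simp
      · rw [(h6 w hw).2]; simp [hw]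
  · right
    have n1 := hne z (by simp; omega)
    have v1 : Y z (g (l + 1)) = q := by
      rw [← transpose_apply Y, hs']; simp [(n1 l (by omega)).symm]
    have v3 : Yᵀ z (g (l + 1)) = p := by
      rw [transpose_apply, hr']; simp [(n1 l (by omega)).symm]
    have ea' : a (l + 2) = p • Y z := by
      rw [ea]; ext w; simp [single_vecMul]
    have eb' : b (l + 2) = q • Yᵀ z := by
      rw [eb]; ext w; simp [single_vecMul]
    have h5 := (hp.eq_single (w := g (l + 1)) (by
      rw [h4, ea', eb', Pi.smul_apply, Pi.smul_apply, v1, v3, smul_eq_mul, smul_eq_mul,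
        mul_comm q p, hpq]; norm_num)).1
    have h6 : Y z = Pi.single (g (l + 1)) q := by
      ext w
      by_cases hw : w = g (l + 1)
      · rw [hw, v1]; simp
      · have h7 := congrFun h5 w
        rw [ea', Pi.smul_apply, Pi.single_apply, if_neg hw, smul_eq_mul] at h7
        rw [Pi.single_apply, if_neg hw]
        exact (mul_eq_zero.1 h7).resolve_left (by omega)
    have hp2 : p ≤ 2 := by nlinarith
    rcases (by omega : p = 1 ∨ p = 2) with rfl | rfl
    · left
      obtain rfl : q = 2 := by omega
      refine exists_equiv_path h.conn hg n1 hr' h6 _ fun i j => ?_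
      rw [coxeterAdj_B]
      split_ifs <;> omega
    · right
      obtain rfl : q = 1 := by omega
      refine exists_equiv_path h.conn hg n1 hr' h6 _ fun i j => ?_
      rw [coxeterAdj_C]
      split_ifs <;> omega

end IsPathRep

end Recognition

/-! ### The possible ends of an intertwiner out of `B` or `F₄` -/

section Target

variable {W : Type*} [Fintype W] [DecidableEq W] {Y : Matrix W W ℤ}

/-- A neighbour `d` of `y` joined to `y` by a simple edge and without further neighbours is a
simple leaf. -/
lemma IsConnectedFiniteType.leaf (hY : IsConnectedFiniteType Y) {y d : W} (h1 : Y y d = 1)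
    (h2 : Y d y = 1) (h3 : ∀ w, w ≠ y → Y d w = 0) :
    Y d = Pi.single y 1 ∧ Yᵀ d = Pi.single y 1 := by
  constructor
  · ext w
    by_cases hw : w = y
    · rw [hw, h2]; simp
    · rw [h3 w hw]; simp [hw]
  · ext w
    by_cases hw : w = y
    · rw [hw, transpose_apply, h1]; simp
    · rw [transpose_apply, hY.symm _ _ (h3 w hw)]; simp [hw]

/-- Distinct vertices whose rows are those of a matrix `M` exhibit `Y` as a relabelling of `M`. -/
lemma exists_equiv_of_rows (hY : IsConnectedFiniteType Y) {r : ℕ} [NeZero r] (v : Fin r → W)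
    (hv : Function.Injective v) (M : Matrix (Fin r) (Fin r) ℤ)
    (h : ∀ i, Y (v i) = ∑ j, Pi.single (v j) (M i j)) :
    ∃ φ : W ≃ Fin r, Y = M.submatrix φ φ ∧ ∀ i, φ (v i) = i := by
  have hval : ∀ i w, Y (v i) w = ∑ j, if w = v j then M i j else 0 := by
    intro i w
    rw [h i, Finset.sum_apply]
    exact Finset.sum_congr rfl fun j _ => by rw [Pi.single_apply]
  obtain ⟨φ, h1, h2⟩ := hY.exists_equiv M (fun k => if hk : k < r then v ⟨k, hk⟩ else v 0)
    (fun i j hij => hv (by simpa using hij)) (fun i j => by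
      simp only [i.2, j.2, dite_true, Fin.eta]
      rw [hval]
      simp [hv.eq_iff]) (fun i w hw => by
      by_contra! hc
      apply hw
      simp only [i.2, dite_true, Fin.eta]
      rw [hval]
      refine Finset.sum_eq_zero fun j _ => ?_
      rw [if_neg]
      rintro rfl
      exact hc j (by simp))
  exact ⟨φ, h1, fun i => by simpa using h2 i⟩

namespace IsPathRep

variable {m : ℕ} {a b : ℕ → W → ℤ}

/-- The possible ends `(Y, y)` of an intertwiner out of `B_{m+2}` whose first row is supported at
`y`. In type `G₂` either vertex may be `y`. -/
def IsTarget (Y : Matrix W W ℤ) (m : ℕ) (y : W) : Prop :=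
  (∃ φ : W ≃ Fin (m + 3), Y = (coxeterAdj (CartanMatrix.D (m + 3))).submatrix φ φ ∧
    (φ y).val = 1) ∨
  (∃ φ : W ≃ Fin (m + 2), Y = (coxeterAdj (CartanMatrix.B (m + 2))ᵀ).submatrix φ φ ∧
    (φ y).val = 1) ∨
  (∃ φ : W ≃ Fin (m + 2), Y = (coxeterAdj (CartanMatrix.C (m + 2))ᵀ).submatrix φ φ ∧
    (φ y).val = 1) ∨
  (m = 2 ∧ ∃ φ : W ≃ Fin 4, Y = (coxeterAdj (CartanMatrix.C 4)ᵀ).submatrix φ φ ∧ φ y = 3) ∨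
  (m = 1 ∧ ∃ φ : W ≃ Fin 2, Y = (coxeterAdj CartanMatrix.G₂).submatrix φ φ)

lemma isTarget_of_leaf (h : IsPathRep Y m a b) (hm : 1 ≤ m) {d y : W} (ha : a 0 = Pi.single y 1)
    (hb : b 0 = Pi.single y 1) (h1 : Y y d = 1)
    (h2 : Y d y = 1) (h3 : ∀ w, w ≠ y → Y d w = 0) : IsTarget Y m y := by
  obtain ⟨hr, hc⟩ := h.conn.leaf h1 h2 h3
  rcases h.equiv_of_leaf hm ha hb hr hc with h | h | h
  exacts [Or.inl h, Or.inr (Or.inl h), Or.inr (Or.inr (Or.inl h))]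

/-- The case of `B₃`: all neighbours of `y` are leaves. -/
lemma isTarget_one (h : IsPathRep Y 1 a b) {y : W} (ha : a 0 = Pi.single y 1)
    (hb : b 0 = Pi.single y 1) : IsTarget Y 1 y := by
  have ha1 : a 1 = Y y := by rw [h.a_one, ha]; simp [row_def]
  have hb1 : b 1 = Yᵀ y := by rw [h.b_one, hb]; simp [row_def]
  have h3 := h.dot_branch
  rw [ha1, hb1] at h3
  have ha2 : a 2 = Y y ᵥ* Y - Pi.single y 1 := by rw [h.a_rec 0 (by omega), ha1, ha]
  have hb2 : b 2 = Yᵀ y ᵥ* Yᵀ - Pi.single y 1 := by rw [h.b_rec 0 (by omega), hb1, hb]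
  have v1 : (Y y ᵥ* Y) y = 3 := h3
  have v2 : (Yᵀ y ᵥ* Yᵀ) y = 3 := by rw [← h3, dotProduct_comm]; rfl
  have h4 := h.dot_last
  -- The place `y` alone accounts for the inner product `4` of the last rows.
  have h5 := ((h.pair 2 le_rfl).eq_single (w := y) (by
    rw [h4, ha2, hb2, Pi.sub_apply, Pi.sub_apply, v1, v2]; simp)).1
  have h6 : ∀ d, Y y d ≠ 0 → ∀ w, w ≠ y → Y d w = 0 := by
    intro d hd w hw
    have h7 := congrFun h5 w
    rw [ha2, Pi.sub_apply, Pi.single_apply, Pi.single_apply, if_neg hw, if_neg hw, sub_zero] at h7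
    have h8 := (Finset.sum_eq_zero_iff_of_nonneg fun e _ =>
      mul_nonneg (h.conn.nonneg y e) (h.conn.nonneg e w)).1 h7 d (Finset.mem_univ d)
    exact (mul_eq_zero.1 h8).resolve_left hd
  rcases (h.conn.pair y).dot_eq_three h3 with ⟨d, hd, hd'⟩ | ⟨d, p, q, hpq, hp, hq, hp', hq'⟩
  · exact h.isTarget_of_leaf le_rfl ha hb hd hd' (h6 d (by omega))
  · refine Or.inr (Or.inr (Or.inr (Or.inr ⟨rfl, ?_⟩)))
    have e1 : Y y d = p := by rw [hp']; simp
    have e2 : Y d y = q := by rw [← transpose_apply Y, hq']; simp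
    have hyd : y ≠ d := by
      rintro rfl
      rw [h.diag] at e1
      omega
    have e3 : ∀ w, w ≠ d → Y y w = 0 := fun w hw => by rw [hp']; simp [hw]
    have e4 := h6 d (by omega)
    have hp3 : p ≤ 3 := by nlinarith
    have hq3 : q ≤ 3 := by nlinarith
    have hG : coxeterAdj CartanMatrix.G₂ = !![0, 3; 1, 0] := by decide
    have rd : Y d = Pi.single y q := by
      ext w
      by_cases hw : w = y
      · rw [hw, e2]; simp
      · rw [e4 w hw]; simp [hw]
    rcases (by interval_cases p <;> omega : p = 3 ∧ q = 1 ∨ p = 1 ∧ q = 3) with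
      ⟨rfl, rfl⟩ | ⟨rfl, rfl⟩
    · obtain ⟨φ, hφ, -⟩ := exists_equiv_of_rows h.conn ![y, d]
        (List.nodup_ofFn.1 (by simpa using hyd)) (coxeterAdj CartanMatrix.G₂) (by
          rw [hG, Fin.forall_fin_two]
          simpa [Fin.sum_univ_two] using ⟨hp', rd⟩)
      exact ⟨φ, hφ⟩
    · obtain ⟨φ, hφ, -⟩ := exists_equiv_of_rows h.conn ![d, y]
        (List.nodup_ofFn.1 (by simpa using hyd.symm)) (coxeterAdj CartanMatrix.G₂) (by
          rw [hG, Fin.forall_fin_two]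
          simpa [Fin.sum_univ_two] using ⟨rd, hp'⟩)
      exact ⟨φ, hφ⟩

/-- The case in which `y` has two simple neighbours, one of which turns out to be a leaf. -/
lemma isTarget_of_simple (h : IsPathRep Y m a b) (hm : 2 ≤ m) {y d d' : W}
    (ha : a 0 = Pi.single y 1) (hb : b 0 = Pi.single y 1) (hdd : d ≠ d')
    (hr : Y y = Pi.single d 1 + Pi.single d' 1) (hc : Yᵀ y = Pi.single d 1 + Pi.single d' 1) :
    IsTarget Y m y := by
  have ha1 : a 1 = Y y := by rw [h.a_one, ha]; simp [row_def]
  have hb1 : b 1 = Yᵀ y := by rw [h.b_one, hb]; simp [row_def]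
  have ha2 : a 2 = Y d + Y d' - Pi.single y 1 := by
    rw [h.a_rec 0 (by omega), ha1, ha, hr]; simp [add_vecMul, row_def]
  have hb2 : b 2 = Yᵀ d + Yᵀ d' - Pi.single y 1 := by
    rw [h.b_rec 0 (by omega), hb1, hb, hc]; simp [add_vecMul, row_def]
  have e1 : Y y d = 1 := by rw [hr]; simp [hdd]
  have e2 : Y y d' = 1 := by rw [hr]; simp [hdd.symm]
  have e3 : Y d y = 1 := by rw [← transpose_apply Y, hc]; simp [hdd]
  have e4 : Y d' y = 1 := by rw [← transpose_apply Y, hc]; simp [hdd.symm]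
  have leaf : (∀ w, w ≠ y → Y d w = 0) ∨ (∀ w, w ≠ y → Y d' w = 0) → IsTarget Y m y := by
    rintro (hl | hl)
    · exact h.isTarget_of_leaf (by omega) ha hb e1 e3 hl
    · exact h.isTarget_of_leaf (by omega) ha hb e2 e4 hl
  obtain ⟨f, g, hfg, hf0, hg0, hf, hg, hdot⟩ := (h.pair 2 (by omega)).split y
  have v1 : a 2 y = 1 := by rw [ha2]; simp [e3, e4]
  have v2 : b 2 y = 1 := by rw [hb2]; simp [e1, e2]
  rw [v1] at hf hdot
  rw [v2] at hg hdot
  have hfw : ∀ w, w ≠ y → f w = Y d w + Y d' w := by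
    intro w hw
    have := congrFun (hf.symm.trans ha2) w
    simpa [hw] using this
  have hgw : ∀ w, w ≠ y → g w = Y w d + Y w d' := by
    intro w hw
    have := congrFun (hg.symm.trans hb2) w
    simpa [hw] using this
  have n1 := h.conn.nonneg d
  have n2 := h.conn.nonneg d'
  -- If `f` is supported at `z` and not both `d` and `d'` are adjacent to `z`, one is a leaf.
  have one : ∀ (z : W) (p : ℤ), z ≠ y → f = Pi.single z p → Y d z = 0 ∨ Y d' z = 0 →
      IsTarget Y m y := by
    intro z p hz hfz h0
    have hw0 : ∀ w, w ≠ y → w ≠ z → Y d w = 0 ∧ Y d' w = 0 := by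
      intro w hw hwz
      have h1 := hfw w hw
      rw [hfz, Pi.single_apply, if_neg hwz] at h1
      have := n1 w
      have := n2 w
      omega
    refine leaf (h0.imp (fun h0 w hw => ?_) (fun h0 w hw => ?_))
    · by_cases hwz : w = z
      · exact hwz ▸ h0
      · exact (hw0 w hw hwz).1
    · by_cases hwz : w = z
      · exact hwz ▸ h0
      · exact (hw0 w hw hwz).2
  rcases hm.eq_or_lt with rfl | hm
  · have h3 := h.dot_branch
    rcases hfg.dot_eq_two (by omega) with ⟨z, z', hzz, hz, hz'⟩ | ⟨z, p, q, hpq, hp, hq, hz, hz'⟩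
    · have hzy : z ≠ y := by rintro rfl; rw [hz] at hf0; simp [hzz] at hf0
      have hzy' : z' ≠ y := by rintro rfl; rw [hz] at hf0; simp [hzz.symm] at hf0
      have f1 : Y d z + Y d' z = 1 := by rw [← hfw z hzy, hz]; simp [hzz]
      have f2 : Y d z' + Y d' z' = 1 := by rw [← hfw z' hzy', hz]; simp [hzz.symm]
      -- If `z` and `z'` were neighbours of different vertices among `d` and `d'`, the last row of
      -- `b` would have an odd entry.
      have hev : 2 ∣ Y d z + Y d z' := by
        have hb3 : b 3 = Yᵀ z + Yᵀ z' := by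
          rw [h.b_rec 1 (by omega), hg, hz', hb1]
          simp [add_vecMul, row_def]
        have := h.even d
        rw [hb3] at this
        exact this
      have hw0 : ∀ w, w ≠ y → w ≠ z → w ≠ z' → Y d w = 0 ∧ Y d' w = 0 := by
        intro w hw hwz hwz'
        have h1 := hfw w hw
        rw [hz] at h1
        simp [hwz, hwz'] at h1
        have := n1 w
        have := n2 w
        omega
      have := n1 z
      have := n1 z'
      have := n2 z
      have := n2 z'
      rcases (by omega : Y d z = 0 ∧ Y d z' = 0 ∨ Y d' z = 0 ∧ Y d' z' = 0) with h0 | h0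
      · refine leaf (Or.inl fun w hw => ?_)
        by_cases hwz : w = z
        · exact hwz ▸ h0.1
        · by_cases hwz' : w = z'
          · exact hwz' ▸ h0.2
          · exact (hw0 w hw hwz hwz').1
      · refine leaf (Or.inr fun w hw => ?_)
        by_cases hwz : w = z
        · exact hwz ▸ h0.1
        · by_cases hwz' : w = z'
          · exact hwz' ▸ h0.2
          · exact (hw0 w hw hwz hwz').2
    · have hzy : z ≠ y := by rintro rfl; rw [hz] at hf0; simp at hf0; omega
      refine one z p hzy hz ?_
      by_contra! hc
      have f1 : Y d z + Y d' z = p := by rw [← hfw z hzy, hz]; simp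
      have f2 : Y z d + Y z d' = q := by rw [← hgw z hzy, hz']; simp
      have := n1 z
      have := n2 z
      have := h.conn.nonneg z d
      have := h.conn.nonneg z d'
      have : Y z d ≠ 0 := fun h0 => hc.1 (h.conn.symm z d h0)
      have : Y z d' ≠ 0 := fun h0 => hc.2 (h.conn.symm z d' h0)
      have := hc.1
      have := hc.2
      have : 2 ≤ p := by omega
      have : 2 ≤ q := by omega
      nlinarith
  · have h3 := h.dot_mid 2 (by omega) hm
    obtain ⟨z, hz, hz'⟩ := hfg.dot_eq_one (by omega)
    have hzy : z ≠ y := by rintro rfl; rw [hz] at hf0; simp at hf0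
    refine one z 1 hzy hz ?_
    have f1 : Y d z + Y d' z = 1 := by rw [← hfw z hzy, hz]; simp
    have := n1 z
    have := n2 z
    omega

/-- The case in which `y` is the end of a double edge: this is the exceptional pair of
`B₄` and `C₄`. -/
lemma isTarget_of_double (h : IsPathRep Y m a b) (hm : 2 ≤ m) {y d : W} {p q : ℤ}
    (ha : a 0 = Pi.single y 1) (hb : b 0 = Pi.single y 1) (hpq : p * q = 2) (hp : 1 ≤ p)
    (hq : 1 ≤ q) (hr : Y y = Pi.single d p) (hc : Yᵀ y = Pi.single d q) :
    IsTarget Y m y := by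
  have ha1 : a 1 = Y y := by rw [h.a_one, ha]; simp [row_def]
  have hb1 : b 1 = Yᵀ y := by rw [h.b_one, hb]; simp [row_def]
  have e1 : Y d y = q := by rw [← transpose_apply Y, hc]; simp
  have e2 : Yᵀ d y = p := by rw [transpose_apply, hr]; simp
  obtain ⟨r, s, hrs, hr0, hs0, hr', hs', hdot⟩ := (h.conn.pair d).split y
  rw [e1] at hr'
  rw [e2] at hs'
  have ha2 : a 2 = Pi.single y 1 + p • r := by
    rw [h.a_rec 0 (by omega), ha1, ha, hr]
    ext w
    simp only [zero_add, Pi.sub_apply, Pi.add_apply, single_vecMul, row_def, hr', Pi.smul_apply,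
      smul_eq_mul, mul_add]
    by_cases hw : w = y
    · subst hw; simp [hpq]; ring
    · simp [hw]
  have hb2 : b 2 = Pi.single y 1 + q • s := by
    rw [h.b_rec 0 (by omega), hb1, hb, hc]
    ext w
    simp only [zero_add, Pi.sub_apply, Pi.add_apply, single_vecMul, row_def, hs', Pi.smul_apply,
      smul_eq_mul, mul_add]
    by_cases hw : w = y
    · subst hw; simp [mul_comm q p, hpq]; ring
    · simp [hw]
  have hdot2 : a 2 ⬝ᵥ b 2 = 1 + 2 * (r ⬝ᵥ s) := by
    rw [ha2, hb2, ← hpq]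
    simp only [add_dotProduct, dotProduct_add, smul_dotProduct, dotProduct_smul, smul_eq_mul,
      single_dotProduct, dotProduct_single, hr0, hs0]
    rw [Pi.add_apply, Pi.smul_apply, hr0, Pi.single_eq_same, smul_zero]
    ring
  rcases hm.lt_or_eq with hm | rfl
  · have := h.dot_mid 2 (by omega) hm
    omega
  have h3 := h.dot_branch
  obtain ⟨z, rfl, rfl⟩ := hrs.dot_eq_one (by omega)
  have hzy : z ≠ y := by rintro rfl; simp at hr0
  have ha3 : a 3 = p • Y z := by
    rw [h.a_rec 1 (by omega), ha2, ha1]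
    simp only [add_vecMul, smul_vecMul, single_one_vecMul, row_def]
    exact add_sub_cancel_left _ _
  have hb3 : b 3 = q • Yᵀ z := by
    rw [h.b_rec 1 (by omega), hb2, hb1]
    simp only [add_vecMul, smul_vecMul, single_one_vecMul, row_def]
    exact add_sub_cancel_left _ _
  have h4 := h.dot_last
  rw [ha3, hb3, smul_dotProduct, dotProduct_smul, smul_eq_mul, smul_eq_mul, ← mul_assoc, hpq] at h4
  obtain ⟨r, s, hrs, hr0, hs0, hr2, hs2, hdot2⟩ := (h.conn.pair z).split d
  have e3 : Y z d = 1 := by rw [← transpose_apply Y, hs']; simp [hzy.symm]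
  have e4 : Yᵀ z d = 1 := by rw [transpose_apply, hr']; simp [hzy.symm]
  rw [e3] at hr2 hdot2
  rw [e4] at hs2 hdot2
  obtain ⟨u, rfl, rfl⟩ := hrs.dot_eq_one (by omega)
  have hud : u ≠ d := by rintro rfl; simp at hr0
  have hq2 : 2 ∣ q := by
    have := h.even u
    rw [hb3, hs2] at this
    simpa [hud] using this
  have : q ≤ 2 := by nlinarith
  obtain rfl : q = 2 := by omega
  obtain rfl : p = 1 := by omega
  have hu : Y u = Pi.single z 1 := by
    have h5 := h.a_last
    rw [show (2 + 1 : ℕ) = 3 from rfl, ha3, ha2, hr2, one_smul] at h5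
    simp only [add_vecMul, single_one_vecMul, row_def, hr', one_smul] at h5
    ext w
    have h6 := congrFun h5 w
    simp only [Pi.add_apply, Pi.smul_apply, smul_eq_mul, Pi.single_apply] at h6 ⊢
    split_ifs at h6 ⊢ <;> omega
  have hdy : d ≠ y := by
    rintro rfl
    have := h.diag d
    rw [hr] at this
    simp at this
  have hzd : z ≠ d := by
    rintro rfl
    rw [h.diag] at e3
    omega
  have huz : u ≠ z := by
    rintro rfl
    have := h.diag u
    rw [hr2] at this
    simp [hzd] at this
  have huy : u ≠ y := by
    rintro rfl
    have h6 : Y z u = 0 := by rw [← transpose_apply Y, hc]; simp [hzd]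
    rw [hr2] at h6
    simp [hud] at h6
  refine Or.inr (Or.inr (Or.inr (Or.inl ⟨rfl, ?_⟩)))
  obtain ⟨φ, hφ, hφ'⟩ := exists_equiv_of_rows h.conn ![u, z, d, y] (by
    intro i j hij
    fin_cases i <;> fin_cases j <;> simp_all) (coxeterAdj (CartanMatrix.C 4)ᵀ) (by
    have hM : coxeterAdj (CartanMatrix.C 4)ᵀ =
        !![0, 1, 0, 0; 1, 0, 1, 0; 0, 1, 0, 2; 0, 0, 1, 0] := by
      decide
    rw [hM]
    intro i
    fin_cases i <;> simp [Fin.sum_univ_four]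
    · exact hu
    · rw [hr2, add_comm]
    · rw [hr', add_comm]
    · exact hr)
  exact ⟨φ, hφ, hφ' 3⟩

/-- The pointed classification: the first row of the intertwiner is a single vertex `y`, and only
five pairs `(Y, y)` are possible. -/
theorem classify (h : IsPathRep Y m a b) (hm : 1 ≤ m) :
    ∃ y, a 0 = Pi.single y 1 ∧ b 0 = Pi.single y 1 ∧ IsTarget Y m y := by
  obtain ⟨y, ha, hb⟩ := (h.pair 0 (by omega)).dot_eq_one h.dot_zero
  refine ⟨y, ha, hb, ?_⟩
  rcases hm.eq_or_lt with rfl | hm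
  · exact h.isTarget_one ha hb
  · have h2 := h.dot_mid 1 le_rfl hm
    rw [h.a_one, h.b_one, ha, hb, single_one_vecMul, single_one_vecMul] at h2
    rcases (h.conn.pair y).dot_eq_two h2 with
      ⟨d, d', hdd, hr, hc⟩ | ⟨d, p, q, hpq, hp, hq, hr, hc⟩
    · exact h.isTarget_of_simple hm ha hb hdd hr hc
    · exact h.isTarget_of_double hm ha hb hpq hp hq hr hc

end IsPathRep

/-- An intertwiner out of `F₄` whose product with the intertwiner in the opposite direction has
the diagonal of the square of the Coxeter adjacency matrix of `F₄` ends at `F₄`. -/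
theorem exists_equiv_F₄ (hY : IsConnectedFiniteType Y) (hd : ∀ w, Y w w = 0) (a b : Fin 4 → W → ℤ)
    (hp : ∀ k, IsPair (a k) (b k)) (a1 : a 1 = a 0 ᵥ* Y) (a2 : a 0 + (2 : ℤ) • a 2 = a 1 ᵥ* Y)
    (a3 : a 1 + a 3 = a 2 ᵥ* Y) (b1 : b 1 = b 0 ᵥ* Yᵀ)
    (b2 : b 0 + b 2 = b 1 ᵥ* Yᵀ) (b3 : (2 : ℤ) • b 1 + b 3 = b 2 ᵥ* Yᵀ)
    (d0 : a 0 ⬝ᵥ b 0 = 1) (d1 : a 1 ⬝ᵥ b 1 = 3) (d2 : a 2 ⬝ᵥ b 2 = 3) (d3 : a 3 ⬝ᵥ b 3 = 1) :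
    ∃ y, a 0 = Pi.single y 1 ∧ b 0 = Pi.single y 1 ∧
      ∃ φ : W ≃ Fin 4, Y = (coxeterAdj CartanMatrix.F₄).submatrix φ φ ∧ φ y = 1 := by
  obtain ⟨y, ha, hb⟩ := (hp 0).dot_eq_one d0
  refine ⟨y, ha, hb, ?_⟩
  rw [ha, single_one_vecMul] at a1
  rw [hb, single_one_vecMul] at b1
  change a 1 = Y y at a1
  change b 1 = Yᵀ y at b1
  have v1 : (Y y ᵥ* Y) y = 3 := by rw [a1, b1] at d1; exact d1
  have v2 : (Yᵀ y ᵥ* Yᵀ) y = 3 := by rw [← v1]; exact dotProduct_comm _ _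
  obtain ⟨f, g, hfg, hf0, hg0, hf, hg, hdot⟩ := (hp 2).split y
  have w1 : a 2 y = 1 := by
    have := congrFun a2 y
    rw [a1, v1, ha] at this
    simp at this
    omega
  have w2 : b 2 y = 2 := by
    have := congrFun b2 y
    rw [b1, v2, hb] at this
    simp at this
    omega
  rw [w1] at hf hdot
  rw [w2] at hg hdot
  obtain ⟨z, rfl, rfl⟩ := hfg.dot_eq_one (by omega)
  have hzy : z ≠ y := by rintro rfl; simp at hf0
  have ea3 : a 3 = Y z := by
    have h1 : a 3 = a 2 ᵥ* Y - a 1 := by rw [← a3]; simp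
    rw [h1, hf, a1]
    simp [add_vecMul, row_def]
  have eb3 : b 3 = Yᵀ z := by
    have h1 : b 3 = b 2 ᵥ* Yᵀ - (2 : ℤ) • b 1 := by rw [← b3]; simp
    rw [h1, hg, b1]
    ext w
    simp [add_vecMul, single_vecMul, row_def]
  obtain ⟨d, hz, hz'⟩ := (hp 3).dot_eq_one d3
  rw [ea3] at hz
  rw [eb3] at hz'
  have q1 : Y y d = 2 := by
    have h1 : (Y y ᵥ* Y) z = Y y d := by
      change Y y ⬝ᵥ Yᵀ z = _
      rw [hz']; simp
    have h2 := congrFun a2 z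
    rw [a1, h1, ha, hf] at h2
    simpa [hzy] using h2.symm
  have q2 : Yᵀ y d = 1 := by
    have h1 : (Yᵀ y ᵥ* Yᵀ) z = Yᵀ y d := by
      change Yᵀ y ⬝ᵥ Y z = _
      rw [hz]; simp
    have h2 := congrFun b2 z
    rw [b1, h1, hb, hg] at h2
    simpa [hzy] using h2.symm
  obtain ⟨r, s, hrs, hr0, hs0, hr, hs, hdot2⟩ := (hY.pair y).split d
  rw [q1] at hr hdot2
  rw [q2] at hs hdot2
  rw [a1, b1] at d1
  obtain ⟨e, rfl, rfl⟩ := hrs.dot_eq_one (by omega)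
  have hed : e ≠ d := by rintro rfl; simp at hr0
  have hsum : ∀ w, 2 * Y d w + Y e w = (if w = y then 3 else 0) + (if w = z then 2 else 0) := by
    intro w
    have h1 := congrFun a2 w
    rw [a1, hr, ha, hf] at h1
    simp only [add_vecMul, Pi.add_apply, single_vecMul, row_def, Pi.smul_apply, smul_eq_mul,
      Pi.single_apply, one_mul] at h1
    rw [← h1]
    split_ifs <;> norm_num
  have u1 : Y e y = 1 := by rw [← transpose_apply Y, hs]; simp [hed]
  have u2 : Y d y = 1 := q2
  have u3 : Y d z = 1 := by rw [← transpose_apply Y, hz']; simp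
  have hdy : d ≠ y := by rintro rfl; rw [hd] at q1; omega
  have hdz : d ≠ z := by rintro rfl; rw [hd] at u3; omega
  have hey : e ≠ y := by rintro rfl; rw [hd] at u1; omega
  have u4 : Y e z = 0 := by
    have := hsum z
    simp [hzy, u3] at this
    omega
  have hez : e ≠ z := by
    rintro rfl
    have : Y e y = 0 := by rw [hz]; simp [hdy.symm]
    omega
  have re : Y e = Pi.single y 1 := by
    ext w
    by_cases hwy : w = y
    · rw [hwy, u1]; simp
    · by_cases hwz : w = z
      · rw [hwz, u4]; simp [hzy]
      · have h1 := hsum w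
        have := hY.nonneg e w
        have := hY.nonneg d w
        rw [if_neg hwy, if_neg hwz] at h1
        rw [Pi.single_apply, if_neg hwy]
        omega
  have rd : Y d = Pi.single y 1 + Pi.single z 1 := by
    ext w
    have h1 := hsum w
    rw [re] at h1
    simp only [Pi.add_apply, Pi.single_apply] at h1 ⊢
    split_ifs at h1 ⊢ <;> omega
  obtain ⟨φ, hφ, hφ'⟩ := exists_equiv_of_rows hY ![e, y, d, z] (by
    intro i j hij
    fin_cases i <;> fin_cases j <;> simp_all) (coxeterAdj CartanMatrix.F₄) (by
    have hM : coxeterAdj CartanMatrix.F₄ = !![0, 1, 0, 0; 1, 0, 2, 0; 0, 1, 0, 1; 0, 0, 1, 0] := by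
      decide
    rw [hM]
    intro i
    fin_cases i <;> simp [Fin.sum_univ_four]
    · exact re
    · rw [hr, add_comm]
    · exact rd
    · exact hz)
  exact ⟨φ, hφ, hφ' 1⟩

end Target

/-! ### The product of the two intertwiners -/

/-- The features of a Coxeter adjacency matrix with at most two components, the fibres of `χ`:
nonnegative entries with symmetric support, the components are connected, and the spectral radius
is less than `2`. -/
structure HasComponents {V : Type*} [Fintype V] (M : Matrix V V ℤ) (χ : V → Bool) : Prop where
  nonneg : ∀ i j, 0 ≤ M i j
  symm : ∀ i j, M i j = 0 → M j i = 0
  pres : ∀ i j, M i j ≠ 0 → χ i = χ j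
  conn : ∀ S : Set V, (∀ i ∈ S, ∀ j, M i j ≠ 0 → j ∈ S) → ∀ i ∈ S, ∀ j, χ i = χ j → j ∈ S
  bound : ∀ p : V → ℝ, (∀ i, 0 ≤ p i) →
    (∀ i, 4 * p i ≤ ∑ j, (M i j : ℝ) * ∑ k, (M j k : ℝ) * p k) → ∀ i, p i = 0

/-- An intertwiner out of a path-like matrix is determined by its first row. -/
lemma eq_zero_of_row_zero {R : Type*} [CommRing R] [IsDomain R] {n : ℕ} {W : Type*} [Fintype W]
    {X : Matrix (Fin n) (Fin n) R} (h1 : ∀ i j : Fin n, i.val + 1 = j.val → X i j ≠ 0)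
    (h2 : ∀ i j : Fin n, i.val + 1 < j.val → X i j = 0) {Y : Matrix W W R}
    {D : Matrix (Fin n) W R} (h : X * D = D * Y) (h0 : ∀ i : Fin n, i.val = 0 → D i = 0) :
    D = 0 := by
  have key : ∀ k : ℕ, ∀ i : Fin n, i.val = k → D i = 0 := by
    intro k
    induction k using Nat.strong_induction_on with
    | _ k ih =>
      intro i hi
      rcases Nat.eq_zero_or_pos k with rfl | hk
      · exact h0 i hi
      · ext w
        have hlt : k - 1 < n := by have := i.2; omega
        have h3 := congrFun (congrFun h ⟨k - 1, hlt⟩) w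
        rw [mul_apply, mul_apply] at h3
        simp only [ih (k - 1) (by omega) ⟨k - 1, hlt⟩ rfl, Pi.zero_apply, zero_mul,
          Finset.sum_const_zero] at h3
        rw [Finset.sum_eq_single i] at h3
        · exact (mul_eq_zero.1 h3).resolve_left (h1 _ _ (by simp; omega))
        · intro j _ hj
          rcases Nat.lt_or_ge j.val k with hjk | hjk
          · rw [ih j.val hjk j rfl]; simp
          · rw [h2 _ _ ?_, zero_mul]
            have : j.val ≠ i.val := fun hc => hj (Fin.ext hc)
            simp only
            omega
        · simp
  exact funext fun i => key i.val i rfl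

section Square

variable {U W : Type*} [Fintype U] [Fintype W] {A : Matrix U W ℤ} {B : Matrix W U ℤ}
  {χ : U ⊕ W → Bool}

/-- The square of the blue matrix acts on vectors that are supported on `U` as `A B`. -/
lemma HasComponents.sq_apply (p : U → ℝ) (u : U) :
    ∑ j, ((fromBlocks 0 A B 0 : Matrix (U ⊕ W) (U ⊕ W) ℤ) (Sum.inl u) j : ℝ) *
      ∑ k, ((fromBlocks 0 A B 0 : Matrix (U ⊕ W) (U ⊕ W) ℤ) j k : ℝ) *
        (Sum.elim p 0 : U ⊕ W → ℝ) k = ∑ v, (((A * B) u v : ℤ) : ℝ) * p v := by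
  simp only [Fintype.sum_sum_type, fromBlocks_apply₁₁, fromBlocks_apply₁₂, fromBlocks_apply₂₁,
    fromBlocks_apply₂₂, Matrix.zero_apply, Int.cast_zero, zero_mul, Finset.sum_const_zero, zero_add,
    Sum.elim_inl, Sum.elim_inr, Pi.zero_apply, mul_zero, add_zero, mul_apply, Int.cast_sum,
    Int.cast_mul, Finset.sum_mul, Finset.mul_sum]
  rw [Finset.sum_comm]
  exact Finset.sum_congr rfl fun v _ => Finset.sum_congr rfl fun w _ => by ring

variable (h : HasComponents (fromBlocks 0 A B 0) χ)
include h

lemma HasComponents.nonneg_left (u : U) (w : W) : 0 ≤ A u w := h.nonneg (Sum.inl u) (Sum.inr w)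

lemma HasComponents.nonneg_right (w : W) (u : U) : 0 ≤ B w u := h.nonneg (Sum.inr w) (Sum.inl u)

lemma HasComponents.pair (u : U) : IsPair (A u) (Bᵀ u) :=
  ⟨h.nonneg_left u, fun w => h.nonneg_right w u,
    fun w => ⟨h.symm (Sum.inl u) (Sum.inr w), h.symm (Sum.inr w) (Sum.inl u)⟩⟩

lemma HasComponents.mul_nonneg (u v : U) : 0 ≤ (A * B) u v :=
  Finset.sum_nonneg fun w _ => _root_.mul_nonneg (h.nonneg_left u w) (h.nonneg_right w v)

/-- A nonnegative vector cannot be stretched by a factor of at least `4` by the square of the blue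
matrix. -/
lemma HasComponents.eq_zero_of_four_le (p : U → ℝ) (hp : ∀ u, 0 ≤ p u)
    (h4 : ∀ u, 4 * p u ≤ ∑ v, (((A * B) u v : ℤ) : ℝ) * p v) (u : U) : p u = 0 := by
  refine h.bound (Sum.elim p 0) ?_ ?_ (Sum.inl u)
  · rintro (v | w)
    · exact hp v
    · exact le_rfl
  · rintro (v | w)
    · rw [HasComponents.sq_apply]
      exact h4 v
    · simp only [Sum.elim_inr, Pi.zero_apply, mul_zero]
      refine Finset.sum_nonneg fun j _ => _root_.mul_nonneg (by exact_mod_cast h.nonneg _ _)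
        (Finset.sum_nonneg fun k _ => _root_.mul_nonneg (by exact_mod_cast h.nonneg _ _) ?_)
      rcases k with v | w
      · exact hp v
      · exact le_rfl

lemma HasComponents.diag_le [DecidableEq U] (u : U) : (A * B) u u ≤ 3 := by
  by_contra! hc
  have := h.eq_zero_of_four_le (Pi.single u 1) (fun v => by
    rw [Pi.single_apply]; split_ifs <;> norm_num) (fun v => by
    have h0 : (0 : ℝ) ≤ (((A * B) v u : ℤ) : ℝ) := by exact_mod_cast h.mul_nonneg v u
    by_cases hv : v = u
    · subst hv
      have : (4 : ℝ) ≤ (((A * B) v v : ℤ) : ℝ) := by exact_mod_cast hc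
      simpa [Pi.single_apply] using this
    · simpa [Pi.single_apply, hv] using h0) u
  simp at this

lemma HasComponents.eq_color (u v : U) (huv : (A * B) u v ≠ 0) :
    χ (Sum.inl u) = χ (Sum.inl v) := by
  obtain ⟨w, -, hw⟩ := Finset.exists_ne_zero_of_sum_ne_zero huv
  have h1 := left_ne_zero_of_mul hw
  have h2 := right_ne_zero_of_mul hw
  exact (h.pres (Sum.inl u) (Sum.inr w) h1).trans (h.pres (Sum.inr w) (Sum.inl v) h2)

/-- A vertex is not isolated if its component contains another vertex of `U`. -/
lemma HasComponents.one_le_diag {u v : U} (huv : u ≠ v)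
    (hχ : χ (Sum.inl u) = χ (Sum.inl v)) : 1 ≤ (A * B) u u := by
  by_contra! hc
  have h0 : (A * B) u u = 0 := by have := h.mul_nonneg u u; omega
  have h1 : ∀ w, A u w = 0 := by
    intro w
    have h2 := (Finset.sum_eq_zero_iff_of_nonneg fun w _ =>
      _root_.mul_nonneg (h.nonneg_left u w) (h.nonneg_right w u)).1 h0 w (Finset.mem_univ w)
    exact (mul_eq_zero.1 h2).elim id (((h.pair u).iff w).2)
  have h3 := h.conn {Sum.inl u} (by
    rintro _ rfl (v | w) hw
    · exact absurd rfl hw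
    · exact absurd (h1 w) hw) (Sum.inl u) rfl (Sum.inl v) hχ
  exact huv (Sum.inl_injective h3).symm

/-- A vertex is at distance two from another vertex of `U` if its component contains one. -/
lemma HasComponents.exists_ne {u v : U} (huv : u ≠ v)
    (hχ : χ (Sum.inl u) = χ (Sum.inl v)) : ∃ v ≠ u, 1 ≤ (A * B) u v := by
  by_contra! hc
  have h3 := h.conn {x | x = Sum.inl u ∨ ∃ w, x = Sum.inr w ∧ A u w ≠ 0} (by
    rintro _ (rfl | ⟨w, rfl, hw⟩) (v | w') hx
    · exact absurd rfl hx
    · exact Or.inr ⟨w', rfl, hx⟩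
    · left
      by_contra hvu
      have h4 : 0 < A u w * B w v := mul_pos ((h.nonneg_left u w).lt_of_ne hw.symm)
        ((h.nonneg_right w v).lt_of_ne (Ne.symm hx))
      have h5 : A u w * B w v ≤ (A * B) u v :=
        Finset.single_le_sum (f := fun w => A u w * B w v)
          (fun w _ => _root_.mul_nonneg (h.nonneg_left u w) (h.nonneg_right w v))
          (Finset.mem_univ w)
      have := hc v (fun h => hvu (by rw [h]))
      omega
    · exact absurd rfl hx) (Sum.inl u) (Or.inl rfl) (Sum.inl v) hχ
  rcases h3 with h3 | ⟨w, h3, -⟩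
  · exact huv (Sum.inl_injective h3).symm
  · exact Sum.inl_ne_inr h3

end Square

section TypeB

variable {n : ℕ}

/-- The Perron eigenvector of `B_n`. -/
lemma sum_coxeterAdj_B_sin (hn : 2 ≤ n) (i : Fin n) :
    ∑ j, ((coxeterAdj (CartanMatrix.B n)ᵀ i j : ℤ) : ℝ) *
        Real.sin ((j.val + 1) * (Real.pi / (2 * n)))
      = 2 * Real.cos (Real.pi / (2 * n)) * Real.sin ((i.val + 1) * (Real.pi / (2 * n))) := by
  set θ := Real.pi / (2 * n) with hθ
  have hn0 : (n : ℝ) ≠ 0 := by positivity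
  rw [sum_path (R := ℝ) _ (fun k => (if i.val + 1 = n then 2 else 1) * Real.sin ((k + 1) * θ)) i
    (fun j => by
      rw [coxeterAdj_B]
      have := j.2
      split_ifs <;> first | omega | simp)]
  rcases Nat.eq_zero_or_pos i.val with h0 | h0
  · rw [h0, if_neg (by omega), if_pos (by omega), if_neg (by omega)]
    push_cast
    rw [show ((1 : ℝ) + 1) * θ = 2 * θ by ring, Real.sin_two_mul]
    ring_nf
  · have h1 : ((i.val - 1 : ℕ) : ℝ) = i.val - 1 := by push_cast [h0]; ring
    rw [if_pos (by omega), h1]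
    by_cases hi : i.val + 1 = n
    · rw [if_pos hi, if_neg (by omega)]
      have h3 : (i.val : ℝ) = n - 1 := by
        have : ((i.val + 1 : ℕ) : ℝ) = n := by rw [hi]
        push_cast at this
        linarith
      have h4 : (n : ℝ) * θ = Real.pi / 2 := by rw [hθ]; field_simp
      rw [h3, show ((n : ℝ) - 1 - 1 + 1) * θ = Real.pi / 2 - θ by rw [← h4]; ring,
        show ((n : ℝ) - 1 + 1) * θ = Real.pi / 2 by rw [← h4]; ring, Real.sin_pi_div_two_sub,
        Real.sin_pi_div_two]
      ring
    · rw [if_neg hi, if_pos (by have := i.2; omega)]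
      push_cast
      have h5 : Real.sin (i.val * θ) + Real.sin ((i.val + 2) * θ) =
          2 * Real.cos θ * Real.sin ((i.val + 1) * θ) := by
        rw [show (i.val : ℝ) * θ = (i.val + 1) * θ - θ by ring,
          show ((i.val : ℝ) + 2) * θ = (i.val + 1) * θ + θ by ring, Real.sin_sub, Real.sin_add]
        ring
      rw [← h5]
      ring_nf

lemma two_mul_sin_le {θ : ℝ} (h0 : 0 ≤ θ) (h1 : θ ≤ Real.pi / 6) :
    2 * Real.sin θ ≤ Real.sin (3 * θ) := by
  have hs0 : 0 ≤ Real.sin θ := Real.sin_nonneg_of_nonneg_of_le_pi h0 (by linarith [Real.pi_pos])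
  have hs1 : Real.sin θ ≤ 1 / 2 := by
    rw [← Real.sin_pi_div_six]
    exact Real.sin_le_sin_of_le_of_le_pi_div_two (by linarith [Real.pi_pos])
      (by linarith [Real.pi_pos]) h1
  rw [Real.sin_three_mul]
  nlinarith [mul_nonneg hs0 (sub_nonneg.2 hs1), mul_nonneg hs0 hs0]

lemma three_mul_sin_le {θ : ℝ} (h0 : 0 ≤ θ) (h1 : θ ≤ Real.pi / 10) :
    3 * Real.sin θ ≤ Real.sin (5 * θ) := by
  have hs0 : 0 ≤ Real.sin θ := Real.sin_nonneg_of_nonneg_of_le_pi h0 (by linarith [Real.pi_pos])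
  have hs1 : Real.sin θ ≤ 0.315 := (Real.sin_le h0).trans (by
    have := Real.pi_lt_d2
    linarith)
  have h5 : Real.sin (5 * θ) = Real.sin θ * (5 - 20 * Real.sin θ ^ 2 + 16 * Real.sin θ ^ 4) := by
    rw [show 5 * θ = 3 * θ + 2 * θ by ring, Real.sin_add, Real.sin_three_mul, Real.cos_three_mul,
      Real.sin_two_mul, Real.cos_two_mul]
    have hc : Real.cos θ ^ 2 = 1 - Real.sin θ ^ 2 := by
      rw [← Real.sin_sq_add_cos_sq θ]; ring
    have hc4 : Real.cos θ ^ 4 = (1 - Real.sin θ ^ 2) ^ 2 := by rw [← hc]; ring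
    ring_nf
    rw [hc4, hc]
    ring
  rw [h5, mul_comm 3]
  refine mul_le_mul_of_nonneg_left ?_ hs0
  have : Real.sin θ ^ 2 ≤ 0.315 ^ 2 := pow_le_pow_left₀ hs0 hs1 2
  nlinarith [pow_nonneg hs0 4]

variable {W : Type*} [Fintype W] {A : Matrix (Fin n) W ℤ} {B : Matrix W (Fin n) ℤ}
  {χ : Fin n ⊕ W → Bool}

/-- The first row of the product `A B` of the two intertwiners pairs with the Perron eigenvector
of `B_n` to less than `4` times its first entry. -/
lemma HasComponents.sum_lt (h : HasComponents (fromBlocks 0 A B 0) χ) (hn : 2 ≤ n)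
    (hK : Commute (coxeterAdj (CartanMatrix.B n)ᵀ) (A * B)) :
    ∑ j, (((A * B) ⟨0, by omega⟩ j : ℤ) : ℝ) * Real.sin ((j.val + 1) * (Real.pi / (2 * n)))
      < 4 * Real.sin (Real.pi / (2 * n)) := by
  set θ := Real.pi / (2 * n) with hθ
  have hn' : (2 : ℝ) ≤ n := by exact_mod_cast hn
  have hθ0 : 0 < θ := by positivity
  have hnθ : (n : ℝ) * θ = Real.pi / 2 := by rw [hθ]; field_simp
  let d : Fin n → ℝ := fun j => Real.sin ((j.val + 1) * θ)
  have hd0 : ∀ j, 0 < d j := by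
    intro j
    have : ((j.val + 1 : ℕ) : ℝ) ≤ n := by exact_mod_cast j.2
    push_cast at this
    refine Real.sin_pos_of_pos_of_lt_pi (by positivity) ?_
    have : ((j.val : ℝ) + 1) * θ ≤ n * θ := mul_le_mul_of_nonneg_right this hθ0.le
    linarith [Real.pi_pos]
  have e0 : d ⟨0, by omega⟩ = Real.sin θ := by simp [d]
  let X : Matrix (Fin n) (Fin n) ℝ := (coxeterAdj (CartanMatrix.B n)ᵀ).map (Int.castRingHom ℝ)
  let K : Matrix (Fin n) (Fin n) ℝ := (A * B).map (Int.castRingHom ℝ)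
  have hXK : X * K = K * X := by
    have := congrArg (Int.castRingHom ℝ).mapMatrix hK.eq
    rwa [map_mul, map_mul] at this
  let dd : Matrix (Fin n) Unit ℝ := of fun i _ => d i
  have hXd : X * dd = (2 * Real.cos θ) • dd := by
    ext i u
    rw [mul_apply, Matrix.smul_apply]
    exact sum_coxeterAdj_B_sin hn i
  -- `A B` commutes with `X` and therefore preserves the eigenspace of `d`, which is a line since a
  -- vector in it is determined by its first entry.
  let ν : ℝ := (K * dd) ⟨0, by omega⟩ () / Real.sin θ
  have hs : 0 < Real.sin θ := e0 ▸ hd0 _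
  have hKd : K * dd - ν • dd = 0 := by
    refine eq_zero_of_row_zero (X := X) (Y := (2 * Real.cos θ) • (1 : Matrix Unit Unit ℝ))
      ?_ ?_ ?_ ?_
    · intro i j hij
      simp only [X, map_apply]
      rw [coxeterAdj_B, if_pos hij]
      simp
    · intro i j hij
      simp only [X, map_apply]
      rw [coxeterAdj_B, if_neg (by omega), if_neg (by omega)]
      simp
    · rw [Matrix.mul_sub, ← Matrix.mul_assoc, hXK, Matrix.mul_assoc, hXd, Matrix.mul_smul,
        Matrix.mul_smul, hXd, Matrix.mul_smul, Matrix.mul_one, smul_sub, smul_comm ν]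
    · intro i hi
      rw [show i = ⟨0, by omega⟩ from Fin.ext hi]
      ext u
      change (K * dd) ⟨0, by omega⟩ () - ν * d ⟨0, by omega⟩ = 0
      rw [e0]
      simp only [ν]
      field_simp
      ring
  have hKd' : ∀ i, ∑ j, (((A * B) i j : ℤ) : ℝ) * d j = ν * d i := by
    intro i
    have := congrFun (congrFun hKd i) ()
    exact sub_eq_zero.1 this
  have hν : ν < 4 := by
    by_contra! hc
    have := h.eq_zero_of_four_le d (fun u => (hd0 u).le) (fun u => by
      rw [hKd']
      exact mul_le_mul_of_nonneg_right hc (hd0 u).le) ⟨0, by omega⟩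
    exact (hd0 _).ne' this
  have := hKd' ⟨0, by omega⟩
  simp only [d] at this
  rw [this]
  rw [show ((0 : ℕ) : ℝ) + 1 = 1 by norm_num, one_mul]
  exact mul_lt_mul_of_pos_right hν hs

/-- Against `B_n` with `n ≥ 3` the product of the two intertwiners is the square of the Coxeter
adjacency matrix: this is what finite type of the blue matrix forces upon the first row. -/
theorem HasComponents.mul_eq_sq_B (h : HasComponents (fromBlocks 0 A B 0) χ) (hn : 3 ≤ n)
    (hK : Commute (coxeterAdj (CartanMatrix.B n)ᵀ) (A * B))
    (hχ : ∀ i j : Fin n, coxeterAdj (CartanMatrix.B n)ᵀ i j ≠ 0 →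
      χ (Sum.inl i) ≠ χ (Sum.inl j)) :
    A * B = coxeterAdj (CartanMatrix.B n)ᵀ * coxeterAdj (CartanMatrix.B n)ᵀ := by
  have hlt := h.sum_lt (by omega) hK
  set X := coxeterAdj (CartanMatrix.B n)ᵀ with hX
  set θ := Real.pi / (2 * n) with hθ
  have hn' : (3 : ℝ) ≤ n := by exact_mod_cast hn
  have hθ0 : 0 < θ := by positivity
  have hnθ : (n : ℝ) * θ = Real.pi / 2 := by rw [hθ]; field_simp
  let i0 : Fin n := ⟨0, by omega⟩
  let i2 : Fin n := ⟨2, by omega⟩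
  -- The colours alternate along the path.
  have hpar : ∀ k : ℕ, ∀ hk : k < n, (χ (Sum.inl ⟨k, hk⟩) = χ (Sum.inl i0)) ↔ Even k := by
    intro k
    induction k with
    | zero => intro hk; simp [i0]
    | succ k ih =>
      intro hk
      have h1 := hχ ⟨k, by omega⟩ ⟨k + 1, hk⟩ (by rw [hX, coxeterAdj_B]; simp)
      have h2 := ih (by omega)
      rw [Nat.even_add_one, ← h2]
      revert h1
      generalize χ (Sum.inl ⟨k, by omega⟩) = x
      generalize χ (Sum.inl ⟨k + 1, hk⟩) = y
      generalize χ (Sum.inl i0) = z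
      revert x y z
      decide
  let c : Fin n → ℤ := fun j => (A * B) i0 j
  let d : Fin n → ℝ := fun j => Real.sin ((j.val + 1) * θ)
  have hmono : ∀ k l : ℕ, k ≤ l → l < n →
      Real.sin ((k + 1) * θ) ≤ Real.sin ((l + 1) * θ) := by
    intro k l hkl hl
    have h1 : ((l + 1 : ℕ) : ℝ) ≤ n := by exact_mod_cast hl
    have h2 : (k : ℝ) ≤ l := by exact_mod_cast hkl
    push_cast at h1
    refine Real.sin_le_sin_of_le_of_le_pi_div_two ?_ ?_ ?_
    · have : (0 : ℝ) ≤ (k + 1) * θ := by positivity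
      linarith [Real.pi_pos]
    · rw [← hnθ]
      exact mul_le_mul_of_nonneg_right h1 hθ0.le
    · exact mul_le_mul_of_nonneg_right (by linarith) hθ0.le
  have hc0 : ∀ j, 0 ≤ c j := fun j => h.mul_nonneg i0 j
  have hs : 0 < Real.sin θ := by
    refine Real.sin_pos_of_pos_of_lt_pi hθ0 ?_
    nlinarith [Real.pi_pos]
  have d0 : d i0 = Real.sin θ := by simp [d, i0]
  have dpos : ∀ j, 0 < d j := fun j => by
    have := hmono 0 j.val (by omega) j.2
    simp only [Nat.cast_zero, zero_add, one_mul] at this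
    exact hs.trans_le this
  have d2 : ∀ j : Fin n, 2 ≤ j.val → 2 * Real.sin θ ≤ d j := by
    intro j hj
    refine (two_mul_sin_le hθ0.le ?_).trans ?_
    · rw [hθ, div_le_div_iff₀ (by positivity) (by norm_num)]
      nlinarith [Real.pi_pos]
    · have := hmono 2 j.val hj j.2
      norm_num at this
      exact this
  have d4 : ∀ j : Fin n, 4 ≤ j.val → 3 * Real.sin θ ≤ d j := by
    intro j hj
    have hn5 : (5 : ℝ) ≤ n := by
      have := j.2
      exact_mod_cast (by omega : 5 ≤ n)
    refine (three_mul_sin_le hθ0.le ?_).trans ?_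
    · rw [hθ, div_le_div_iff₀ (by positivity) (by norm_num)]
      nlinarith [Real.pi_pos]
    · have := hmono 4 j.val hj j.2
      norm_num at this
      exact this
  have hsum : ∑ j, (c j : ℝ) * d j < 4 * Real.sin θ := hlt
  have hle : ∀ s : Finset (Fin n), ∑ j ∈ s, (c j : ℝ) * d j < 4 * Real.sin θ := fun s =>
    (Finset.sum_le_sum_of_subset_of_nonneg (Finset.subset_univ s) fun j _ _ =>
      _root_.mul_nonneg (by exact_mod_cast hc0 j) (dpos j).le).trans_lt hsum
  have hcol : χ (Sum.inl i0) = χ (Sum.inl i2) := ((hpar 2 (by omega)).2 even_two).symm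
  have hne : i0 ≠ i2 := by simp [i0, i2]
  have hc1 : 1 ≤ c i0 := h.one_le_diag hne hcol
  obtain ⟨j, hj, hcj⟩ := h.exists_ne hne hcol
  have hj2 : ∀ j, j ≠ i0 → c j ≠ 0 → 2 ≤ j.val := by
    intro j hj hcj
    have h1 := (hpar j.val j.2).1 (h.eq_color i0 j hcj).symm
    have h2 : j.val ≠ 0 := fun h0 => hj (Fin.ext h0)
    obtain ⟨r, hr⟩ := h1
    omega
  change 1 ≤ c j at hcj
  have hjv := hj2 j hj (by omega)
  have hcjR : (1 : ℝ) ≤ c j := by exact_mod_cast hcj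
  have hc1R : (1 : ℝ) ≤ c i0 := by exact_mod_cast hc1
  have e1 := hle {i0, j}
  rw [Finset.sum_pair hj.symm, d0] at e1
  -- As `d` is at least `2 sin θ` from the vertex `2` on and at least `3 sin θ` from the vertex `4`
  -- on, the bound `4 sin θ` leaves room for an entry `1` at each of the vertices `0` and `2` only.
  have c0_eq : c i0 = 1 := by
    by_contra hne
    have h2 : (2 : ℝ) ≤ c i0 := by exact_mod_cast (by omega : 2 ≤ c i0)
    nlinarith [d2 j hjv]
  have cj_eq : c j = 1 := by
    by_contra hne
    have h2 : (2 : ℝ) ≤ c j := by exact_mod_cast (by omega : 2 ≤ c j)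
    nlinarith [d2 j hjv]
  have hj_eq : j = i2 := by
    by_contra hne
    have h3 : 4 ≤ j.val := by
      obtain ⟨r, hr⟩ := (hpar j.val j.2).1 (h.eq_color i0 j (by change c j ≠ 0; omega)).symm
      have : j.val ≠ 2 := fun h2 => hne (Fin.ext h2)
      omega
    nlinarith [d4 j h3]
  subst hj_eq
  have hrest : ∀ k, k ≠ i0 → k ≠ i2 → c k = 0 := by
    intro k h0 h2
    by_contra hk
    have hck : (1 : ℝ) ≤ c k := by
      have := hc0 k
      exact_mod_cast (by omega : 1 ≤ c k)
    have e2 := hle {i0, i2, k}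
    rw [Finset.sum_insert (by simp [hne, h0.symm]), Finset.sum_pair h2.symm, d0] at e2
    nlinarith [d2 k (hj2 k h0 hk), d2 i2 le_rfl]
  -- Both sides commute with `X` and have the same first row.
  rw [← sub_eq_zero]
  refine eq_zero_of_row_zero (X := X) (Y := X) ?_ ?_ ?_ ?_
  · intro i j hij
    rw [hX, coxeterAdj_B, if_pos hij]
    simp
  · intro i j hij
    rw [hX, coxeterAdj_B, if_neg (by omega), if_neg (by omega)]
  · rw [Matrix.mul_sub, Matrix.sub_mul, hK.eq, Matrix.mul_assoc X X X]
  · intro i hi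
    rw [show i = i0 from Fin.ext hi]
    ext k
    rw [Matrix.sub_apply, mul_apply (M := X), Finset.sum_eq_single ⟨1, by omega⟩]
    · change c k - _ = 0
      rw [hX, coxeterAdj_B, coxeterAdj_B]
      by_cases k0 : k = i0
      · rw [k0, c0_eq]; simp [i0]; omega
      · by_cases k2 : k = i2
        · rw [k2, cj_eq]; simp [i0, i2]
        · rw [hrest k k0 k2]
          have h1 : k.val ≠ 0 := fun h => k0 (Fin.ext h)
          have h2 : k.val ≠ 2 := fun h => k2 (Fin.ext h)
          simp [i0, h1, h2.symm]
    · intro l _ hl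
      have : l.val ≠ 1 := fun h => hl (Fin.ext h)
      rw [hX, coxeterAdj_B, if_neg (by simp [i0]; omega), if_neg (by simp [i0])]
      simp
    · simp

end TypeB

/-- Against `F₄` the product of the two intertwiners is the square of the Coxeter adjacency
matrix. -/
theorem HasComponents.mul_eq_sq_F₄ {W : Type*} [Fintype W] {A : Matrix (Fin 4) W ℤ}
    {B : Matrix W (Fin 4) ℤ} {χ : Fin 4 ⊕ W → Bool} (h : HasComponents (fromBlocks 0 A B 0) χ)
    (hK : Commute (coxeterAdj CartanMatrix.F₄) (A * B))
    (hχ : ∀ i j : Fin 4, coxeterAdj CartanMatrix.F₄ i j ≠ 0 → χ (Sum.inl i) ≠ χ (Sum.inl j)) :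
    A * B = coxeterAdj CartanMatrix.F₄ * coxeterAdj CartanMatrix.F₄ := by
  have hM : coxeterAdj CartanMatrix.F₄ = !![0, 1, 0, 0; 1, 0, 2, 0; 0, 1, 0, 1; 0, 0, 1, 0] := by
    decide
  rw [hM] at hK hχ ⊢
  have c01 := hχ 0 1 (by simp)
  have c12 := hχ 1 2 (by simp)
  have c23 := hχ 2 3 (by simp)
  have hcol : χ (Sum.inl 0) = χ (Sum.inl 2) := by
    revert c01 c12
    generalize χ (Sum.inl 0) = x
    generalize χ (Sum.inl 1) = y
    generalize χ (Sum.inl 2) = z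
    revert x y z
    decide
  have k1 : (A * B) 0 1 = 0 := by
    by_contra hne
    exact c01 (h.eq_color 0 1 hne)
  have k3 : (A * B) 0 3 = 0 := by
    by_contra hne
    exact c23 (hcol.symm.trans (h.eq_color 0 3 hne))
  have k0 := h.one_le_diag (u := 0) (v := 2) (by decide) hcol
  obtain ⟨j, hj, hcj⟩ := h.exists_ne (u := 0) (v := 2) (by decide) hcol
  have k2 : 1 ≤ (A * B) 0 2 := by
    fin_cases j
    · exact absurd rfl hj
    · simp [k1] at hcj
    · exact hcj
    · simp [k3] at hcj
  have kd := h.diag_le 1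
  have hK' := hK.eq
  generalize A * B = K at *
  have e := fun i j => congrFun (congrFun hK' i) j
  have e00 := e 0 0
  have e01 := e 0 1
  have e02 := e 0 2
  have e03 := e 0 3
  have e10 := e 1 0
  have e11 := e 1 1
  have e12 := e 1 2
  have e13 := e 1 3
  have e20 := e 2 0
  have e21 := e 2 1
  have e22 := e 2 2
  have e23 := e 2 3
  simp [mul_apply, Fin.sum_univ_four, k1, k3] at e00 e01 e02 e03 e10 e11 e12 e13 e20 e21 e22 e23
  ext i j
  fin_cases i <;> fin_cases j <;> simp [mul_apply, Fin.sum_univ_four] <;> omega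

/-! ### Relabelling, folding and block forms -/

namespace Biagram

variable {U V W U' W' V' : Type*}

lemma Iso.refl (P : Biagram V) : P.Iso P := ⟨Equiv.refl V, rfl, rfl⟩

lemma Iso.symm {P : Biagram V} {Q : Biagram W} (h : P.Iso Q) : Q.Iso P := by
  obtain ⟨e, h1, h2⟩ := h
  exact ⟨e.symm, by rw [h1]; simp, by rw [h2]; simp⟩

lemma Iso.trans {P : Biagram V} {Q : Biagram W} {R : Biagram U} (h : P.Iso Q) (h' : Q.Iso R) :
    P.Iso R := by
  obtain ⟨e, h1, h2⟩ := h
  obtain ⟨e', h1', h2'⟩ := h'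
  exact ⟨e.trans e', by rw [h1, h1']; rfl, by rw [h2, h2']; rfl⟩

lemma Iso.dual {P : Biagram V} {Q : Biagram W} (h : P.Iso Q) : P.dual.Iso Q.dual := by
  obtain ⟨e, h1, h2⟩ := h
  exact ⟨e, h2, h1⟩

lemma Iso.flip {P : Biagram V} {Q : Biagram W} (h : P.Iso Q) : P.flip.Iso Q.flip := by
  obtain ⟨e, h1, h2⟩ := h
  exact ⟨e, by simp [Biagram.flip, h1], by simp [Biagram.flip, h2]⟩

/-- The relabelling `e` is an isomorphism from `P` to `Q`. -/
def IsoVia (e : V ≃ W) (P : Biagram V) (Q : Biagram W) : Prop :=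
  P.red = Q.red.submatrix e e ∧ P.blue = Q.blue.submatrix e e

lemma IsoVia.iso {e : V ≃ W} {P : Biagram V} {Q : Biagram W} (h : IsoVia e P Q) : P.Iso Q := ⟨e, h⟩

lemma IsoVia.flip {e : V ≃ W} {P : Biagram V} {Q : Biagram W} (h : IsoVia e P Q) :
    IsoVia e P.flip Q.flip :=
  ⟨by simp [Biagram.flip, h.1], by simp [Biagram.flip, h.2]⟩

/-- An isomorphism that carries the orbits and the representatives on one side to those on the
other descends to the folded biagrams. -/
lemma IsoVia.fold [Fintype V] [Fintype V'] [DecidableEq W] [DecidableEq W'] {P : Biagram V}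
    {Q : Biagram V'} {e : V ≃ V'} (h : IsoVia e P Q) {π : V → W} {σ : W → V} {π' : V' → W'}
    {σ' : W' → V'} {f : W ≃ W'} (hπ : ∀ v, π' (e v) = f (π v)) (hσ : ∀ w, σ' (f w) = e (σ w)) :
    IsoVia f (P.fold π σ) (Q.fold π' σ') := by
  have key : ∀ (M : Matrix V V ℤ) (N : Matrix V' V' ℤ), M = N.submatrix e e → ∀ I J,
      ∑ i with π i = I, M i (σ J) = ∑ i with π' i = f I, N i (σ' (f J)) := by
    rintro _ N rfl I J
    refine Finset.sum_equiv e (fun i => ?_) (fun i _ => ?_)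
    · simp [hπ]
    · rw [hσ]; rfl
  exact ⟨by ext I J; exact key _ _ h.1 I J, by ext I J; exact key _ _ h.2 I J⟩

/-- The biagram with red matrix `diag(X, Y)` and blue matrix with off-diagonal blocks
`A` and `B`. -/
def ofBlocks (X : Matrix U U ℤ) (Y : Matrix W W ℤ) (A : Matrix U W ℤ) (B : Matrix W U ℤ) :
    Biagram (U ⊕ W) :=
  ⟨fromBlocks X 0 0 Y, fromBlocks 0 A B 0⟩

lemma ofBlocks_flip (X : Matrix U U ℤ) (Y : Matrix W W ℤ) (A : Matrix U W ℤ) (B : Matrix W U ℤ) :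
    (ofBlocks X Y A B).flip = ofBlocks Xᵀ Yᵀ Bᵀ Aᵀ := by
  simp [ofBlocks, Biagram.flip, fromBlocks_transpose]

lemma ofBlocks_swap (X : Matrix U U ℤ) (Y : Matrix W W ℤ) (A : Matrix U W ℤ) (B : Matrix W U ℤ) :
    (ofBlocks X Y A B).Iso (ofBlocks Y X B A) := by
  refine ⟨Equiv.sumComm U W, ?_, ?_⟩ <;> ext (i | i) (j | j) <;> rfl

lemma ofBlocks_relabel (X : Matrix U U ℤ) (Y : Matrix W W ℤ) (A : Matrix U W ℤ)
    (B : Matrix W U ℤ) (f : U' ≃ U) (g : W' ≃ W) :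
    (ofBlocks (X.submatrix f f) (Y.submatrix g g) (A.submatrix f g) (B.submatrix g f)).Iso
      (ofBlocks X Y A B) := by
  refine ⟨Equiv.sumCongr f g, ?_, ?_⟩ <;> ext (i | i) (j | j) <;> rfl

/-- The matrix that adds up the coordinates over the fibres of `π`. -/
def foldMatrix [DecidableEq W] (π : V → W) : Matrix W V ℤ := of fun I i => if π i = I then 1 else 0

/-- The matrix that selects the coordinates in the image of `σ`. -/
def selectMatrix [DecidableEq V] (σ : W → V) : Matrix V W ℤ :=
  of fun i J => if i = σ J then 1 else 0

lemma foldMatrix_mul_apply [Fintype V] [DecidableEq W] (π : V → W) (X : Matrix V U ℤ) (I : W)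
    (u : U) : (foldMatrix π * X) I u = ∑ i with π i = I, X i u := by
  simp [mul_apply, foldMatrix, Finset.sum_filter]

lemma mul_selectMatrix_apply [Fintype V] [DecidableEq V] (σ : W → V) (X : Matrix U V ℤ) (u : U)
    (J : W) : (X * selectMatrix σ) u J = X u (σ J) := by
  simp [mul_apply, selectMatrix]

variable [Fintype U] [Fintype W] [DecidableEq U] [DecidableEq W] [DecidableEq U'] [DecidableEq W']

lemma ofBlocks_fold_left (X : Matrix U U ℤ) (Y : Matrix W W ℤ) (A : Matrix U W ℤ)
    (B : Matrix W U ℤ) (π : U → U') (σ : U' → U) :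
    (ofBlocks X Y A B).fold (Sum.map π id) (Sum.map σ id) =
      ofBlocks (foldMatrix π * X * selectMatrix σ) Y (foldMatrix π * A) (B * selectMatrix σ) := by
  simp only [ofBlocks, fold, mk.injEq]
  constructor <;> ext (i | i) (j | j) <;>
    simp [Finset.sum_filter, Fintype.sum_sum_type, mul_selectMatrix_apply, foldMatrix_mul_apply]

lemma ofBlocks_fold_right (X : Matrix U U ℤ) (Y : Matrix W W ℤ) (A : Matrix U W ℤ)
    (B : Matrix W U ℤ) (π : W → W') (σ : W' → W) :
    (ofBlocks X Y A B).fold (Sum.map id π) (Sum.map id σ) =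
      ofBlocks X (foldMatrix π * Y * selectMatrix σ) (A * selectMatrix σ) (foldMatrix π * B) := by
  simp only [ofBlocks, fold, mk.injEq]
  constructor <;> ext (i | i) (j | j) <;>
    simp [Finset.sum_filter, Fintype.sum_sum_type, mul_selectMatrix_apply, foldMatrix_mul_apply]

/-- The pair of conditions on the blocks that amounts to admissibility. -/
structure Intertwine (X : Matrix U U ℤ) (Y : Matrix W W ℤ) (A : Matrix U W ℤ)
    (B : Matrix W U ℤ) : Prop where
  left : X * A = A * Y
  right : Y * B = B * X

namespace Intertwine

variable {X : Matrix U U ℤ} {Y : Matrix W W ℤ} {A : Matrix U W ℤ} {B : Matrix W U ℤ}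

lemma swap (h : Intertwine X Y A B) : Intertwine Y X B A := ⟨h.right, h.left⟩

lemma flip (h : Intertwine X Y A B) : Intertwine Xᵀ Yᵀ Bᵀ Aᵀ :=
  ⟨by rw [← transpose_mul, ← transpose_mul, h.right],
    by rw [← transpose_mul, ← transpose_mul, h.left]⟩

/-- Folding preserves admissibility if the blocks whose columns are folded are constant along the
orbits, that is, if picking a representative of each orbit and spreading out again does nothing. -/
lemma fold_left [Fintype U'] (h : Intertwine X Y A B) {π : U → U'} {σ : U' → U}
    (hX : X * selectMatrix σ * foldMatrix π = X) (hB : B * selectMatrix σ * foldMatrix π = B) :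
    Intertwine (foldMatrix π * X * selectMatrix σ) Y (foldMatrix π * A) (B * selectMatrix σ) where
  left := calc
    _ = foldMatrix π * (X * selectMatrix σ * foldMatrix π) * A := by simp only [Matrix.mul_assoc]
    _ = _ := by rw [hX, Matrix.mul_assoc, h.left, Matrix.mul_assoc]
  right := calc
    _ = Y * B * selectMatrix σ := by simp only [Matrix.mul_assoc]
    _ = B * selectMatrix σ * foldMatrix π * X * selectMatrix σ := by rw [hB, h.right]
    _ = _ := by simp only [Matrix.mul_assoc]

lemma fold_right [Fintype W'] (h : Intertwine X Y A B) {π : W → W'} {σ : W' → W}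
    (hY : Y * selectMatrix σ * foldMatrix π = Y) (hA : A * selectMatrix σ * foldMatrix π = A) :
    Intertwine X (foldMatrix π * Y * selectMatrix σ) (A * selectMatrix σ) (foldMatrix π * B) :=
  (h.swap.fold_left hY hA).swap

end Intertwine

/-- The Cartan matrices commute if and only if the Coxeter adjacency matrices do. -/
lemma isAdmissible_iff [Fintype V] [DecidableEq V] {P : Biagram V} :
    P.IsAdmissible ↔ P.red * P.blue = P.blue * P.red := by
  unfold IsAdmissible
  rw [commute_iff_eq]
  simp only [sub_mul, mul_sub, smul_mul_assoc, mul_smul_comm, one_mul, mul_one, smul_sub]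
  constructor
  · intro h
    have e : ∀ a b c x y : Matrix V V ℤ, a - b - (c - x) = a - c - (b - y) → x = y := by
      intro a b c x y h
      have := congrArg (fun z => z - a + b + c) h
      simpa [sub_eq_add_neg, add_assoc, add_comm, add_left_comm] using this
    exact e _ _ _ _ _ h
  · intro h
    rw [h]; abel

lemma intertwine_iff {X : Matrix U U ℤ} {Y : Matrix W W ℤ} {A : Matrix U W ℤ}
    {B : Matrix W U ℤ} : (ofBlocks X Y A B).IsAdmissible ↔ Intertwine X Y A B := by
  rw [isAdmissible_iff]
  simp only [ofBlocks, fromBlocks_multiply, Matrix.mul_zero, Matrix.zero_mul, add_zero, zero_add]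
  rw [fromBlocks_inj]
  exact ⟨fun h => ⟨h.2.1, h.2.2.1⟩, fun h => ⟨rfl, h.left, h.right, rfl⟩⟩

lemma Iso.isAdmissible [Fintype V] [DecidableEq V] {P : Biagram V} {Q : Biagram W} (h : P.Iso Q)
    (hQ : Q.IsAdmissible) : P.IsAdmissible := by
  obtain ⟨e, h1, h2⟩ := h
  rw [isAdmissible_iff] at *
  rw [h1, h2, submatrix_mul_equiv, submatrix_mul_equiv, hQ]

end Biagram

/-! ### Block forms and self-duality of the bindings in the list -/

namespace Biagram

section FoldD

/-- The matrix that selects all but the last of `n + 1` coordinates. -/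
abbrev dropLast (n : ℕ) : Matrix (Fin (n + 1)) (Fin n) ℤ := selectMatrix Fin.castSucc

lemma coxeterAdj_C_eq_transpose (n : ℕ) :
    coxeterAdj (CartanMatrix.C n)ᵀ = (coxeterAdj (CartanMatrix.B n)ᵀ)ᵀ := by
  ext i j
  rw [transpose_apply, coxeterAdj_B, coxeterAdj_C]

lemma coxeterAdj_D_transpose (n : ℕ) (hn : 3 ≤ n) :
    (coxeterAdj (CartanMatrix.D n))ᵀ = coxeterAdj (CartanMatrix.D n) := by
  ext i j
  rw [transpose_apply, coxeterAdj_D _ _ hn, coxeterAdj_D _ _ hn]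
  grind

variable (n : ℕ) (hn : 2 ≤ n)

/-- The two exchanged leaves have the same neighbours. -/
lemma coxeterAdj_D_mul_fold :
    coxeterAdj (CartanMatrix.D (n + 1)) * dropLast n * foldMatrix (orbD n hn) =
      coxeterAdj (CartanMatrix.D (n + 1)) := by
  ext i j
  rw [mul_apply, Finset.sum_eq_single (orbD n hn j)]
  · rw [mul_selectMatrix_apply, coxeterAdj_D _ _ (by omega), coxeterAdj_D _ _ (by omega)]
    simp only [foldMatrix, of_apply, if_true, mul_one, orbD, Fin.val_castSucc]
    have := i.2
    have := j.2
    congr 1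
    simp only [eq_iff_iff]
    omega
  · intro b _ hb
    simp [foldMatrix, hb.symm]
  · simp

lemma fold_coxeterAdj_D_apply (i : Fin n) (j : Fin (n + 1)) :
    (foldMatrix (orbD n hn) * coxeterAdj (CartanMatrix.D (n + 1))) i j =
      if i.val + 1 = n then 2 * coxeterAdj (CartanMatrix.D (n + 1)) i.castSucc j
      else coxeterAdj (CartanMatrix.D (n + 1)) i.castSucc j := by
  rw [foldMatrix_mul_apply, Finset.sum_filter, Fin.sum_univ_castSucc]
  rw [Finset.sum_eq_single i]
  · have hi := i.2
    have hj := j.2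
    simp only [coxeterAdj_D _ _ (show 3 ≤ n + 1 by omega), orbD, Fin.ext_iff, Fin.val_castSucc,
      Fin.val_last]
    grind
  · intro b _ hb
    rw [if_neg]
    intro h
    apply hb
    have hi := b.2
    simp only [orbD, Fin.ext_iff, Fin.val_castSucc] at h ⊢
    omega
  · simp

lemma fold_coxeterAdj_D :
    foldMatrix (orbD n hn) * coxeterAdj (CartanMatrix.D (n + 1)) * dropLast n =
      coxeterAdj (CartanMatrix.B n)ᵀ := by
  ext i j
  rw [mul_selectMatrix_apply, fold_coxeterAdj_D_apply, coxeterAdj_D _ _ (by omega), coxeterAdj_B]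
  have := i.2
  have := j.2
  simp only [Fin.val_castSucc]
  grind

/-- The upper right blue block of `B_n ⋉ D_{n+1}`. -/
def blockBD : Matrix (Fin n) (Fin (n + 1)) ℤ :=
  foldMatrix (orbD n hn) * coxeterAdj (CartanMatrix.D (n + 1))

/-- The lower left blue block of `B_n ⋉ D_{n+1}`. -/
def blockDB : Matrix (Fin (n + 1)) (Fin n) ℤ :=
  coxeterAdj (CartanMatrix.D (n + 1)) * dropLast n

lemma bLtimesD_eq : bLtimesD n hn = ofBlocks (coxeterAdj (CartanMatrix.B n)ᵀ)
    (coxeterAdj (CartanMatrix.D (n + 1))) (blockBD n hn) (blockDB n) := by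
  rw [← fold_coxeterAdj_D n hn, blockBD, blockDB, ← ofBlocks_fold_left]
  rfl

lemma intertwine_bLtimesD : Intertwine (coxeterAdj (CartanMatrix.B n)ᵀ)
    (coxeterAdj (CartanMatrix.D (n + 1))) (blockBD n hn) (blockDB n) := by
  rw [← fold_coxeterAdj_D n hn]
  exact Intertwine.fold_left ⟨rfl, rfl⟩ (coxeterAdj_D_mul_fold n hn) (coxeterAdj_D_mul_fold n hn)

lemma cLtimesD_eq : cLtimesD n hn = ofBlocks (coxeterAdj (CartanMatrix.C n)ᵀ)
    (coxeterAdj (CartanMatrix.D (n + 1))) (blockDB n)ᵀ (blockBD n hn)ᵀ := by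
  rw [cLtimesD, bLtimesD_eq, ofBlocks_flip, coxeterAdj_D_transpose _ (by omega),
    coxeterAdj_C_eq_transpose]

lemma intertwine_cLtimesD : Intertwine (coxeterAdj (CartanMatrix.C n)ᵀ)
    (coxeterAdj (CartanMatrix.D (n + 1))) (blockDB n)ᵀ (blockBD n hn)ᵀ := by
  have := (intertwine_bLtimesD n hn).flip
  rwa [coxeterAdj_D_transpose _ (by omega), ← coxeterAdj_C_eq_transpose] at this

end FoldD

lemma bBowtieC_eq (n : ℕ) (hn : 3 ≤ n) : bBowtieC n hn = ofBlocks (coxeterAdj (CartanMatrix.C n)ᵀ)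
    (coxeterAdj (CartanMatrix.B n)ᵀ) ((blockDB n)ᵀ * dropLast n)
    (foldMatrix (orbD n (by omega)) * (blockBD n (by omega))ᵀ) := by
  rw [bBowtieC, cLtimesD_eq, ofBlocks_fold_right, fold_coxeterAdj_D]

lemma intertwine_bBowtieC (n : ℕ) (hn : 3 ≤ n) : Intertwine (coxeterAdj (CartanMatrix.C n)ᵀ)
    (coxeterAdj (CartanMatrix.B n)ᵀ) ((blockDB n)ᵀ * dropLast n)
    (foldMatrix (orbD n (by omega)) * (blockBD n (by omega))ᵀ) := by
  rw [← fold_coxeterAdj_D n (by omega)]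
  refine (intertwine_cLtimesD n (by omega)).fold_right (coxeterAdj_D_mul_fold n (by omega)) ?_
  rw [blockDB, transpose_mul, coxeterAdj_D_transpose _ (by omega), Matrix.mul_assoc,
    Matrix.mul_assoc, ← Matrix.mul_assoc (coxeterAdj _), coxeterAdj_D_mul_fold]

/-- The involution of `U ⊕ W` that exchanges the part of `U` where `s` holds with the part of `W`
where `t` holds. -/
def swapPart {U W : Type*} (f : U → W) (g : W → U) (s : U → Prop) (t : W → Prop)
    [DecidablePred s] [DecidablePred t] (hs : ∀ u, s u → t (f u) ∧ g (f u) = u)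
    (ht : ∀ w, t w → s (g w) ∧ f (g w) = w) : U ⊕ W ≃ U ⊕ W :=
  Function.Involutive.toPerm
    (Sum.elim (fun u => if s u then Sum.inr (f u) else Sum.inl u)
      (fun w => if t w then Sum.inl (g w) else Sum.inr w)) (by
    rintro (u | w)
    · by_cases h : s u
      · simp [h, hs u h]
      · simp [h]
    · by_cases h : t w
      · simp [h, ht w h]
      · simp [h])

section SwapPart

variable {U W : Type*} {f : U → W} {g : W → U} {s : U → Prop} {t : W → Prop}
    [DecidablePred s] [DecidablePred t] {hs : ∀ u, s u → t (f u) ∧ g (f u) = u}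
    {ht : ∀ w, t w → s (g w) ∧ f (g w) = w}

@[simp] lemma swapPart_inl (u : U) : swapPart f g s t hs ht (Sum.inl u) =
    if s u then Sum.inr (f u) else Sum.inl u := rfl

@[simp] lemma swapPart_inr (w : W) : swapPart f g s t hs ht (Sum.inr w) =
    if t w then Sum.inl (g w) else Sum.inr w := rfl

end SwapPart

/-- The twist of a bipartite matrix is self-dual: exchange the two copies on one colour class. -/
lemma twist_dual {V : Type*} (M : Matrix V V ℤ) (s : V → Prop) [DecidablePred s]
    (h : ∀ i j, M i j ≠ 0 → (s i ↔ ¬ s j)) :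
    IsoVia (swapPart id id s s (fun _ h => ⟨h, rfl⟩) fun _ h => ⟨h, rfl⟩) (twist M).dual
      (twist M) := by
  have h' : ∀ i j, M i j = 0 ∨ (s i ↔ ¬ s j) := fun i j => or_iff_not_imp_left.2 (h i j)
  constructor <;> ext (i | i) (j | j) <;> rcases h' i j with h | h <;> by_cases hj : s j <;>
    by_cases hi : s i <;> simp [twist, Biagram.dual, hi, hj, h] <;> simp_all

/-- Along a path the parity of the distance from the last vertex is a colouring. -/
lemma twist_dual_B (n : ℕ) : (twist (coxeterAdj (CartanMatrix.B n)ᵀ)).dual.Iso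
    (twist (coxeterAdj (CartanMatrix.B n)ᵀ)) := by
  refine (twist_dual _ (fun i => Even i.val) fun i j hij => ?_).iso
  have : i.val + 1 = j.val ∨ j.val + 1 = i.val := by
    rw [coxeterAdj_B] at hij; grind
  rcases this with h | h <;> simp only [← h, Nat.even_add_one] <;> tauto

/-- The vertices of `D_{n+1}` other than the last one whose distance from the last but one
vertex is odd. -/
def alt (n : ℕ) {m : ℕ} (i : Fin m) : Prop := i.val < n ∧ Even (i.val + n)

instance (n : ℕ) {m : ℕ} : DecidablePred (alt n (m := m)) := fun _ => instDecidableAnd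

lemma twist_dual_D (n : ℕ) (hn : 2 ≤ n) : IsoVia
    (swapPart id id (alt n) (alt n) (fun _ h => ⟨h, rfl⟩) fun _ h => ⟨h, rfl⟩)
    (twist (coxeterAdj (CartanMatrix.D (n + 1)))).dual
    (twist (coxeterAdj (CartanMatrix.D (n + 1)))) := by
  refine twist_dual _ (alt n) fun i j hij => ?_
  rw [coxeterAdj_D _ _ (by omega)] at hij
  simp only [alt, Nat.even_iff]
  have := i.2
  have := j.2
  by_contra hc
  apply hij
  rw [if_neg]
  omega

section DualD

variable (n : ℕ) (hn : 2 ≤ n)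

/-- The self-duality of the twist `D_{n+1} × D_{n+1}` descends to the fold, since the colour class
on which the two copies are exchanged does not contain the folded leaves. -/
lemma bLtimesD_dual : IsoVia (swapPart Fin.castSucc (orbD n hn) (alt n) (alt n)
    (fun u h => ⟨h, Fin.ext (by have := u.2; simp [orbD]; omega)⟩)
    (fun w h => ⟨⟨by have := h.1; simp [orbD]; omega, by
      have := h.1; have h2 := h.2; simp only [orbD]; rwa [min_eq_left (by omega)]⟩,
      Fin.ext (by have := h.1; simp [orbD]; omega)⟩))
    (bLtimesD n hn).dual (bLtimesD n hn) := by
  refine (twist_dual_D n hn).fold ?_ ?_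
  · rintro (v | v)
    · have h : alt n (orbD n hn v) ↔ alt n v := by
        have := v.2
        simp only [alt, orbD, Nat.even_iff]
        omega
      by_cases hv : alt n v
      · have h2 := hv.1
        simp only [Sum.map_inl, swapPart_inl, h, hv, if_true, id, Sum.map_inr]
        refine congrArg _ (Fin.ext ?_)
        simp [orbD]
        omega
      · simp [h, hv]
    · by_cases hv : alt n v <;> simp [hv]
  · rintro (v | v)
    · have h : alt n v.castSucc ↔ alt n v := Iff.rfl
      by_cases hv : alt n v <;> simp [h, hv]
    · by_cases hv : alt n v
      · have h2 := hv.1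
        simp [hv, Fin.ext_iff, orbD]
        omega
      · simp [hv]

lemma cLtimesD_dual : (cLtimesD n hn).dual.Iso (cLtimesD n hn) := (bLtimesD_dual n hn).flip.iso

end DualD

lemma bBowtieC_dual (n : ℕ) (hn : 3 ≤ n) : (bBowtieC n hn).dual.Iso (bBowtieC n hn) := by
  refine (IsoVia.fold (f := swapPart id id (alt n) (alt n) (fun _ h => ⟨h, rfl⟩)
    (fun _ h => ⟨h, rfl⟩)) (bLtimesD_dual n (by omega)).flip ?_ ?_).iso
  · rintro (v | v)
    · by_cases hv : alt n v
      · simp [hv, Fin.ext_iff, orbD]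
        omega
      · simp [hv]
    · have h : alt n (orbD n (by omega) v) ↔ alt n v := by
        have := v.2
        simp only [alt, orbD, Nat.even_iff]
        omega
      by_cases hv : alt n v <;> simp [h, hv]
  · rintro (v | v)
    · by_cases hv : alt n v <;> simp [hv]
    · have h : alt n v.castSucc ↔ alt n v := Iff.rfl
      by_cases hv : alt n v
      · have h2 := hv.1
        simp only [Sum.map_inr, swapPart_inr, h, hv, if_true, id, Sum.map_inl]
        exact congrArg _ (Fin.ext (by simp [orbD]; omega))
      · simp [h, hv]

lemma twist_dual_F₄ : (twist (coxeterAdj CartanMatrix.F₄)).dual.Iso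
    (twist (coxeterAdj CartanMatrix.F₄)) :=
  (twist_dual _ (fun i => i = 0 ∨ i = 2)
    (show ∀ i j, entry (coxeterAdj CartanMatrix.F₄) i j ≠ 0 → _ by decide)).iso

lemma twist_dual_G₂ : (twist (coxeterAdj CartanMatrix.G₂)).dual.Iso
    (twist (coxeterAdj CartanMatrix.G₂)) :=
  (twist_dual _ (fun i => i = 0)
    (show ∀ i j, entry (coxeterAdj CartanMatrix.G₂) i j ≠ 0 → _ by decide)).iso

lemma gLtimesD₁_eq : gLtimesD₁ = ofBlocks (coxeterAdj CartanMatrix.G₂)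
    (coxeterAdj (CartanMatrix.D 4)) !![0, 3, 0, 0; 1, 0, 1, 1] !![0, 1; 1, 0; 0, 1; 0, 1] :=
  congrArg₂ mk (show gLtimesD₁.red = _ by decide) (show gLtimesD₁.blue = _ by decide)

lemma intertwine_gLtimesD₁ : Intertwine (coxeterAdj CartanMatrix.G₂)
    (coxeterAdj (CartanMatrix.D 4)) !![0, 3, 0, 0; 1, 0, 1, 1] !![0, 1; 1, 0; 0, 1; 0, 1] :=
  ⟨by decide, by decide⟩

lemma gLtimesD₁_dual :
    IsoVia (Equiv.swap (Sum.inl 1) (Sum.inr 1)) gLtimesD₁.dual gLtimesD₁ :=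
  ⟨by decide, by decide⟩

lemma bBowtieG₁_eq : bBowtieG₁ = ofBlocks (coxeterAdj CartanMatrix.G₂)
    (coxeterAdj (CartanMatrix.B 3)ᵀ) !![0, 3, 0; 1, 0, 1] !![0, 1; 1, 0; 0, 2] :=
  congrArg₂ mk (show bBowtieG₁.red = _ by decide) (show bBowtieG₁.blue = _ by decide)

lemma intertwine_bBowtieG₁ : Intertwine (coxeterAdj CartanMatrix.G₂)
    (coxeterAdj (CartanMatrix.B 3)ᵀ) !![0, 3, 0; 1, 0, 1] !![0, 1; 1, 0; 0, 2] :=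
  ⟨by decide, by decide⟩

lemma bBowtieG₁_dual :
    IsoVia (Equiv.swap (Sum.inl 1) (Sum.inr 1)) bBowtieG₁.dual bBowtieG₁ :=
  ⟨by decide, by decide⟩

lemma bBowtieG₂_eq : bBowtieG₂ = ofBlocks (coxeterAdj CartanMatrix.G₂)ᵀ
    (coxeterAdj (CartanMatrix.B 3)ᵀ) !![0, 1, 0; 1, 0, 1] !![0, 1; 3, 0; 0, 2] :=
  congrArg₂ mk (show bBowtieG₂.red = _ by decide) (show bBowtieG₂.blue = _ by decide)

lemma intertwine_bBowtieG₂ : Intertwine (coxeterAdj CartanMatrix.G₂)ᵀ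
    (coxeterAdj (CartanMatrix.B 3)ᵀ) !![0, 1, 0; 1, 0, 1] !![0, 1; 3, 0; 0, 2] :=
  ⟨by decide, by decide⟩

lemma bBowtieG₂_dual :
    IsoVia (Equiv.swap (Sum.inl 1) (Sum.inr 1)) bBowtieG₂.dual bBowtieG₂ :=
  ⟨by decide, by decide⟩

lemma bBowtieG₂_flip : bBowtieG₂.flip.Iso cBowtieG₁ :=
  ⟨Equiv.sumComm _ _, by decide, by decide⟩

lemma bBoxC_eq : bBoxC = ofBlocks (coxeterAdj (CartanMatrix.B 4)ᵀ)
    (coxeterAdj (CartanMatrix.C 4)ᵀ)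
    !![0, 0, 0, 1; 0, 0, 1, 0; 0, 1, 0, 1; 1, 0, 1, 0]
    !![0, 0, 0, 1; 0, 0, 2, 0; 0, 2, 0, 1; 1, 0, 1, 0] :=
  congrArg₂ mk (show bBoxC.red = _ by decide) (show bBoxC.blue = _ by decide)

lemma intertwine_bBoxC : Intertwine (coxeterAdj (CartanMatrix.B 4)ᵀ)
    (coxeterAdj (CartanMatrix.C 4)ᵀ)
    !![0, 0, 0, 1; 0, 0, 1, 0; 0, 1, 0, 1; 1, 0, 1, 0]
    !![0, 0, 0, 1; 0, 0, 2, 0; 0, 2, 0, 1; 1, 0, 1, 0] :=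
  ⟨by decide, by decide⟩

lemma bBoxC_dual : IsoVia
    ((Equiv.swap (Sum.inl 1) (Sum.inr 3)).trans (Equiv.swap (Sum.inl 3) (Sum.inr 1)))
    bBoxC.dual bBoxC :=
  ⟨by decide, by decide⟩

lemma bBoxC_flip : bBoxC.flip.Iso bBoxC :=
  ⟨Equiv.sumComm _ _, by decide, by decide⟩

lemma bBowtieC_flip (n : ℕ) (hn : 3 ≤ n) : (bBowtieC n hn).flip.Iso (bBowtieC n hn) := by
  have h1 : ((blockDB n)ᵀ * dropLast n)ᵀ = (blockDB n)ᵀ * dropLast n := by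
    rw [blockDB, transpose_mul, transpose_transpose, transpose_mul,
      coxeterAdj_D_transpose _ (by omega), Matrix.mul_assoc]
  have h2 : (foldMatrix (orbD n (by omega)) * (blockBD n (by omega))ᵀ)ᵀ =
      foldMatrix (orbD n (by omega)) * (blockBD n (by omega))ᵀ := by
    rw [blockBD, transpose_mul, transpose_transpose, transpose_mul,
      coxeterAdj_D_transpose _ (by omega), Matrix.mul_assoc]
  rw [bBowtieC_eq, ofBlocks_flip, h1, h2, coxeterAdj_C_eq_transpose, transpose_transpose]
  exact ofBlocks_swap _ _ _ _

end Biagram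

/-! ### The biagrams of the list are admissible non-ADE double bindings -/

/-- `M` is a relabelling of the Coxeter adjacency matrix of a connected Dynkin diagram. -/
def IsConnectedDynkin {U : Type*} (M : Matrix U U ℤ) : Prop :=
  ∃ (X : DynkinType) (f : U ≃ Fin X.rank), M = X.adj.submatrix f f

namespace IsConnectedDynkin

lemma adj (X : DynkinType) : IsConnectedDynkin X.adj := ⟨X, Equiv.refl _, rfl⟩

lemma submatrix {U U' : Type*} {M : Matrix U U ℤ} (h : IsConnectedDynkin M) (f : U' ≃ U) :
    IsConnectedDynkin (M.submatrix f f) := by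
  obtain ⟨X, g, rfl⟩ := h
  exact ⟨X, f.trans g, rfl⟩

lemma B (n : ℕ) (hn : 2 ≤ n) : IsConnectedDynkin (coxeterAdj (CartanMatrix.B n)ᵀ) :=
  adj (.B n hn)

lemma C (n : ℕ) (hn : 2 ≤ n) : IsConnectedDynkin (coxeterAdj (CartanMatrix.C n)ᵀ) := by
  rcases hn.eq_or_lt with rfl | hn
  · rw [show coxeterAdj (CartanMatrix.C 2)ᵀ =
      (coxeterAdj (CartanMatrix.B 2)ᵀ).submatrix Fin.revPerm Fin.revPerm by decide]
    exact (B 2 le_rfl).submatrix Fin.revPerm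
  · exact adj (.C n hn)

lemma D (n : ℕ) (hn : 3 ≤ n) : IsConnectedDynkin (coxeterAdj (CartanMatrix.D n)) := by
  rcases hn.eq_or_lt with rfl | hn
  · rw [show coxeterAdj (CartanMatrix.D 3) =
      (coxeterAdj (CartanMatrix.A 3)).submatrix (Equiv.swap 0 1) (Equiv.swap 0 1) by decide]
    have h : IsConnectedDynkin (coxeterAdj (CartanMatrix.A 3)) := adj (.A 3 (by norm_num))
    exact h.submatrix (Equiv.swap 0 1)
  · exact adj (.D n hn)

end IsConnectedDynkin

lemma coxeterAdj_F₄_transpose : (coxeterAdj CartanMatrix.F₄)ᵀ =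
    (coxeterAdj CartanMatrix.F₄).submatrix Fin.revPerm Fin.revPerm := by decide

lemma coxeterAdj_G₂_transpose : (coxeterAdj CartanMatrix.G₂)ᵀ =
    (coxeterAdj CartanMatrix.G₂).submatrix Fin.revPerm Fin.revPerm := by decide

/-- The transpose of a Coxeter adjacency matrix is one as well, and it is simply laced if and only
if the original one is. -/
lemma DynkinType.exists_transpose (X : DynkinType) : ∃ (Y : DynkinType)
    (f : Fin X.rank ≃ Fin Y.rank), X.adjᵀ = Y.adj.submatrix f f ∧ (Y.IsADE ↔ X.IsADE) := by
  cases X with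
  | A n hn =>
    refine ⟨.A n hn, Equiv.refl _, ?_, Iff.rfl⟩
    ext i j
    exact (coxeterAdj_A (n := n) j i).trans
      ((by simp only [or_comm]) : _ = _) |>.trans (coxeterAdj_A (n := n) i j).symm
  | B n hn =>
    rcases hn.eq_or_lt with rfl | hn'
    · refine ⟨.B 2 le_rfl, Fin.revPerm, ?_, Iff.rfl⟩
      change (coxeterAdj (CartanMatrix.B 2)ᵀ)ᵀ =
        (coxeterAdj (CartanMatrix.B 2)ᵀ).submatrix Fin.revPerm Fin.revPerm
      decide
    · exact ⟨.C n hn', Equiv.refl _, (Biagram.coxeterAdj_C_eq_transpose n).symm, Iff.rfl⟩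
  | C n hn =>
    refine ⟨.B n (by omega), Equiv.refl _, ?_, Iff.rfl⟩
    exact congrArg transpose (Biagram.coxeterAdj_C_eq_transpose n)
  | D n hn =>
    exact ⟨.D n hn, Equiv.refl _, Biagram.coxeterAdj_D_transpose n (by omega), Iff.rfl⟩
  | E₆ =>
    exact ⟨.E₆, Equiv.refl _,
      show (coxeterAdj CartanMatrix.E₆)ᵀ = coxeterAdj CartanMatrix.E₆ by decide, Iff.rfl⟩
  | E₇ =>
    exact ⟨.E₇, Equiv.refl _,
      show (coxeterAdj CartanMatrix.E₇)ᵀ = coxeterAdj CartanMatrix.E₇ by decide, Iff.rfl⟩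
  | E₈ =>
    exact ⟨.E₈, Equiv.refl _,
      show (coxeterAdj CartanMatrix.E₈)ᵀ = coxeterAdj CartanMatrix.E₈ by decide, Iff.rfl⟩
  | F₄ => exact ⟨.F₄, Fin.revPerm, coxeterAdj_F₄_transpose, Iff.rfl⟩
  | G₂ => exact ⟨.G₂, Fin.revPerm, coxeterAdj_G₂_transpose, Iff.rfl⟩

lemma DynkinType.exists_two_le {X : DynkinType} (hX : ¬ X.IsADE) : ∃ i j, 2 ≤ X.adj i j := by
  cases X with
  | A n hn => exact absurd trivial hX
  | B n hn =>
    refine ⟨⟨n - 1, by change n - 1 < n; omega⟩, ⟨n - 2, by change n - 2 < n; omega⟩, ?_⟩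
    exact ((coxeterAdj_B (n := n) ⟨n - 1, by omega⟩ ⟨n - 2, by omega⟩).trans (by
      simp only; rw [if_neg (by omega), if_pos (by omega), if_pos (by omega)])).ge
  | C n hn =>
    refine ⟨⟨n - 2, by change n - 2 < n; omega⟩, ⟨n - 1, by change n - 1 < n; omega⟩, ?_⟩
    exact ((coxeterAdj_C (n := n) ⟨n - 2, by omega⟩ ⟨n - 1, by omega⟩).trans (by
      simp only; rw [if_neg (by omega), if_pos (by omega), if_pos (by omega)])).ge
  | D n hn => exact absurd trivial hX
  | E₆ => exact absurd trivial hX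
  | E₇ => exact absurd trivial hX
  | E₈ => exact absurd trivial hX
  | F₄ => exact ⟨(1 : Fin 4), (2 : Fin 4), show 2 ≤ coxeterAdj CartanMatrix.F₄ 1 2 by decide⟩
  | G₂ => exact ⟨(0 : Fin 2), (1 : Fin 2), show 2 ≤ coxeterAdj CartanMatrix.G₂ 0 1 by decide⟩

namespace Biagram

variable {U V W : Type*}

lemma isBinding_ofBlocks {X : Matrix U U ℤ} {Y : Matrix W W ℤ} (hX : IsConnectedDynkin X)
    (hY : IsConnectedDynkin Y) (A : Matrix U W ℤ) (B : Matrix W U ℤ) :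
    (ofBlocks X Y A B).IsBinding := by
  obtain ⟨X, f, rfl⟩ := hX
  obtain ⟨Y, g, rfl⟩ := hY
  refine ⟨X, Y, Equiv.sumCongr f g, ?_, ?_⟩
  · ext (i | i) (j | j) <;> rfl
  · rintro (i | i) (j | j) h <;> first | exact absurd rfl h | simp

lemma Iso.isBinding {P : Biagram V} {Q : Biagram W} (h : P.Iso Q) (hQ : Q.IsBinding) :
    P.IsBinding := by
  obtain ⟨e, h1, h2⟩ := h
  obtain ⟨X, Y, f, h3, h4⟩ := hQ
  refine ⟨X, Y, e.trans f, by rw [h1, h3]; rfl, fun i j hij => h4 (e i) (e j) ?_⟩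
  rwa [h2] at hij

lemma isDoubleBinding_of_dual {P : Biagram V} (h : P.IsBinding) (hd : P.dual.Iso P) :
    P.IsDoubleBinding := ⟨h, hd.isBinding h⟩

lemma Iso.isDoubleBinding {P : Biagram V} {Q : Biagram W} (h : P.Iso Q)
    (hQ : Q.IsDoubleBinding) : P.IsDoubleBinding := ⟨h.isBinding hQ.1, h.dual.isBinding hQ.2⟩

lemma le_one_of_isUnionOfDynkin {M : Matrix V V ℤ} (h : IsUnionOfDynkin {X | X.IsADE} M)
    (i j : V) : M i j ≤ 1 := by
  obtain ⟨k, t, e, ht, rfl⟩ := h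
  rw [submatrix_apply]
  generalize e i = a
  generalize e j = b
  obtain ⟨a, a'⟩ := a
  obtain ⟨b, b'⟩ := b
  by_cases hab : a = b
  · subst hab
    rw [blockDiagonal'_apply_eq]
    exact DynkinType.adj_le_one (ht a) _ _
  · rw [blockDiagonal'_apply_ne _ _ _ hab]
    norm_num

lemma isUnionOfDynkin_of_blocks {S : Set DynkinType} {X Y : DynkinType} (hX : X ∈ S) (hY : Y ∈ S)
    (e : V ≃ Fin X.rank ⊕ Fin Y.rank) :
    IsUnionOfDynkin S ((fromBlocks X.adj 0 0 Y.adj).submatrix e e) := by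
  let g : Fin X.rank ⊕ Fin Y.rank ≃ Σ i : Fin 2, Fin ((![X, Y] : Fin 2 → DynkinType) i).rank :=
    { toFun := Sum.elim (fun i => ⟨0, i⟩) (fun i => ⟨1, i⟩)
      invFun := fun x => match x with
        | ⟨0, i⟩ => Sum.inl i
        | ⟨1, i⟩ => Sum.inr i
      left_inv := by rintro (i | i) <;> rfl
      right_inv := by
        rintro ⟨i, x⟩
        match i, x with
        | 0, x => rfl
        | 1, x => rfl }
  refine ⟨2, ![X, Y], e.trans g, ?_, ?_⟩
  · intro i
    fin_cases i
    · exact hX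
    · exact hY
  · ext i j
    simp only [submatrix_apply, Equiv.coe_trans, Function.comp_apply]
    rcases e i with a | a <;> rcases e j with b | b
    · exact (blockDiagonal'_apply_eq (fun i => ((![X, Y] : Fin 2 → DynkinType) i).adj) 0 a b).symm
    · exact (blockDiagonal'_apply_ne (fun i => ((![X, Y] : Fin 2 → DynkinType) i).adj)
        (k := 0) (k' := 1) a b (show (0 : Fin 2) ≠ 1 by decide)).symm
    · exact (blockDiagonal'_apply_ne (fun i => ((![X, Y] : Fin 2 → DynkinType) i).adj)
        (k := 1) (k' := 0) a b (show (1 : Fin 2) ≠ 0 by decide)).symm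
    · exact (blockDiagonal'_apply_eq (fun i => ((![X, Y] : Fin 2 → DynkinType) i).adj) 1 a b).symm

/-- A double binding is a Dynkin biagram: its vertices are coloured by the parity of the indices
of the red and of the blue component. -/
lemma IsDoubleBinding.isDynkin {P : Biagram V} (h : P.IsDoubleBinding) : P.IsDynkin := by
  obtain ⟨⟨X, Y, e, h1, h2⟩, ⟨X', Y', e', h1', h2'⟩⟩ := h
  change P.blue = _ at h1'
  change ∀ i j, P.red i j ≠ 0 → _ at h2'
  have key : ∀ {X Y : DynkinType} (x y : Fin X.rank ⊕ Fin Y.rank),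
      fromBlocks X.adj 0 0 Y.adj x y ≠ 0 → x.isLeft = y.isLeft := by
    rintro X Y (x | x) (y | y) h <;> first | rfl | exact absurd rfl h
  have hr : ∀ i j, P.red i j ≠ 0 → (e i).isLeft = (e j).isLeft := by
    intro i j hij
    rw [h1] at hij
    exact key _ _ hij
  have hb : ∀ i j, P.blue i j ≠ 0 → (e' i).isLeft = (e' j).isLeft := by
    intro i j hij
    rw [h1'] at hij
    exact key _ _ hij
  refine ⟨?_, ?_, ⟨fun i => xor (e i).isLeft (e' i).isLeft, ?_⟩, ?_⟩
  · rw [h1]; exact isUnionOfDynkin_of_blocks (Set.mem_univ _) (Set.mem_univ _) e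
  · rw [h1']; exact isUnionOfDynkin_of_blocks (Set.mem_univ _) (Set.mem_univ _) e'
  · intro i j hij
    have : P.red i j ≠ 0 ∨ P.blue i j ≠ 0 := by
      by_contra! hc
      exact hij (by simp [hc.1, hc.2])
    rcases this with h | h
    · have a := hr i j h
      have b := h2' i j h
      simp only [a]
      intro hc
      exact b (by simpa using hc)
    · have a := hb i j h
      have b := h2 i j h
      simp only [a]
      intro hc
      exact b (by simpa using hc)
  · intro i j
    by_contra! hc
    exact h2 i j hc.2 (hr i j hc.1)

/-- Admissible non-ADE double bindings, where non-ADE is expressed by the presence of an entry of at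
least `2`. -/
structure IsGood [Fintype V] [DecidableEq V] (P : Biagram V) : Prop where
  double : P.IsDoubleBinding
  admissible : P.IsAdmissible
  nonADE : ∃ i j, 2 ≤ P.red i j ∨ 2 ≤ P.blue i j

variable [Fintype V] [DecidableEq V]

lemma IsGood.iso [Fintype W] [DecidableEq W] {P : Biagram V} {Q : Biagram W} (hQ : Q.IsGood)
    (h : P.Iso Q) : P.IsGood := by
  refine ⟨h.isDoubleBinding hQ.double, h.isAdmissible hQ.admissible, ?_⟩
  obtain ⟨e, h1, h2⟩ := h
  obtain ⟨i, j, hij⟩ := hQ.nonADE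
  exact ⟨e.symm i, e.symm j, by simpa [h1, h2] using hij⟩

lemma IsGood.not_isADE {P : Biagram V} (h : P.IsGood) : ¬ P.IsADE := by
  rintro ⟨h1, h2⟩
  obtain ⟨i, j, hij⟩ := h.nonADE
  have := le_one_of_isUnionOfDynkin h1 i j
  have := le_one_of_isUnionOfDynkin h2 i j
  omega

/-- The components are connected Dynkin diagrams by the definition of a double binding, and such a
diagram is ADE if and only if its entries are at most `1`. -/
lemma isGood_iff {P : Biagram V} :
    P.IsGood ↔ P.IsDynkin ∧ P.IsDoubleBinding ∧ P.IsAdmissible ∧ ¬ P.IsADE := by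
  refine ⟨fun h => ⟨h.double.isDynkin, h.double, h.admissible, h.not_isADE⟩,
    fun ⟨_, h1, h2, h3⟩ => ⟨h1, h2, ?_⟩⟩
  by_contra! hc
  apply h3
  obtain ⟨⟨X, Y, e, h1, h2⟩, ⟨X', Y', e', h1', h2'⟩⟩ := h1
  change P.blue = _ at h1'
  have key : ∀ (M : Matrix V V ℤ), (∀ i j, M i j < 2) → ∀ {X Y : DynkinType}
      (e : V ≃ Fin X.rank ⊕ Fin Y.rank), M = (fromBlocks X.adj 0 0 Y.adj).submatrix e e →
      IsUnionOfDynkin {X | X.IsADE} M := by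
    rintro M hM X Y e rfl
    refine isUnionOfDynkin_of_blocks ?_ ?_ e
    · by_contra hX
      obtain ⟨i, j, hij⟩ := DynkinType.exists_two_le hX
      have := hM (e.symm (Sum.inl i)) (e.symm (Sum.inl j))
      simp at this
      omega
    · by_contra hX
      obtain ⟨i, j, hij⟩ := DynkinType.exists_two_le hX
      have := hM (e.symm (Sum.inr i)) (e.symm (Sum.inr j))
      simp at this
      omega
  exact ⟨key P.red (fun i j => (hc i j).1) e h1, key P.blue (fun i j => (hc i j).2) e' h1'⟩

lemma isGood_ofBlocks [Fintype U] [DecidableEq U] [Fintype W] [DecidableEq W]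
    {X : Matrix U U ℤ} {Y : Matrix W W ℤ} {A : Matrix U W ℤ} {B : Matrix W U ℤ}
    (hX : IsConnectedDynkin X) (hY : IsConnectedDynkin Y) (h : Intertwine X Y A B)
    (hd : (ofBlocks X Y A B).dual.Iso (ofBlocks X Y A B)) (h2 : ∃ i j, 2 ≤ X i j) :
    (ofBlocks X Y A B).IsGood := by
  obtain ⟨i, j, hij⟩ := h2
  exact ⟨isDoubleBinding_of_dual (isBinding_ofBlocks hX hY A B) hd, intertwine_iff.2 h,
    Sum.inl i, Sum.inl j, Or.inl hij⟩

end Biagram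

/-! ### The list and its closure under duality and flip -/

/-- The connected Dynkin diagrams with two vertices. -/
def DynkinType.rankTwo : Set DynkinType := {.A 2 one_le_two, .B 2 le_rfl, .G₂}

namespace Biagram

variable {U V W U' W' : Type*}

section Tensor

variable {M N : Matrix (Fin 2) (Fin 2) ℤ}

lemma tensor_iso_ofBlocks [DecidableEq U] (X : Matrix U U ℤ) (h0 : N 0 0 = 0) (h1 : N 1 1 = 0) :
    (tensor X N).Iso (ofBlocks X X (diagonal fun _ => N 0 1) (diagonal fun _ => N 1 0)) := by
  refine ⟨((Equiv.prodComm U (Fin 2)).trans (Equiv.prodCongr finTwoEquiv (Equiv.refl U))).trans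
    (Equiv.boolProdEquivSum U), ?_, ?_⟩ <;>
  · ext ⟨i, a⟩ ⟨j, b⟩
    fin_cases a <;> fin_cases b <;>
      simp [tensor, ofBlocks, Matrix.one_apply, Equiv.boolProdEquivSum, finTwoEquiv, h0, h1,
        mul_comm, diagonal_apply]

lemma tensor_dual [DecidableEq U] [DecidableEq W] (X : Matrix U U ℤ) (Y : Matrix W W ℤ) :
    (tensor X Y).dual.Iso (tensor Y X) := by
  refine ⟨Equiv.prodComm U W, ?_, ?_⟩ <;> ext ⟨i, a⟩ ⟨j, b⟩ <;>
    simp [tensor, Biagram.dual, mul_comm]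

lemma tensor_flip_iso [DecidableEq U] [DecidableEq W] {X : Matrix U U ℤ} {Y : Matrix W W ℤ}
    (f : U ≃ U) (g : W ≃ W) (hX : Xᵀ = X.submatrix f f) (hY : Yᵀ = Y.submatrix g g) :
    (tensor X Y).flip.Iso (tensor X Y) := by
  have hX' : ∀ i j, X j i = X (f i) (f j) := fun i j => congrFun (congrFun hX i) j
  have hY' : ∀ i j, Y j i = Y (g i) (g j) := fun i j => congrFun (congrFun hY i) j
  refine ⟨Equiv.prodCongr f g, ?_, ?_⟩ <;> ext ⟨i, a⟩ ⟨j, b⟩ <;>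
    simp only [tensor, Biagram.flip, transpose_apply, kroneckerMap_apply, submatrix_apply,
      Equiv.prodCongr_apply, Prod.map_apply, Matrix.one_apply, ← hX', ← hY', f.injective.eq_iff,
      g.injective.eq_iff, eq_comm]

lemma isGood_tensor (hM : IsConnectedDynkin M) (hN : IsConnectedDynkin N) (hM0 : ∀ i, M i i = 0)
    (hN0 : ∀ i, N i i = 0) (h : (∃ i j, 2 ≤ M i j) ∨ ∃ i j, 2 ≤ N i j) : (tensor M N).IsGood := by
  refine ⟨⟨(tensor_iso_ofBlocks M (hN0 0) (hN0 1)).isBinding (isBinding_ofBlocks hM hM _ _),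
    ((tensor_dual M N).trans (tensor_iso_ofBlocks N (hM0 0) (hM0 1))).isBinding
      (isBinding_ofBlocks hN hN _ _)⟩, ?_, ?_⟩
  · rw [isAdmissible_iff]
    simp only [tensor, ← mul_kronecker_mul, Matrix.one_mul, Matrix.mul_one]
  · rcases h with ⟨i, j, h⟩ | ⟨i, j, h⟩
    · exact ⟨(i, 0), (j, 0), Or.inl (by simpa [tensor] using h)⟩
    · exact ⟨(0, i), (0, j), Or.inr (by simpa [tensor] using h)⟩

end Tensor

lemma twist_relabel (M : Matrix U U ℤ) (f : W ≃ U) :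
    (twist (M.submatrix f f)).Iso (twist M) :=
  ofBlocks_relabel M M M M f f

lemma twist_flip (M : Matrix U U ℤ) : (twist M).flip = twist Mᵀ := ofBlocks_flip M M M M

lemma twist_dual_nonADE {X : DynkinType} (hX : ¬ X.IsADE) :
    (twist X.adj).dual.Iso (twist X.adj) := by
  cases X with
  | A n hn => exact absurd trivial hX
  | B n hn => exact twist_dual_B n
  | C n hn =>
    have h := (twist_dual_B n).flip
    change (twist _).flip.dual.Iso (twist _).flip at h
    rw [twist_flip, ← coxeterAdj_C_eq_transpose] at h
    exact h
  | D n hn => exact absurd trivial hX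
  | E₆ => exact absurd trivial hX
  | E₇ => exact absurd trivial hX
  | E₈ => exact absurd trivial hX
  | F₄ => exact twist_dual_F₄
  | G₂ => exact twist_dual_G₂

/-- The biagrams of the classification. The parallel bindings appear as the tensor products of two
diagrams with two vertices which are not both of type `A₂`. -/
inductive IsListed (P : Biagram V) : Prop
  | tensor (X Y : DynkinType) (hX : X ∈ DynkinType.rankTwo) (hY : Y ∈ DynkinType.rankTwo)
      (h : ¬ (X.IsADE ∧ Y.IsADE)) (e : P.Iso (tensor X.adj Y.adj))
  | twist (X : DynkinType) (hX : ¬ X.IsADE) (e : P.Iso (twist X.adj))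
  | bLtimesD (n : ℕ) (hn : 2 ≤ n) (e : P.Iso (bLtimesD n hn))
  | cLtimesD (n : ℕ) (hn : 2 ≤ n) (e : P.Iso (cLtimesD n hn))
  | bBowtieC (n : ℕ) (hn : 3 ≤ n) (e : P.Iso (bBowtieC n hn))
  | gLtimesD₁ (e : P.Iso gLtimesD₁)
  | gLtimesD₂ (e : P.Iso gLtimesD₂)
  | bBowtieG₁ (e : P.Iso bBowtieG₁)
  | bBowtieG₂ (e : P.Iso bBowtieG₂)
  | cBowtieG₁ (e : P.Iso cBowtieG₁)
  | cBowtieG₂ (e : P.Iso cBowtieG₂)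
  | bBoxC (e : P.Iso bBoxC)

lemma IsListed.iso {P : Biagram V} {Q : Biagram W} (hQ : Q.IsListed) (h : P.Iso Q) :
    P.IsListed := by
  cases hQ with
  | tensor X Y hX hY hXY e => exact .tensor X Y hX hY hXY (h.trans e)
  | twist X hX e => exact .twist X hX (h.trans e)
  | bLtimesD n hn e => exact .bLtimesD n hn (h.trans e)
  | cLtimesD n hn e => exact .cLtimesD n hn (h.trans e)
  | bBowtieC n hn e => exact .bBowtieC n hn (h.trans e)
  | gLtimesD₁ e => exact .gLtimesD₁ (h.trans e)
  | gLtimesD₂ e => exact .gLtimesD₂ (h.trans e)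
  | bBowtieG₁ e => exact .bBowtieG₁ (h.trans e)
  | bBowtieG₂ e => exact .bBowtieG₂ (h.trans e)
  | cBowtieG₁ e => exact .cBowtieG₁ (h.trans e)
  | cBowtieG₂ e => exact .cBowtieG₂ (h.trans e)
  | bBoxC e => exact .bBoxC (h.trans e)

lemma cBowtieG₁_dual : cBowtieG₁.dual.Iso cBowtieG₁ :=
  bBowtieG₂_flip.symm.dual.trans (bBowtieG₂_dual.flip.iso.trans bBowtieG₂_flip)

lemma IsListed.of_dual {P : Biagram V} (hP : P.dual.IsListed) : P.IsListed := by
  cases hP with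
  | tensor X Y hX hY hXY e =>
    exact .tensor Y X hY hX (fun h => hXY h.symm) (e.dual.trans (tensor_dual _ _))
  | twist X hX e => exact .twist X hX (e.dual.trans (twist_dual_nonADE hX))
  | bLtimesD n hn e => exact .bLtimesD n hn (e.dual.trans (bLtimesD_dual n hn).iso)
  | cLtimesD n hn e => exact .cLtimesD n hn (e.dual.trans (cLtimesD_dual n hn))
  | bBowtieC n hn e => exact .bBowtieC n hn (e.dual.trans (bBowtieC_dual n hn))
  | gLtimesD₁ e => exact .gLtimesD₁ (e.dual.trans gLtimesD₁_dual.iso)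
  | gLtimesD₂ e => exact .gLtimesD₂ (e.dual.trans gLtimesD₁_dual.flip.iso)
  | bBowtieG₁ e => exact .bBowtieG₁ (e.dual.trans bBowtieG₁_dual.iso)
  | bBowtieG₂ e => exact .bBowtieG₂ (e.dual.trans bBowtieG₂_dual.iso)
  | cBowtieG₁ e => exact .cBowtieG₁ (e.dual.trans cBowtieG₁_dual)
  | cBowtieG₂ e => exact .cBowtieG₂ (e.dual.trans bBowtieG₁_dual.flip.iso)
  | bBoxC e => exact .bBoxC (e.dual.trans bBoxC_dual.iso)

lemma exists_transpose_of_rankTwo {X : DynkinType} (hX : X ∈ DynkinType.rankTwo) :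
    ∃ f : Fin X.rank ≃ Fin X.rank, X.adjᵀ = X.adj.submatrix f f := by
  rcases hX with rfl | rfl | rfl
  · refine ⟨Equiv.refl _, ?_⟩
    change (coxeterAdj (CartanMatrix.A 2))ᵀ = coxeterAdj (CartanMatrix.A 2)
    decide
  · refine ⟨Fin.revPerm, ?_⟩
    change (coxeterAdj (CartanMatrix.B 2)ᵀ)ᵀ =
      (coxeterAdj (CartanMatrix.B 2)ᵀ).submatrix Fin.revPerm Fin.revPerm
    decide
  · exact ⟨Fin.revPerm, coxeterAdj_G₂_transpose⟩

lemma IsListed.of_flip {P : Biagram V} (hP : P.flip.IsListed) : P.IsListed := by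
  cases hP with
  | tensor X Y hX hY hXY e =>
    obtain ⟨f, hf⟩ := exists_transpose_of_rankTwo hX
    obtain ⟨g, hg⟩ := exists_transpose_of_rankTwo hY
    exact .tensor X Y hX hY hXY (e.flip.trans (tensor_flip_iso f g hf hg))
  | twist X hX e =>
    obtain ⟨Y, f, h1, h2⟩ := X.exists_transpose
    have := e.flip
    rw [twist_flip, h1] at this
    exact .twist Y (h2.not.2 hX) (this.trans (twist_relabel _ f))
  | bLtimesD n hn e => exact .cLtimesD n hn e.flip
  | cLtimesD n hn e => exact .bLtimesD n hn e.flip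
  | bBowtieC n hn e => exact .bBowtieC n hn (e.flip.trans (bBowtieC_flip n hn))
  | gLtimesD₁ e => exact .gLtimesD₂ e.flip
  | gLtimesD₂ e => exact .gLtimesD₁ e.flip
  | bBowtieG₁ e => exact .cBowtieG₂ e.flip
  | bBowtieG₂ e => exact .cBowtieG₁ (e.flip.trans bBowtieG₂_flip)
  | cBowtieG₁ e => exact .bBowtieG₂ (e.flip.trans bBowtieG₂_flip.flip.symm)
  | cBowtieG₂ e => exact .bBowtieG₁ e.flip
  | bBoxC e => exact .bBoxC (e.flip.trans bBoxC_flip)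

/-- `X` is the type of one of the two red components of the binding `P`. -/
def IsRedComponent (P : Biagram V) (X : DynkinType) : Prop :=
  ∃ (Y : DynkinType) (e : V ≃ Fin X.rank ⊕ Fin Y.rank),
    P.red = (fromBlocks X.adj 0 0 Y.adj).submatrix e e ∧
    ∀ i j, P.blue i j ≠ 0 → (e i).isLeft ≠ (e j).isLeft

lemma IsRedComponent.flip {P : Biagram V} {X X' : DynkinType} (h : P.IsRedComponent X)
    (f : Fin X.rank ≃ Fin X'.rank) (hf : X.adjᵀ = X'.adj.submatrix f f) :
    P.flip.IsRedComponent X' := by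
  obtain ⟨Y, e, h1, h2⟩ := h
  obtain ⟨Y', g, hg, -⟩ := Y.exists_transpose
  refine ⟨Y', e.trans (Equiv.sumCongr f g), ?_, fun i j hij => ?_⟩
  · change P.redᵀ = _
    rw [h1, transpose_submatrix, fromBlocks_transpose, hf, hg]
    ext i j
    simp only [submatrix_apply, Equiv.coe_trans, Function.comp_apply]
    rcases e i with a | a <;> rcases e j with b | b <;> rfl
  · have := h2 j i hij
    simp only [Equiv.coe_trans, Function.comp_apply]
    revert this
    rcases e i with a | a <;> rcases e j with b | b <;> simp

lemma IsBinding.flip {P : Biagram V} (h : P.IsBinding) : P.flip.IsBinding := by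
  obtain ⟨X, h⟩ := h
  obtain ⟨X', f, hf, -⟩ := X.exists_transpose
  exact ⟨X', IsRedComponent.flip h f hf⟩

lemma IsGood.flip [Fintype V] [DecidableEq V] {P : Biagram V} (h : P.IsGood) : P.flip.IsGood := by
  refine ⟨⟨h.double.1.flip, h.double.2.flip⟩, ?_, ?_⟩
  · have := h.admissible
    rw [isAdmissible_iff] at this ⊢
    simp only [Biagram.flip, ← transpose_mul, this]
  · obtain ⟨i, j, hij⟩ := h.nonADE
    exact ⟨j, i, hij⟩

lemma IsGood.dual [Fintype V] [DecidableEq V] {P : Biagram V} (h : P.IsGood) : P.dual.IsGood := by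
  refine ⟨⟨h.double.2, h.double.1⟩, ?_, ?_⟩
  · have := h.admissible
    rw [isAdmissible_iff] at this ⊢
    exact this.symm
  · obtain ⟨i, j, hij⟩ := h.nonADE
    exact ⟨i, j, hij.symm⟩

lemma exists_two_le_B (n : ℕ) (hn : 2 ≤ n) : ∃ i j, 2 ≤ coxeterAdj (CartanMatrix.B n)ᵀ i j :=
  DynkinType.exists_two_le (X := .B n hn) id

lemma isGood_bLtimesD (n : ℕ) (hn : 2 ≤ n) : (bLtimesD n hn).IsGood := by
  have h := (bLtimesD_dual n hn).iso
  rw [bLtimesD_eq] at h ⊢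
  exact isGood_ofBlocks (.B n hn) (.D (n + 1) (by omega)) (intertwine_bLtimesD n hn) h
    (exists_two_le_B n hn)

lemma isGood_bBowtieC (n : ℕ) (hn : 3 ≤ n) : (bBowtieC n hn).IsGood := by
  have h := bBowtieC_dual n hn
  rw [bBowtieC_eq] at h ⊢
  exact isGood_ofBlocks (.C n (by omega)) (.B n (by omega)) (intertwine_bBowtieC n hn) h
    (DynkinType.exists_two_le (X := .C n hn) id)

lemma isGood_gLtimesD₁ : gLtimesD₁.IsGood := by
  have h := gLtimesD₁_dual.iso
  rw [gLtimesD₁_eq] at h ⊢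
  exact isGood_ofBlocks (.adj .G₂) (.D 4 (by norm_num)) intertwine_gLtimesD₁ h
    (DynkinType.exists_two_le (X := .G₂) id)

lemma isGood_bBowtieG₁ : bBowtieG₁.IsGood := by
  have h := bBowtieG₁_dual.iso
  rw [bBowtieG₁_eq] at h ⊢
  exact isGood_ofBlocks (.adj .G₂) (.B 3 (by norm_num)) intertwine_bBowtieG₁ h
    (DynkinType.exists_two_le (X := .G₂) id)

lemma isGood_bBowtieG₂ : bBowtieG₂.IsGood := by
  have h := bBowtieG₂_dual.iso
  rw [bBowtieG₂_eq] at h ⊢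
  refine isGood_ofBlocks ?_ (.B 3 (by norm_num)) intertwine_bBowtieG₂ h ⟨1, 0, by decide⟩
  rw [coxeterAdj_G₂_transpose]
  exact (IsConnectedDynkin.adj .G₂).submatrix Fin.revPerm

lemma isGood_bBoxC : bBoxC.IsGood := by
  have h := bBoxC_dual.iso
  rw [bBoxC_eq] at h ⊢
  exact isGood_ofBlocks (.B 4 (by norm_num)) (.C 4 (by norm_num)) intertwine_bBoxC h
    (exists_two_le_B 4 (by norm_num))

lemma rankTwo_diag {X : DynkinType} (hX : X ∈ DynkinType.rankTwo) :
    ∃ M : Matrix (Fin 2) (Fin 2) ℤ, IsConnectedDynkin M ∧ (∀ i, M i i = 0) ∧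
      ∃ f : Fin X.rank ≃ Fin 2, X.adj = M.submatrix f f := by
  rcases hX with rfl | rfl | rfl
  · exact ⟨coxeterAdj (CartanMatrix.A 2), .adj (.A 2 one_le_two),
      show ∀ i, entry (coxeterAdj (CartanMatrix.A 2)) i i = 0 by decide, Equiv.refl _, rfl⟩
  · exact ⟨coxeterAdj (CartanMatrix.B 2)ᵀ, .adj (.B 2 le_rfl),
      show ∀ i, entry (coxeterAdj (CartanMatrix.B 2)ᵀ) i i = 0 by decide, Equiv.refl _, rfl⟩
  · exact ⟨coxeterAdj CartanMatrix.G₂, .adj .G₂,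
      show ∀ i, entry (coxeterAdj CartanMatrix.G₂) i i = 0 by decide, Equiv.refl _, rfl⟩

lemma tensor_relabel [DecidableEq U] [DecidableEq W] [DecidableEq U'] [DecidableEq W']
    (X : Matrix U U ℤ) (Y : Matrix W W ℤ) (f : U' ≃ U) (g : W' ≃ W) :
    (tensor (X.submatrix f f) (Y.submatrix g g)).Iso (tensor X Y) := by
  refine ⟨Equiv.prodCongr f g, ?_, ?_⟩ <;> ext ⟨i, a⟩ ⟨j, b⟩ <;>
    simp [tensor, Matrix.one_apply]

theorem IsListed.isGood [Fintype V] [DecidableEq V] {P : Biagram V} (hP : P.IsListed) :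
    P.IsGood := by
  cases hP with
  | tensor X Y hX hY hXY e =>
    obtain ⟨M, hM, hM0, f, hf⟩ := rankTwo_diag hX
    obtain ⟨N, hN, hN0, g, hg⟩ := rankTwo_diag hY
    have h2 : (∃ i j, 2 ≤ M i j) ∨ ∃ i j, 2 ≤ N i j := by
      rw [not_and_or] at hXY
      refine hXY.imp (fun h => ?_) fun h => ?_
      · obtain ⟨i, j, hij⟩ := DynkinType.exists_two_le h
        exact ⟨f i, f j, by rwa [hf] at hij⟩
      · obtain ⟨i, j, hij⟩ := DynkinType.exists_two_le h
        exact ⟨g i, g j, by rwa [hg] at hij⟩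
    rw [hf, hg] at e
    exact (isGood_tensor hM hN hM0 hN0 h2).iso (e.trans (tensor_relabel M N f g))
  | twist X hX e =>
    exact (isGood_ofBlocks (.adj X) (.adj X) ⟨rfl, rfl⟩ (twist_dual_nonADE hX)
      (DynkinType.exists_two_le hX)).iso e
  | bLtimesD n hn e => exact (isGood_bLtimesD n hn).iso e
  | cLtimesD n hn e => exact (isGood_bLtimesD n hn).flip.iso e
  | bBowtieC n hn e => exact (isGood_bBowtieC n hn).iso e
  | gLtimesD₁ e => exact isGood_gLtimesD₁.iso e
  | gLtimesD₂ e => exact isGood_gLtimesD₁.flip.iso e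
  | bBowtieG₁ e => exact isGood_bBowtieG₁.iso e
  | bBowtieG₂ e => exact isGood_bBowtieG₂.iso e
  | cBowtieG₁ e => exact isGood_bBowtieG₂.flip.iso (e.trans bBowtieG₂_flip.symm)
  | cBowtieG₂ e => exact isGood_bBowtieG₁.flip.iso e
  | bBoxC e => exact isGood_bBoxC.iso e

end Biagram

/-! ### Double bindings in block form -/

lemma IsConnectedFiniteType.hasComponents {U W : Type*} [Fintype U] [Fintype W]
    {X : Matrix U U ℤ} {Y : Matrix W W ℤ} (hX : IsConnectedFiniteType X)
    (hY : IsConnectedFiniteType Y) : HasComponents (fromBlocks X 0 0 Y) Sum.isLeft where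
  nonneg := by
    rintro (i | i) (j | j)
    exacts [hX.nonneg i j, le_rfl, le_rfl, hY.nonneg i j]
  symm := by
    rintro (i | i) (j | j)
    exacts [hX.symm i j, id, id, hY.symm i j]
  pres := by
    rintro (i | i) (j | j) h <;> first | rfl | exact absurd rfl h
  conn := by
    rintro S hS (i | i) hi (j | j) hij
    · exact hX.conn (Sum.inl ⁻¹' S) (fun a ha b hb => hS _ ha (Sum.inl b) hb) i hi j
    · simp at hij
    · simp at hij
    · exact hY.conn (Sum.inr ⁻¹' S) (fun a ha b hb => hS _ ha (Sum.inr b) hb) i hi j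
  bound := by
    intro p hp h4
    have e1 := hX.eq_zero_of_four_le (fun i => p (Sum.inl i)) (fun i => hp _) fun i => by
      simpa [Fintype.sum_sum_type] using h4 (Sum.inl i)
    have e2 := hY.eq_zero_of_four_le (fun i => p (Sum.inr i)) (fun i => hp _) fun i => by
      simpa [Fintype.sum_sum_type] using h4 (Sum.inr i)
    rintro (i | i)
    exacts [e1 i, e2 i]

lemma HasComponents.submatrix {U V : Type*} [Fintype U] [Fintype V] {M : Matrix V V ℤ}
    {χ : V → Bool} (h : HasComponents M χ) (e : U ≃ V) :
    HasComponents (M.submatrix e e) (χ ∘ e) where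
  nonneg i j := h.nonneg _ _
  symm i j := h.symm _ _
  pres i j := h.pres _ _
  conn S hS i hi j hij := by
    have := h.conn (e.symm ⁻¹' S) (fun a ha b hb => hS _ ha _ (by simpa using hb)) (e i)
      (by simpa using hi) (e j) hij
    simpa using this
  bound p hp h4 i := by
    have := h.bound (p ∘ e.symm) (fun i => hp _) (fun i => by
      have := h4 (e.symm i)
      simp only [submatrix_apply, Equiv.apply_symm_apply] at this
      rw [← Equiv.sum_comp e]
      refine this.trans_eq (Finset.sum_congr rfl fun j _ => ?_)
      rw [← Equiv.sum_comp e]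
      simp) (e i)
    simpa using this

/-- The block form of an admissible double binding: the diagonal blocks `X`, `Y` of the red
matrix are connected, the blue matrix has off-diagonal blocks `A`, `B`, which intertwine `X` and
`Y`, and `χ` distinguishes the two blue components. -/
structure DoubleBlocks {U W : Type*} [Fintype U] [Fintype W] (X : Matrix U U ℤ) (Y : Matrix W W ℤ)
    (A : Matrix U W ℤ) (B : Matrix W U ℤ) (χ : U ⊕ W → Bool) : Prop where
  conn : IsConnectedFiniteType Y
  components : HasComponents (fromBlocks 0 A B 0) χ
  color_left : ∀ i j, X i j ≠ 0 → χ (Sum.inl i) ≠ χ (Sum.inl j)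
  color_right : ∀ i j, Y i j ≠ 0 → χ (Sum.inr i) ≠ χ (Sum.inr j)
  intertwine : Biagram.Intertwine X Y A B

namespace DoubleBlocks

variable {U W : Type*} [Fintype U] [Fintype W] {X : Matrix U U ℤ} {Y : Matrix W W ℤ}
  {A : Matrix U W ℤ} {B : Matrix W U ℤ} {χ : U ⊕ W → Bool}

lemma diag_right (h : DoubleBlocks X Y A B χ) (w : W) : Y w w = 0 := by
  by_contra hc
  exact h.color_right w w hc rfl

lemma commute (h : DoubleBlocks X Y A B χ) : Commute X (A * B) := by
  rw [commute_iff_eq, ← Matrix.mul_assoc, h.intertwine.left, Matrix.mul_assoc,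
    h.intertwine.right, Matrix.mul_assoc]

lemma vecMul_left (h : DoubleBlocks X Y A B χ) (i : U) (w : W) :
    (A i ᵥ* Y) w = ∑ j, X i j * A j w := by
  rw [← mul_apply_eq_vecMul, ← h.intertwine.left, mul_apply]

lemma vecMul_right (h : DoubleBlocks X Y A B χ) (i : U) (w : W) :
    (Bᵀ i ᵥ* Yᵀ) w = ∑ j, X j i * Bᵀ j w := by
  rw [← mul_apply_eq_vecMul, ← transpose_mul, h.intertwine.right, transpose_apply, mul_apply]
  exact Finset.sum_congr rfl fun j _ => mul_comm _ _

end DoubleBlocks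

namespace Biagram

variable {U V W : Type*}

/-- The second red component is a red component too: exchange the two summands. -/
lemma IsRedComponent.other {P : Biagram V} {X Y : DynkinType}
    (e : V ≃ Fin X.rank ⊕ Fin Y.rank) (hr : P.red = (fromBlocks X.adj 0 0 Y.adj).submatrix e e)
    (hb : ∀ i j, P.blue i j ≠ 0 → (e i).isLeft ≠ (e j).isLeft) : P.IsRedComponent Y := by
  refine ⟨X, e.trans (Equiv.sumComm _ _), ?_, fun i j hij => ?_⟩
  · rw [hr]
    ext i j
    simp only [submatrix_apply, Equiv.coe_trans, Function.comp_apply]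
    rcases e i with a | a <;> rcases e j with b | b <;> rfl
  · have := hb i j hij
    simp only [Equiv.coe_trans, Function.comp_apply]
    revert this
    rcases e i with a | a <;> rcases e j with b | b <;> simp

/-- The block form of a double binding with respect to a chosen red component `X`. The blue matrix
is related to its components `X'` and `Y'` by `f`, and `χ` tells which of the two a vertex is in. -/
theorem IsGood.exists_blocks [Fintype V] [DecidableEq V] {P : Biagram V} (hP : P.IsGood)
    {X : DynkinType} (hX : P.IsRedComponent X) : ∃ (Y : DynkinType)
      (A : Matrix (Fin X.rank) (Fin Y.rank) ℤ) (B : Matrix (Fin Y.rank) (Fin X.rank) ℤ)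
      (χ : Fin X.rank ⊕ Fin Y.rank → Bool), P.Iso (ofBlocks X.adj Y.adj A B) ∧
        DoubleBlocks X.adj Y.adj A B χ ∧
        ∃ (X' Y' : DynkinType) (f : Fin X.rank ⊕ Fin Y.rank ≃ Fin X'.rank ⊕ Fin Y'.rank),
          P.dual.IsRedComponent X' ∧ P.dual.IsRedComponent Y' ∧
          fromBlocks 0 A B 0 = (fromBlocks X'.adj 0 0 Y'.adj).submatrix f f ∧
          ∀ v, χ v = (f v).isLeft := by
  obtain ⟨Y, e, hr, hb⟩ := hX
  obtain ⟨X', Y', e', hr', hb'⟩ := hP.double.2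
  let A : Matrix (Fin X.rank) (Fin Y.rank) ℤ :=
    of fun i j => P.blue (e.symm (Sum.inl i)) (e.symm (Sum.inr j))
  let B : Matrix (Fin Y.rank) (Fin X.rank) ℤ :=
    of fun i j => P.blue (e.symm (Sum.inr i)) (e.symm (Sum.inl j))
  have hblue : P.blue.submatrix e.symm e.symm = fromBlocks 0 A B 0 := by
    ext (i | i) (j | j)
    · by_contra hc
      exact hb _ _ hc (by simp)
    · rfl
    · rfl
    · by_contra hc
      exact hb _ _ hc (by simp)
  have hred : P.red.submatrix e.symm e.symm = fromBlocks X.adj 0 0 Y.adj := by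
    rw [hr]; simp
  have hiso : P.Iso (ofBlocks X.adj Y.adj A B) :=
    ⟨e, hr, by simp only [ofBlocks]; rw [← hblue]; simp⟩
  have hbl : fromBlocks 0 A B 0 =
      (fromBlocks X'.adj 0 0 Y'.adj).submatrix (e.symm.trans e') (e.symm.trans e') := by
    rw [← hblue]
    change P.blue = _ at hr'
    rw [hr']
    rfl
  have hcol : ∀ i j, fromBlocks X.adj 0 0 Y.adj i j ≠ 0 →
      (e' (e.symm i)).isLeft ≠ (e' (e.symm j)).isLeft := by
    intro i j hij
    rw [← hred] at hij
    exact hb' _ _ hij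
  refine ⟨Y, A, B, fun v => (e' (e.symm v)).isLeft, hiso,
    ⟨Y.isConnectedFiniteType_adj, ?_, fun i j hij => hcol (Sum.inl i) (Sum.inl j) hij,
      fun i j hij => hcol (Sum.inr i) (Sum.inr j) hij,
      intertwine_iff.1 (hiso.symm.isAdmissible hP.admissible)⟩,
    X', Y', e.symm.trans e', ⟨Y', e', hr', hb'⟩, IsRedComponent.other e' hr' hb', hbl,
    fun v => rfl⟩
  rw [hbl]
  exact (X'.isConnectedFiniteType_adj.hasComponents Y'.isConnectedFiniteType_adj).submatrix _

end Biagram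

/-! ### A red component of type `B` of rank at least three, or of type `F₄` -/

namespace DoubleBlocks

section Path

variable {m : ℕ} {W : Type*} [Fintype W] [DecidableEq W] {Y : Matrix W W ℤ}
  {A : Matrix (Fin (m + 2)) W ℤ} {B : Matrix W (Fin (m + 2)) ℤ} {χ : Fin (m + 2) ⊕ W → Bool}

/-- The rows of a matrix, extended by zero. -/
def rowOrZero {n : ℕ} (A : Matrix (Fin n) W ℤ) (k : ℕ) : W → ℤ := if h : k < n then A ⟨k, h⟩ else 0

lemma rowOrZero_val {n : ℕ} (A : Matrix (Fin n) W ℤ) (i : Fin n) : rowOrZero A i.val = A i := by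
  simp [rowOrZero]

lemma rowOrZero_of_lt {n : ℕ} (A : Matrix (Fin n) W ℤ) {k : ℕ} (h : k < n) :
    rowOrZero A k = A ⟨k, h⟩ := by
  simp [rowOrZero, h]

lemma rowOrZero_vecMul (h : DoubleBlocks (coxeterAdj (CartanMatrix.B (m + 2))ᵀ) Y A B χ) {k : ℕ}
    (hk : k < m + 2) : rowOrZero A k ᵥ* Y =
      (if 1 ≤ k then (if k = m + 1 then (2 : ℤ) else 1) • rowOrZero A (k - 1) else 0) +
        (if k < m + 1 then rowOrZero A (k + 1) else 0) := by
  ext w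
  rw [rowOrZero_of_lt _ hk, h.vecMul_left, sum_path (R := ℤ) _
    (fun l => (if k = l + 1 ∧ k = m + 1 then 2 else 1) * rowOrZero A l w) ⟨k, hk⟩ (fun j => by
      rw [coxeterAdj_B, rowOrZero_val]
      have := j.2
      simp only
      split_ifs <;> omega)]
  simp only [Pi.add_apply]
  congr 1
  · by_cases h1 : 1 ≤ k
    · rw [if_pos h1, if_pos h1]
      by_cases h2 : k = m + 1
      · rw [if_pos h2, if_pos (by omega)]; rfl
      · rw [if_neg h2, if_neg (by omega), one_mul, one_smul]
    · rw [if_neg h1, if_neg h1]; rfl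
  · by_cases h1 : k < m + 1
    · rw [if_pos h1, if_pos (by omega), if_neg (by omega), one_mul]
    · rw [if_neg h1, if_neg (by omega)]; rfl

lemma colOrZero_vecMul (h : DoubleBlocks (coxeterAdj (CartanMatrix.B (m + 2))ᵀ) Y A B χ) {k : ℕ}
    (hk : k < m + 2) : rowOrZero Bᵀ k ᵥ* Yᵀ =
      (if 1 ≤ k then rowOrZero Bᵀ (k - 1) else 0) +
        (if k < m + 1 then (if k = m then (2 : ℤ) else 1) • rowOrZero Bᵀ (k + 1) else 0) := by
  ext w
  rw [rowOrZero_of_lt _ hk, h.vecMul_right, sum_path (R := ℤ) _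
    (fun l => (if l = k + 1 ∧ k = m then 2 else 1) * rowOrZero Bᵀ l w) ⟨k, hk⟩ (fun j => by
      rw [coxeterAdj_B, rowOrZero_val]
      have := j.2
      simp only
      split_ifs <;> omega)]
  simp only [Pi.add_apply]
  congr 1
  · by_cases h1 : 1 ≤ k
    · rw [if_pos h1, if_pos h1, if_neg (by omega), one_mul]
    · rw [if_neg h1, if_neg h1]; rfl
  · by_cases h1 : k < m + 1
    · rw [if_pos h1, if_pos (show k + 1 < m + 2 by omega)]
      by_cases h2 : k = m
      · rw [if_pos h2, if_pos ⟨trivial, h2⟩]; rfl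
      · rw [if_neg h2, if_neg (by omega), one_mul, one_smul]
    · rw [if_neg h1, if_neg (by omega)]; rfl

/-- The inner products are the diagonal entries of the square of the matrix of `B_{m+2}`. -/
lemma rowOrZero_dot (h : DoubleBlocks (coxeterAdj (CartanMatrix.B (m + 2))ᵀ) Y A B χ)
    (hm : 1 ≤ m) {k : ℕ} (hk : k < m + 2) : rowOrZero A k ⬝ᵥ rowOrZero Bᵀ k =
      if k = 0 then 1 else if k = m then 3 else 2 := by
  have hsq := h.components.mul_eq_sq_B (by omega) h.commute h.color_left
  have h1 := congrFun (congrFun hsq ⟨k, hk⟩) ⟨k, hk⟩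
  rw [rowOrZero_of_lt _ hk, rowOrZero_of_lt _ hk]
  refine h1.trans ?_
  rw [mul_apply, sum_path (R := ℤ) _
    (fun l => if k = l + 1 ∧ k = m + 1 ∨ l = k + 1 ∧ k = m then 2 else 1) ⟨k, hk⟩ (fun j => by
      rw [coxeterAdj_B, coxeterAdj_B]
      have := j.2
      simp only
      split_ifs <;> omega)]
  simp only
  split_ifs <;> simp_all <;> omega

/-- The rows of `A` and the columns of `B`, with the last column doubled, form a representation
of the path. -/
theorem isPathRep (h : DoubleBlocks (coxeterAdj (CartanMatrix.B (m + 2))ᵀ) Y A B χ) (hm : 1 ≤ m) :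
    IsPathRep Y m (rowOrZero A)
      (fun k => (if k = m + 1 then (2 : ℤ) else 1) • rowOrZero Bᵀ k) where
  conn := h.conn
  diag := h.diag_right
  pair k hk := by
    have hp := h.components.pair ⟨k, by omega⟩
    rw [rowOrZero_of_lt _ (by omega), rowOrZero_of_lt _ (by omega)]
    refine ⟨hp.left, fun w => ?_, fun w => ?_⟩
    · have := hp.right w
      split_ifs <;> simp only [Pi.smul_apply, smul_eq_mul] <;> linarith
    · rw [hp.iff w]
      split_ifs <;> simp
  a_one := by rw [h.rowOrZero_vecMul (by omega)]; simp
  b_one := by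
    rw [if_neg (by omega), if_neg (by omega), one_smul, one_smul, h.colOrZero_vecMul (by omega)]
    simp
    omega
  a_rec k hk := by
    rw [h.rowOrZero_vecMul (by omega), if_pos (by omega), if_neg (by omega), if_pos (by omega)]
    simp
  b_rec k hk := by
    rw [if_neg (show k + 1 ≠ m + 1 by omega), if_neg (show k ≠ m + 1 by omega), one_smul, one_smul,
      h.colOrZero_vecMul (by omega), if_pos (show 1 ≤ k + 1 by omega),
      if_pos (show k + 1 < m + 1 by omega), Nat.add_sub_cancel, add_sub_cancel_left]
    congr 1
    exact if_congr (by omega) rfl rfl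
  a_last := by
    rw [h.rowOrZero_vecMul (by omega), if_pos (by omega), if_pos rfl, if_neg (by omega)]
    simp
  b_last := by
    rw [if_pos rfl, if_neg (by omega), one_smul, smul_vecMul, h.colOrZero_vecMul (by omega),
      if_pos (by omega), if_neg (by omega)]
    simp
  dot_zero := by
    rw [if_neg (by omega), one_smul, h.rowOrZero_dot hm (by omega), if_pos rfl]
  dot_mid k h1 h2 := by
    rw [if_neg (by omega), one_smul, h.rowOrZero_dot hm (by omega), if_neg (by omega),
      if_neg (by omega)]
  dot_branch := by
    rw [if_neg (by omega), one_smul, h.rowOrZero_dot hm (by omega), if_neg (by omega), if_pos rfl]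
  dot_last := by
    rw [if_pos rfl, dotProduct_smul, h.rowOrZero_dot hm (by omega), if_neg (by omega),
      if_neg (by omega)]
    rfl
  even w := by
    rw [if_pos rfl]
    exact ⟨_, rfl⟩

end Path

end DoubleBlocks

namespace Biagram

/-- Against a path-like matrix `X`, the blue blocks are determined by the first row of `A` and
the first column of `B`. -/
theorem iso_of_first_row {n : ℕ} {U W : Type*} [Fintype U] [Fintype W] [DecidableEq U]
    [DecidableEq W] {X : Matrix (Fin n) (Fin n) ℤ}
    (h1 : ∀ i j : Fin n, i.val + 1 = j.val → X i j ≠ 0 ∧ X j i ≠ 0)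
    (h2 : ∀ i j : Fin n, i.val + 1 < j.val → X i j = 0 ∧ X j i = 0) {Y : Matrix W W ℤ}
    {Z : Matrix U U ℤ} {A : Matrix (Fin n) W ℤ} {B : Matrix W (Fin n) ℤ}
    {A' : Matrix (Fin n) U ℤ} {B' : Matrix U (Fin n) ℤ} (h : Intertwine X Y A B)
    (h' : Intertwine X Z A' B') (φ : W ≃ U) (hφ : Y = Z.submatrix φ φ) (i0 : Fin n)
    (hi0 : i0.val = 0) {y : W} {u : U} (hu : φ y = u)
    (hA : A i0 = Pi.single y 1) (hB : Bᵀ i0 = Pi.single y 1)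
    (hA' : ∀ v, A' i0 v = if v = u then 1 else 0)
    (hB' : ∀ v, B' v i0 = if v = u then 1 else 0) :
    (ofBlocks X Y A B).Iso (ofBlocks X Z A' B') := by
  subst hu
  have eA : A - A'.submatrix id φ = 0 := by
    refine eq_zero_of_row_zero (X := X) (Y := Y) (fun i j hij => (h1 i j hij).1)
      (fun i j hij => (h2 i j hij).1) ?_ fun i hi => ?_
    · rw [Matrix.mul_sub, Matrix.sub_mul, h.left, hφ, submatrix_mul_equiv A' Z, ← h'.left]
      congr 1
    · obtain rfl : i = i0 := Fin.ext (hi.trans hi0.symm)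
      ext w
      change A i w - A' i (φ w) = 0
      rw [hA, hA']
      simp [Pi.single_apply]
  have eB : (B - B'.submatrix φ id)ᵀ = 0 := by
    refine eq_zero_of_row_zero (X := Xᵀ) (Y := Yᵀ) (fun i j hij => (h1 i j hij).2)
      (fun i j hij => (h2 i j hij).2) ?_ fun i hi => ?_
    · rw [← transpose_mul, ← transpose_mul, Matrix.mul_sub, Matrix.sub_mul, h.right, hφ,
        submatrix_mul_equiv Z B', h'.right]
      congr 2
    · obtain rfl : i = i0 := Fin.ext (hi.trans hi0.symm)
      ext w
      change Bᵀ i w - B' (φ w) i = 0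
      rw [hB, hB']
      simp [Pi.single_apply]
  have eB' : B = B'.submatrix φ id := by
    have := congrArg transpose eB
    rw [transpose_transpose, transpose_zero] at this
    exact sub_eq_zero.1 this
  rw [hφ, sub_eq_zero.1 eA, eB']
  exact ofBlocks_relabel X Z A' B' (Equiv.refl _) φ

section B

variable {n : ℕ}

lemma path_B (i j : Fin n) (h : i.val + 1 = j.val) : coxeterAdj (CartanMatrix.B n)ᵀ i j ≠ 0 ∧
    coxeterAdj (CartanMatrix.B n)ᵀ j i ≠ 0 := by
  rw [coxeterAdj_B, coxeterAdj_B]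
  grind

lemma path_B_zero (i j : Fin n) (h : i.val + 1 < j.val) : coxeterAdj (CartanMatrix.B n)ᵀ i j = 0 ∧
    coxeterAdj (CartanMatrix.B n)ᵀ j i = 0 := by
  rw [coxeterAdj_B, coxeterAdj_B]
  grind

end B

/-- A double binding with a red component of type `B_n`, `n ≥ 3`, is in the list. -/
theorem isListed_of_B {V W : Type*} [Fintype W] [DecidableEq W] {P : Biagram V} {m : ℕ}
    (hm : 1 ≤ m) {Y : Matrix W W ℤ} {A : Matrix (Fin (m + 2)) W ℤ} {B : Matrix W (Fin (m + 2)) ℤ}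
    {χ : Fin (m + 2) ⊕ W → Bool}
    (h : DoubleBlocks (coxeterAdj (CartanMatrix.B (m + 2))ᵀ) Y A B χ)
    (hP : P.Iso (ofBlocks (coxeterAdj (CartanMatrix.B (m + 2))ᵀ) Y A B)) : P.IsListed := by
  obtain ⟨y, ha, hb, ht⟩ := (h.isPathRep hm).classify hm
  simp only [if_neg (show 0 ≠ m + 1 by omega), one_smul] at hb
  rw [DoubleBlocks.rowOrZero_of_lt _ (by omega)] at ha hb
  rcases ht with ⟨φ, hφ, hy⟩ | ⟨φ, hφ, hy⟩ | ⟨φ, hφ, hy⟩ | ⟨rfl, φ, hφ, hy⟩ | ⟨rfl, φ, hφ⟩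
  · refine .bLtimesD (m + 2) (by omega) (hP.trans ?_)
    rw [bLtimesD_eq]
    refine iso_of_first_row path_B path_B_zero h.intertwine (intertwine_bLtimesD _ _) φ hφ
      ⟨0, by omega⟩ rfl rfl ha hb (fun v => ?_) fun v => ?_
    · rw [blockBD, fold_coxeterAdj_D_apply, coxeterAdj_D _ _ (by omega)]
      simp only [Fin.val_castSucc, Fin.ext_iff, hy]
      grind
    · rw [blockDB, mul_selectMatrix_apply, coxeterAdj_D _ _ (by omega)]
      simp only [Fin.val_castSucc, Fin.ext_iff, hy]
      grind
  · refine .twist (.B (m + 2) (by omega)) id (hP.trans ?_)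
    change Iso _ (ofBlocks (coxeterAdj (CartanMatrix.B (m + 2))ᵀ)
      (coxeterAdj (CartanMatrix.B (m + 2))ᵀ) (coxeterAdj (CartanMatrix.B (m + 2))ᵀ)
      (coxeterAdj (CartanMatrix.B (m + 2))ᵀ))
    refine iso_of_first_row path_B path_B_zero h.intertwine ⟨rfl, rfl⟩ φ hφ
      ⟨0, by omega⟩ rfl rfl ha hb (fun v => ?_) fun v => ?_
    · rw [coxeterAdj_B]
      simp only [Fin.ext_iff, hy]
      grind
    · rw [coxeterAdj_B]
      simp only [Fin.ext_iff, hy]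
      grind
  · refine .bBowtieC (m + 2) (by omega) (hP.trans ?_)
    rw [bBowtieC_eq]
    refine Iso.trans ?_ (ofBlocks_swap _ _ _ _)
    refine iso_of_first_row path_B path_B_zero h.intertwine
      (intertwine_bBowtieC (m + 2) (by omega)).swap φ hφ
      ⟨0, by omega⟩ rfl rfl ha hb (fun v => ?_) fun v => ?_
    · rw [foldMatrix_mul_apply, Finset.sum_filter, Finset.sum_eq_single ⟨0, by omega⟩]
      · rw [if_pos (Fin.ext (by simp [orbD])), transpose_apply, blockBD, fold_coxeterAdj_D_apply,
          coxeterAdj_D _ _ (by omega)]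
        simp only [Fin.val_castSucc, Fin.ext_iff, hy]
        grind
      · intro i _ hi
        rw [if_neg]
        intro hc
        apply hi
        simp only [orbD, Fin.ext_iff] at hc ⊢
        omega
      · simp
    · rw [mul_selectMatrix_apply, transpose_apply, blockDB, mul_selectMatrix_apply,
        coxeterAdj_D _ _ (by omega)]
      simp only [Fin.val_castSucc, Fin.ext_iff, hy]
      grind
  · refine .bBoxC (hP.trans ?_)
    rw [bBoxC_eq]
    exact iso_of_first_row path_B path_B_zero h.intertwine intertwine_bBoxC φ hφ
      0 rfl hy ha hb (by decide) (by decide)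
  · have hy : φ y = 1 ∨ Fin.revPerm (φ y) = 1 := by
      generalize φ y = z
      revert z
      decide
    rcases hy with hy | hy
    · refine .bBowtieG₁ (hP.trans ?_)
      rw [bBowtieG₁_eq]
      exact (iso_of_first_row path_B path_B_zero h.intertwine intertwine_bBowtieG₁.swap φ hφ
        0 rfl hy ha hb (by decide) (by decide)).trans (ofBlocks_swap _ _ _ _)
    · refine .bBowtieG₂ (hP.trans ?_)
      rw [bBowtieG₂_eq]
      refine (iso_of_first_row path_B path_B_zero h.intertwine intertwine_bBowtieG₂.swap
        (φ.trans Fin.revPerm) ?_ 0 rfl hy ha hb (by decide) (by decide)).trans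
          (ofBlocks_swap _ _ _ _)
      rw [hφ, coxeterAdj_G₂_transpose]
      ext i j
      simp

/-- A double binding with a red component of type `F₄` is in the list. -/
theorem isListed_of_F₄ {V W : Type*} [Fintype W] [DecidableEq W] {P : Biagram V}
    {Y : Matrix W W ℤ} {A : Matrix (Fin 4) W ℤ} {B : Matrix W (Fin 4) ℤ}
    {χ : Fin 4 ⊕ W → Bool} (h : DoubleBlocks (coxeterAdj CartanMatrix.F₄) Y A B χ)
    (hP : P.Iso (ofBlocks (coxeterAdj CartanMatrix.F₄) Y A B)) : P.IsListed := by
  have hM : coxeterAdj CartanMatrix.F₄ = !![0, 1, 0, 0; 1, 0, 2, 0; 0, 1, 0, 1; 0, 0, 1, 0] := by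
    decide
  have hsq := h.components.mul_eq_sq_F₄ h.commute h.color_left
  have hd : ∀ k, A k ⬝ᵥ Bᵀ k = (coxeterAdj CartanMatrix.F₄ * coxeterAdj CartanMatrix.F₄) k k :=
    fun k => congrFun (congrFun hsq k) k
  have hl := h.vecMul_left
  have hr := h.vecMul_right
  obtain ⟨y, ha, hb, φ, hφ, hy⟩ := exists_equiv_F₄ h.conn h.diag_right A Bᵀ h.components.pair
    (by ext w; rw [hl, hM]; simp [Fin.sum_univ_four])
    (by ext w; rw [hl, hM]; simp [Fin.sum_univ_four])
    (by ext w; rw [hl, hM]; simp [Fin.sum_univ_four])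
    (by ext w; rw [hr, hM]; simp [Fin.sum_univ_four])
    (by ext w; rw [hr, hM]; simp [Fin.sum_univ_four])
    (by ext w; rw [hr, hM]; simp [Fin.sum_univ_four])
    (by rw [hd]; decide) (by rw [hd]; decide) (by rw [hd]; decide) (by rw [hd]; decide)
  refine .twist .F₄ id (hP.trans ?_)
  change Iso _ (ofBlocks (coxeterAdj CartanMatrix.F₄) (coxeterAdj CartanMatrix.F₄)
    (coxeterAdj CartanMatrix.F₄) (coxeterAdj CartanMatrix.F₄))
  exact iso_of_first_row
    (show ∀ i j : Fin 4, i.val + 1 = j.val → entry (coxeterAdj CartanMatrix.F₄) i j ≠ 0 ∧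
      entry (coxeterAdj CartanMatrix.F₄) j i ≠ 0 by decide)
    (show ∀ i j : Fin 4, i.val + 1 < j.val → entry (coxeterAdj CartanMatrix.F₄) i j = 0 ∧
      entry (coxeterAdj CartanMatrix.F₄) j i = 0 by decide)
    h.intertwine ⟨rfl, rfl⟩ φ hφ 0 rfl hy ha hb
    (show ∀ v : Fin 4, entry (coxeterAdj CartanMatrix.F₄) 0 v = if v = 1 then 1 else 0 by decide)
    (show ∀ v : Fin 4, entry (coxeterAdj CartanMatrix.F₄) v 0 = if v = 1 then 1 else 0 by decide)

end Biagram

/-! ### All components that are not simply laced have rank two -/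

lemma eq_of_sum_eq_one {W : Type*} [Fintype W] {f : W → ℤ} (h0 : ∀ w, 0 ≤ f w)
    (h1 : ∑ w, f w = 1) {a b : W} (ha : f a ≠ 0) (hb : f b ≠ 0) : a = b := by
  classical
  by_contra hab
  have h2 : ∑ w ∈ {a, b}, f w ≤ ∑ w, f w :=
    Finset.sum_le_sum_of_subset_of_nonneg (Finset.subset_univ _) fun w _ _ => h0 w
  rw [Finset.sum_pair hab] at h2
  have := h0 a
  have := h0 b
  omega

namespace DoubleBlocks

variable {W : Type*} [Fintype W] {p q : ℤ} {Y : Matrix W W ℤ} {A : Matrix (Fin 2) W ℤ}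
  {B : Matrix W (Fin 2) ℤ} {χ : Fin 2 ⊕ W → Bool}

/-- The blue component of the vertex `k` has exactly one other vertex, namely `w`. -/
def IsSingle (A : Matrix (Fin 2) W ℤ) (k : Fin 2) (w : W) : Prop := ∀ v, A k v ≠ 0 ↔ v = w

/-- The blue edges at the vertex `k` are simple. -/
def IsSimple (A : Matrix (Fin 2) W ℤ) (B : Matrix W (Fin 2) ℤ) (k : Fin 2) : Prop :=
  ∀ w, A k w ≠ 0 → A k w = 1 ∧ B w k = 1

/-- The roles of the two vertices of `X` may be exchanged. -/
lemma reverse (h : DoubleBlocks !![0, p; q, 0] Y A B χ) :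
    DoubleBlocks !![0, q; p, 0] Y (A.submatrix Fin.revPerm id) (B.submatrix id Fin.revPerm)
      (χ ∘ Sum.map Fin.revPerm id) where
  conn := h.conn
  components := by
    have := h.components.submatrix (Equiv.sumCongr Fin.revPerm (Equiv.refl W))
    convert this using 1
    · ext (i | i) (j | j) <;> rfl
    · rfl
  color_left i j hij := by
    refine h.color_left (Fin.revPerm i) (Fin.revPerm j) ?_
    revert hij
    fin_cases i <;> fin_cases j <;> simp
  color_right := h.color_right
  intertwine := by
    have e : !![0, q; p, 0] = (!![0, p; q, 0] : Matrix (Fin 2) (Fin 2) ℤ).submatrix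
        Fin.revPerm Fin.revPerm := by
      ext i j
      fin_cases i <;> fin_cases j <;> rfl
    constructor
    · rw [e, submatrix_mul_equiv, h.intertwine.left]
      rfl
    · rw [e, submatrix_mul_equiv, ← h.intertwine.right]
      rfl

section

variable (h : DoubleBlocks !![0, p; q, 0] Y A B χ) (hp : 1 ≤ p) (hq : 1 ≤ q)
include h

lemma left_zero (w : W) : p * A 1 w = ∑ v, A 0 v * Y v w := by
  have := h.vecMul_left 0 w
  simp only [Fin.sum_univ_two, vecMul, dotProduct] at this
  simpa [Fin.sum_univ_two] using this.symm

lemma left_one (w : W) : q * A 0 w = ∑ v, A 1 v * Y v w := by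
  have := h.vecMul_left 1 w
  simp only [Fin.sum_univ_two, vecMul, dotProduct] at this
  simpa [Fin.sum_univ_two] using this.symm

lemma right_zero (w : W) : q * B w 1 = ∑ v, Y w v * B v 0 := by
  have := h.vecMul_right 0 w
  simp only [Fin.sum_univ_two, vecMul, dotProduct, transpose_apply] at this
  simpa [mul_comm] using this.symm

lemma right_one (w : W) : p * B w 0 = ∑ v, Y w v * B v 1 := by
  have := h.vecMul_right 1 w
  simp only [Fin.sum_univ_two, vecMul, dotProduct, transpose_apply] at this
  simpa [mul_comm] using this.symm

lemma left_nonneg (k : Fin 2) (w : W) : 0 ≤ A k w := h.components.nonneg_left k w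

lemma right_nonneg (k : Fin 2) (w : W) : 0 ≤ B w k := h.components.nonneg_right w k

lemma right_eq_zero {k : Fin 2} {w : W} : B w k = 0 ↔ A k w = 0 :=
  ((h.components.pair k).iff w).symm

include hp

lemma color_ne : χ (Sum.inl 0) ≠ χ (Sum.inl 1) :=
  h.color_left 0 1 (by simp; omega)

/-- Every vertex of `Y` is adjacent to exactly the vertex of `X` of its colour. -/
lemma ne_zero_iff (k : Fin 2) (w : W) : A k w ≠ 0 ↔ χ (Sum.inr w) = χ (Sum.inl k) := by
  refine ⟨fun hw => (h.components.pres (Sum.inl k) (Sum.inr w) hw).symm, fun hw => ?_⟩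
  have hc := h.color_ne hp
  have := h.components.conn {x | x = Sum.inl k ∨ ∃ v, x = Sum.inr v ∧ A k v ≠ 0} (by
    rintro _ (rfl | ⟨v, rfl, hv⟩) (l | v') hx
    · exact absurd rfl hx
    · exact Or.inr ⟨v', rfl, hx⟩
    · left
      have h1 := h.components.pres (Sum.inl k) (Sum.inr v) hv
      have h2 := h.components.pres (Sum.inr v) (Sum.inl l) hx
      have h3 := h1.trans h2
      congr 1
      revert h3 hc
      fin_cases k <;> fin_cases l <;> simp
      tauto
    · exact absurd rfl hx) (Sum.inl k) (Or.inl rfl) (Sum.inr w) hw.symm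
  rcases this with h1 | ⟨v, h1, h2⟩
  · exact absurd h1 Sum.inr_ne_inl
  · rwa [Sum.inr_injective h1]

lemma zero_or_one (w : W) : A 0 w = 0 ↔ A 1 w ≠ 0 := by
  have h0 := h.ne_zero_iff hp 0 w
  have h1 := h.ne_zero_iff hp 1 w
  have hc := h.color_ne hp
  rw [h1, ← not_iff_not, ← ne_eq, h0]
  revert hc
  generalize χ (Sum.inl 0) = x
  generalize χ (Sum.inl 1) = y
  generalize χ (Sum.inr w) = z
  revert x y z
  decide

/-- The edges of `Y` join the two colour classes. -/
lemma right_apply_eq_zero {k : Fin 2} {v w : W} (hv : A k v ≠ 0) (hw : A k w ≠ 0) : Y v w = 0 := by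
  by_contra hc
  refine h.color_right v w hc ?_
  rw [(h.ne_zero_iff hp k v).1 hv, (h.ne_zero_iff hp k w).1 hw]

/-- The product of the two intertwiners is a scalar `c`: off the diagonal it vanishes as the two
vertices of `X` have different colours, and it commutes with `X`. -/
lemma exists_degree [Nonempty W] : ∃ c : ℤ, 1 ≤ c ∧ c ≤ 3 ∧ ∀ k, ∑ w, A k w * B w k = c := by
  have h01 : (A * B) 0 1 = 0 := by
    by_contra hc
    exact h.color_ne hp (h.components.eq_color 0 1 hc)
  have h10 : (A * B) 1 0 = 0 := by
    by_contra hc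
    exact h.color_ne hp (h.components.eq_color 1 0 hc).symm
  have hK : (A * B) 0 0 = (A * B) 1 1 := by
    have e := congrFun (congrFun h.commute.eq 0) 1
    simp only [mul_apply (M := !![0, p; q, 0]), mul_apply (N := !![0, p; q, 0]),
      Fin.sum_univ_two] at e
    simp at e
    change p * (A * B) 1 1 = (A * B) 0 0 * p at e
    rw [mul_comm] at e
    exact (mul_right_cancel₀ (by omega) e).symm
  have hk : ∀ k, ∑ w, A k w * B w k = (A * B) 0 0 := by
    intro k
    fin_cases k
    · rfl
    · exact hK.symm
  refine ⟨(A * B) 0 0, ?_, h.components.diag_le 0, hk⟩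
  obtain ⟨w⟩ := ‹Nonempty W›
  have key : ∀ k, A k w ≠ 0 → 1 ≤ (A * B) 0 0 := by
    intro k hkw
    rw [← hk k]
    have h1 := (h.left_nonneg k w).lt_of_ne hkw.symm
    have h2 := (h.right_nonneg k w).lt_of_ne fun hc => hkw (h.right_eq_zero.1 hc.symm)
    have h3 : A k w * B w k ≤ ∑ w, A k w * B w k :=
      Finset.single_le_sum (f := fun w => A k w * B w k)
        (fun v _ => mul_nonneg (h.left_nonneg k v) (h.right_nonneg k v)) (Finset.mem_univ w)
    have := mul_pos h1 h2
    omega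
  by_cases h0 : A 0 w = 0
  · exact key 1 ((h.zero_or_one hp w).1 h0)
  · exact key 0 h0

omit hp in
/-- If a blue component that contains a multiple edge has only two vertices, then each vertex of
`X` has exactly one blue neighbour or simple blue edges only. -/
lemma single_or_simple
    (h2 : ∀ x y, 2 ≤ (fromBlocks 0 A B 0 : Matrix (Fin 2 ⊕ W) (Fin 2 ⊕ W) ℤ) x y →
      ∀ z, χ z = χ x → z = x ∨ z = y) (k : Fin 2) :
    (∃ w, IsSingle A k w) ∨ IsSimple A B k := by
  by_cases hs : IsSimple A B k
  · exact Or.inr hs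
  · left
    simp only [IsSimple, not_forall] at hs
    obtain ⟨w, hw, hs⟩ := hs
    refine ⟨w, fun v => ⟨fun hv => ?_, fun hv => hv ▸ hw⟩⟩
    have e1 := h.components.pres (Sum.inl k) (Sum.inr w) hw
    have e2 := h.components.pres (Sum.inl k) (Sum.inr v) hv
    have n1 := h.left_nonneg k w
    have n2 := h.right_nonneg k w
    have n3 : B w k ≠ 0 := fun hc => hw (h.right_eq_zero.1 hc)
    by_cases ha : A k w = 1
    · have := h2 (Sum.inr w) (Sum.inl k) (show 2 ≤ B w k by
        by_contra hc
        exact hs ⟨ha, by omega⟩) (Sum.inr v) (e2.symm.trans e1)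
      simpa using this
    · have := h2 (Sum.inl k) (Sum.inr w) (show 2 ≤ A k w by omega) (Sum.inr v) e2.symm
      simpa using this

omit h hp in
lemma exists_single_of_degree_one {A : Matrix (Fin 2) W ℤ} {B : Matrix W (Fin 2) ℤ}
    {k : Fin 2} (h0 : ∀ w, 0 ≤ A k w * B w k) (hAB : ∀ w, B w k = 0 ↔ A k w = 0)
    (h1 : ∑ w, A k w * B w k = 1) :
    ∃ w, IsSingle A k w := by
  obtain ⟨w, -, hw⟩ := Finset.exists_ne_zero_of_sum_ne_zero (h1.trans_ne one_ne_zero)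
  refine ⟨w, fun v => ⟨fun hv => ?_, fun hv => hv ▸ left_ne_zero_of_mul hw⟩⟩
  exact eq_of_sum_eq_one h0 h1 (mul_ne_zero hv fun hc => hv ((hAB v).1 hc)) hw

/-- If `p = 1`, the two blue components cannot both be stars with `c ≥ 2` simple edges: the edges of
`Y` would form a matching between the leaves of the two stars, and `Y` would not be connected. -/
lemma false_of_simple_of_left (hp1 : p = 1) (h0 : IsSimple A B 0) (h1 : IsSimple A B 1)
    {c : ℤ} (hc : 2 ≤ c) (hk : ∑ w, A 0 w * B w 0 = c) : False := by
  subst hp1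
  obtain ⟨w, -, hw⟩ := Finset.exists_ne_zero_of_sum_ne_zero (hk.trans_ne (by omega))
  replace hw := left_ne_zero_of_mul hw
  obtain ⟨w', hw', hne⟩ : ∃ w', A 0 w' ≠ 0 ∧ w' ≠ w := by
    by_contra! hcon
    rw [Finset.sum_eq_single w (fun v _ hv => by
      rw [of_not_not fun hz => hv (hcon v hz), zero_mul]) (by simp), (h0 w hw).1, (h0 w hw).2] at hk
    omega
  -- Rows of `Y` in the first class and columns in the second class have sum one.
  have row : ∀ u, A 0 u ≠ 0 → ∑ v, Y u v = 1 := by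
    intro u hu
    rw [← (h0 u hu).2, ← one_mul (B u 0), h.right_one]
    refine Finset.sum_congr rfl fun v _ => ?_
    by_cases hv : A 1 v = 0
    · have : A 0 v ≠ 0 := fun h0 => (h.zero_or_one hp v).1 h0 hv
      rw [h.right_apply_eq_zero hp hu this, zero_mul]
    · rw [(h1 v hv).2, mul_one]
  have col : ∀ v, A 1 v ≠ 0 → ∑ u, Y u v = 1 := by
    intro v hv
    rw [← (h1 v hv).1, ← one_mul (A 1 v), h.left_zero]
    refine Finset.sum_congr rfl fun u _ => ?_
    by_cases hu : A 0 u = 0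
    · rw [h.right_apply_eq_zero hp ((h.zero_or_one hp u).1 hu) hv, mul_zero]
    · rw [(h0 u hu).1, one_mul]
  obtain ⟨v, -, hv⟩ := Finset.exists_ne_zero_of_sum_ne_zero ((row w hw).trans_ne one_ne_zero)
  have hv1 : A 1 v ≠ 0 := by
    rw [← h.zero_or_one hp]
    by_contra hv0
    exact hv (h.right_apply_eq_zero hp hw hv0)
  have hall := h.conn.conn {w, v} (by
    rintro u (rfl | rfl) u' hu'
    · exact Or.inr (eq_of_sum_eq_one (fun v => h.conn.nonneg _ v) (row _ hw) hu' hv)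
    · refine Or.inl (eq_of_sum_eq_one (fun v => h.conn.nonneg v _) (col _ hv1)
        (fun hz => hu' (h.conn.symm _ _ hz)) hv)) w (Or.inl rfl) w'
  rcases hall with rfl | rfl
  · exact hne rfl
  · exact hw' ((h.zero_or_one hp _).2 hv1)

end

end DoubleBlocks

/-- The irreducible nonnegative matrices of size two and finite type are the Coxeter adjacency
matrices of the diagrams with two vertices. -/
lemma DynkinType.exists_rankTwo {x y : ℤ} (hx : 1 ≤ x) (hy : 1 ≤ y) (hxy : x * y ≤ 3) :
    ∃ T ∈ DynkinType.rankTwo, ∃ f : Fin 2 ≃ Fin T.rank,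
      (!![0, x; y, 0] : Matrix (Fin 2) (Fin 2) ℤ) = T.adj.submatrix f f ∧
        (T.IsADE → x * y = 1) := by
  have hx3 : x ≤ 3 := by nlinarith
  have hy3 : y ≤ 3 := by nlinarith
  have hA : (!![0, 1; 1, 0] : Matrix (Fin 2) (Fin 2) ℤ) = coxeterAdj (CartanMatrix.A 2) := by decide
  have hB : (!![0, 1; 2, 0] : Matrix (Fin 2) (Fin 2) ℤ) = coxeterAdj (CartanMatrix.B 2)ᵀ := by
    decide
  have hB' : (!![0, 2; 1, 0] : Matrix (Fin 2) (Fin 2) ℤ) =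
      (coxeterAdj (CartanMatrix.B 2)ᵀ).submatrix Fin.revPerm Fin.revPerm := by decide
  have hG : (!![0, 3; 1, 0] : Matrix (Fin 2) (Fin 2) ℤ) = coxeterAdj CartanMatrix.G₂ := by decide
  have hG' : (!![0, 1; 3, 0] : Matrix (Fin 2) (Fin 2) ℤ) =
      (coxeterAdj CartanMatrix.G₂).submatrix Fin.revPerm Fin.revPerm := by decide
  interval_cases x <;> interval_cases y <;> first | omega | skip
  · exact ⟨.A 2 one_le_two, Or.inl rfl, Equiv.refl _, hA, fun _ => rfl⟩
  · exact ⟨.B 2 le_rfl, Or.inr (Or.inl rfl), Equiv.refl _, hB, False.elim⟩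
  · exact ⟨.G₂, Or.inr (Or.inr rfl), Fin.revPerm, hG', False.elim⟩
  · exact ⟨.B 2 le_rfl, Or.inr (Or.inl rfl), Fin.revPerm, hB', False.elim⟩
  · exact ⟨.G₂, Or.inr (Or.inr rfl), Equiv.refl _, hG, False.elim⟩

/-- The arithmetic behind two blue components that are single edges. -/
lemma parallel_or_twist {p q r s x y x' y' : ℤ} (hp : 1 ≤ p) (hq : 1 ≤ q) (hx : 1 ≤ x)
    (hy : 1 ≤ y) (hx' : 1 ≤ x') (hy' : 1 ≤ y') (hpq : p * q ≤ 3)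
    (hxy : x * y ≤ 3) (h : x' * y' = x * y) (h1 : p * x' = x * r) (h2 : q * x = x' * s)
    (h3 : q * y' = s * y) (h4 : p * y = r * y') :
    (x' = x ∧ y' = y ∧ r = p ∧ s = q) ∨
      (p = 1 ∧ s = 1 ∧ r = q ∧ x = 1 ∧ y' = 1 ∧ x' = q ∧ y = q) ∨
      (q = 1 ∧ r = 1 ∧ s = p ∧ x' = 1 ∧ y = 1 ∧ x = p ∧ y' = p) := by
  have hp3 : p ≤ 3 := by nlinarith
  have hq3 : q ≤ 3 := by nlinarith
  have hx3 : x ≤ 3 := by nlinarith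
  have hy3 : y ≤ 3 := by nlinarith
  have hx3' : x' ≤ 3 := by nlinarith
  have hy3' : y' ≤ 3 := by nlinarith
  interval_cases x <;> interval_cases y <;> first | omega | skip
  all_goals interval_cases x' <;> first | omega | skip
  all_goals interval_cases p <;> omega

namespace DoubleBlocks

open Biagram

variable {V W : Type*} [Fintype W] {p q : ℤ} {Y : Matrix W W ℤ} {A : Matrix (Fin 2) W ℤ}
  {B : Matrix W (Fin 2) ℤ} {χ : Fin 2 ⊕ W → Bool} {P : Biagram V}

lemma iso_relabel {U : Type*} (X : Matrix (Fin 2) (Fin 2) ℤ) (ψ : U ≃ W) :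
    (ofBlocks X Y A B).Iso
      (ofBlocks X (Y.submatrix ψ ψ) (A.submatrix id ψ) (B.submatrix ψ id)) :=
  (ofBlocks_relabel X Y A B (Equiv.refl _) ψ).symm

lemma iso_reverse : (ofBlocks !![0, p; q, 0] Y A B).Iso
    (ofBlocks !![0, q; p, 0] Y (A.submatrix Fin.revPerm id) (B.submatrix id Fin.revPerm)) := by
  refine Iso.trans (ofBlocks_relabel _ Y A B Fin.revPerm (Equiv.refl _)).symm ?_
  have e : !![0, q; p, 0] = (!![0, p; q, 0] : Matrix (Fin 2) (Fin 2) ℤ).submatrix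
      Fin.revPerm Fin.revPerm := by
    ext i j
    fin_cases i <;> fin_cases j <;> rfl
  rw [e]
  exact Iso.refl _

/-- A block form of the twist of the diagram with matrix `!![0, 1; c, 0]`, in which the vertices of
the second copy are listed in the opposite order. -/
lemma isListed_twist {c : ℤ} (hc : 2 ≤ c) (hc3 : c ≤ 3)
    (hP : P.Iso (ofBlocks !![0, 1; c, 0] !![0, c; 1, 0] !![1, 0; 0, c] !![c, 0; 0, 1])) :
    P.IsListed := by
  obtain ⟨T, -, f, hf, hT⟩ := DynkinType.exists_rankTwo (x := 1) (y := c) le_rfl (by omega)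
    (by omega)
  refine .twist T (fun h => by have := hT h; omega) (hP.trans ?_)
  refine Iso.trans ?_ (twist_relabel T.adj f)
  rw [← hf]
  refine Iso.trans (iso_relabel _ Fin.revPerm) ?_
  have e1 : (!![0, c; 1, 0] : Matrix (Fin 2) (Fin 2) ℤ).submatrix Fin.revPerm Fin.revPerm =
      !![0, 1; c, 0] := by
    ext i j; fin_cases i <;> fin_cases j <;> rfl
  have e2 : (!![1, 0; 0, c] : Matrix (Fin 2) (Fin 2) ℤ).submatrix id Fin.revPerm =
      !![0, 1; c, 0] := by
    ext i j; fin_cases i <;> fin_cases j <;> rfl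
  have e3 : (!![c, 0; 0, 1] : Matrix (Fin 2) (Fin 2) ℤ).submatrix Fin.revPerm id =
      !![0, 1; c, 0] := by
    ext i j; fin_cases i <;> fin_cases j <;> rfl
  rw [e1, e2, e3]
  exact Iso.refl _

section

variable (h : DoubleBlocks !![0, p; q, 0] Y A B χ) (hp : 1 ≤ p) (hq : 1 ≤ q)
  (hpq : p * q = 2 ∨ p * q = 3)
include h hp hq hpq

/-- Both blue components are single edges: the binding is parallel or a twist. -/
theorem isListed_of_single_single {w₀ w₁ : W} (h0 : IsSingle A 0 w₀) (h1 : IsSingle A 1 w₁)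
    (hP : P.Iso (ofBlocks !![0, p; q, 0] Y A B)) : P.IsListed := by
  have a0 : A 0 w₀ ≠ 0 := (h0 w₀).2 rfl
  have a1 : A 1 w₁ ≠ 0 := (h1 w₁).2 rfl
  have a01 : A 0 w₁ = 0 := (h.zero_or_one hp w₁).2 a1
  have a10 : A 1 w₀ = 0 := by
    by_contra hc
    exact a0 ((h.zero_or_one hp w₀).2 hc)
  have hne : w₀ ≠ w₁ := fun hc => a0 (hc ▸ a01)
  have hψ : Function.Bijective ![w₀, w₁] := by
    constructor
    · intro i j hij
      fin_cases i <;> fin_cases j <;> simp_all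
    · intro w
      by_cases hw : A 0 w = 0
      · exact ⟨1, ((h1 w).1 ((h.zero_or_one hp w).1 hw)).symm⟩
      · exact ⟨0, ((h0 w).1 hw).symm⟩
  let ψ : Fin 2 ≃ W := Equiv.ofBijective _ hψ
  have hsum : ∀ f : W → ℤ, ∑ w, f w = f w₀ + f w₁ := by
    intro f
    rw [← Equiv.sum_comp ψ, Fin.sum_univ_two]
    rfl
  obtain ⟨c, hc1, hc3, hc⟩ := @exists_degree _ _ _ _ _ _ _ _ h hp ⟨w₀⟩
  have b01 : B w₁ 0 = 0 := h.right_eq_zero.2 a01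
  have b10 : B w₀ 1 = 0 := h.right_eq_zero.2 a10
  have b0 : B w₀ 0 ≠ 0 := fun hz => a0 (h.right_eq_zero.1 hz)
  have b1 : B w₁ 1 ≠ 0 := fun hz => a1 (h.right_eq_zero.1 hz)
  have c0 := hc 0
  have c1 := hc 1
  have e1 := h.left_zero w₁
  have e2 := h.left_one w₀
  have e3 := h.right_zero w₁
  have e4 := h.right_one w₀
  rw [hsum] at c0 c1 e1 e2 e3 e4
  simp only [a01, a10, b01, b10, h.diag_right, mul_zero, add_zero, zero_add]
    at c0 c1 e1 e2 e3 e4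
  have hPψ := hP.trans (iso_relabel _ ψ)
  have eY : Y.submatrix ψ ψ = !![0, Y w₀ w₁; Y w₁ w₀, 0] := by
    ext i j
    fin_cases i <;> fin_cases j
    exacts [h.diag_right _, rfl, rfl, h.diag_right _]
  have eA : A.submatrix id ψ = !![A 0 w₀, 0; 0, A 1 w₁] := by
    ext i j
    fin_cases i <;> fin_cases j
    exacts [rfl, a01, a10, rfl]
  have eB : B.submatrix ψ id = !![B w₀ 0, 0; 0, B w₁ 1] := by
    ext i j
    fin_cases i <;> fin_cases j
    exacts [rfl, b10, b01, rfl]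
  rw [eY, eA, eB] at hPψ
  have hA0 := h.left_nonneg 0 w₀
  have hA1 := h.left_nonneg 1 w₁
  have hB0 := h.right_nonneg 0 w₀
  have hB1 := h.right_nonneg 1 w₁
  have hr := h.conn.nonneg w₀ w₁
  have hs := h.conn.nonneg w₁ w₀
  generalize A 0 w₀ = x at *
  generalize A 1 w₁ = x' at *
  generalize B w₀ 0 = y at *
  generalize B w₁ 1 = y' at *
  generalize Y w₀ w₁ = r at *
  generalize Y w₁ w₀ = s at *
  rcases parallel_or_twist hp hq (show 1 ≤ x by omega) (show 1 ≤ y by omega)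
    (show 1 ≤ x' by omega) (show 1 ≤ y' by omega) (by omega) (by omega)
    (c1.trans c0.symm) e1 e2 e3 e4 with
    ⟨rfl, rfl, rfl, rfl⟩ | ⟨rfl, rfl, rfl, rfl, rfl, rfl, rfl⟩ |
      ⟨f1, f2, f3, f4, f5, f6, f7⟩
  · obtain ⟨S, hS, f, hf, hS1⟩ := DynkinType.exists_rankTwo hp hq (by omega)
    obtain ⟨T, hT, g, hg, -⟩ := DynkinType.exists_rankTwo (show 1 ≤ x' by omega)
      (show 1 ≤ y' by omega) (by omega)
    refine .tensor S T hS hT (fun h => by have := hS1 h.1; omega) (hPψ.trans ?_)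
    refine Iso.trans ?_ (tensor_relabel S.adj T.adj f g)
    rw [← hf, ← hg]
    refine Iso.trans ?_ (tensor_iso_ofBlocks _ rfl rfl).symm
    have d : ∀ x : ℤ, (!![x, 0; 0, x] : Matrix (Fin 2) (Fin 2) ℤ) = diagonal fun _ => x := by
      intro x
      ext i j
      fin_cases i <;> fin_cases j <;> rfl
    rw [d, d]
    exact Iso.refl _
  · exact isListed_twist (by omega) (by omega) hPψ
  · rw [f1, f2, f3, f4, f5, f6, f7] at hPψ
    rw [f1, mul_one] at hpq
    refine isListed_twist (c := p) (by omega) (by omega) (hPψ.trans ?_)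
    refine Iso.trans iso_reverse (Iso.trans (iso_relabel _ Fin.revPerm) ?_)
    convert Iso.refl _ using 2 <;>
    · ext i j
      fin_cases i <;> fin_cases j <;> rfl

/-- One blue component is a star with simple edges, the other one is a single edge. -/
theorem isListed_of_simple_single {w₁ : W} (h0 : IsSimple A B 0) (h1 : IsSingle A 1 w₁) {c : ℤ}
    (hc : 2 ≤ c) (hk : ∀ k, ∑ w, A k w * B w k = c) (hP : P.Iso (ofBlocks !![0, p; q, 0] Y A B)) :
    P.IsListed := by
  classical
  have a1 : A 1 w₁ ≠ 0 := (h1 w₁).2 rfl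
  have a0 : A 0 w₁ = 0 := (h.zero_or_one hp w₁).2 a1
  have a0' : ∀ w, w ≠ w₁ → A 0 w = 1 ∧ B w 0 = 1 := fun w hw => h0 w fun hz =>
    hw ((h1 w).1 ((h.zero_or_one hp w).1 hz))
  have a1' : ∀ w, w ≠ w₁ → A 1 w = 0 := fun w hw => of_not_not fun hz => hw ((h1 w).1 hz)
  have hcard : (Fintype.card W : ℤ) = c + 1 := by
    rw [← hk 0, ← Finset.sum_erase_add _ _ (Finset.mem_univ w₁), a0, zero_mul, add_zero,
      Finset.sum_congr rfl (fun w hw => by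
        rw [(a0' w (Finset.ne_of_mem_erase hw)).1, (a0' w (Finset.ne_of_mem_erase hw)).2, one_mul]),
      Finset.sum_const, Finset.card_erase_of_mem (Finset.mem_univ _), Finset.card_univ]
    have : 0 < Fintype.card W := Fintype.card_pos_iff.2 ⟨w₁⟩
    simp
    omega
  have c1 : A 1 w₁ * B w₁ 1 = c := by
    rw [← hk 1, Finset.sum_eq_single w₁ (fun w _ hw => by rw [a1' w hw, zero_mul]) (by simp)]
  have e1 : ∀ w, w ≠ w₁ → q = A 1 w₁ * Y w₁ w := by
    intro w hw
    have := h.left_one w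
    rwa [(a0' w hw).1, mul_one, Finset.sum_eq_single w₁
      (fun v _ hv => by rw [a1' v hv, zero_mul]) (by simp)] at this
  have e2 : ∀ w, w ≠ w₁ → p = Y w w₁ * B w₁ 1 := by
    intro w hw
    have := h.right_one w
    rwa [(a0' w hw).2, mul_one, Finset.sum_eq_single w₁
      (fun v _ hv => by rw [h.right_eq_zero.2 (a1' v hv), mul_zero]) (by simp)] at this
  have n1 : 1 ≤ A 1 w₁ := by have := h.left_nonneg 1 w₁; omega
  have n2 : 1 ≤ B w₁ 1 := by
    have := h.right_nonneg 1 w₁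
    have : B w₁ 1 ≠ 0 := fun hz => a1 (h.right_eq_zero.1 hz)
    omega
  have key : ∀ x y r s : ℤ, 1 ≤ x → 1 ≤ y → x * y = c → 0 ≤ r → 0 ≤ s → q = x * s → p = r * y →
      x = q ∧ y = p ∧ r = 1 ∧ s = 1 := by
    rintro x y r s hx hy rfl hr hs rfl rfl
    have hr1 : 1 ≤ r := by nlinarith
    have hs1 : 1 ≤ s := by nlinarith
    have : r * s * (x * y) ≤ 3 := by
      rcases hpq with h | h <;> nlinarith
    have hrs : r * s = 1 := by
      by_contra hne
      have : 1 ≤ r * s := by nlinarith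
      have : 2 ≤ r * s := by omega
      nlinarith
    have hr2 : r = 1 := by nlinarith
    subst hr2
    simp at hrs
    subst hrs
    simp
  have key' : ∀ w, w ≠ w₁ → A 1 w₁ = q ∧ B w₁ 1 = p ∧ Y w w₁ = 1 ∧ Y w₁ w = 1 := fun w hw =>
    key _ _ _ _ n1 n2 c1 (h.conn.nonneg _ _) (h.conn.nonneg _ _) (e1 w hw) (e2 w hw)
  obtain ⟨w', hw'⟩ : ∃ w', w' ≠ w₁ := by
    by_contra! hcon
    have : Fintype.card W = 1 := Fintype.card_eq_one_iff.2 ⟨w₁, hcon⟩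
    omega
  obtain ⟨hA1, hB1, -, -⟩ := key' w' hw'
  have hcpq : c = p * q := by rw [← c1, hA1, hB1, mul_comm]
  -- The blocks, up to a relabelling that puts `w₁` at a given place.
  have hiso : ∀ (N : ℕ) (z : Fin N), (Fintype.card W = N) → ∀ (Y' : Matrix (Fin N) (Fin N) ℤ)
      (A' : Matrix (Fin 2) (Fin N) ℤ) (B' : Matrix (Fin N) (Fin 2) ℤ),
      (∀ i j, Y' i j = if i = z then if j = z then 0 else 1 else if j = z then 1 else 0) →
      (∀ j, A' 0 j = if j = z then 0 else 1) → (∀ j, A' 1 j = if j = z then q else 0) →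
      (∀ j, B' j 0 = if j = z then 0 else 1) → (∀ j, B' j 1 = if j = z then p else 0) →
      P.Iso (ofBlocks !![0, p; q, 0] Y' A' B') := by
    intro N z hN Y' A' B' hY' hA0 hA1' hB0 hB1'
    let φ₀ := Fintype.equivFinOfCardEq hN
    let φ : W ≃ Fin N := φ₀.trans (Equiv.swap (φ₀ w₁) z)
    have hφ : φ w₁ = z := by simp [φ]
    have hφ' : ∀ w, φ w = z ↔ w = w₁ := fun w => by rw [← hφ, φ.injective.eq_iff]
    refine hP.trans ?_
    have eY : Y = Y'.submatrix φ φ := by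
      ext v w
      rw [submatrix_apply, hY']
      simp only [hφ']
      by_cases hv : v = w₁
      · subst hv
        by_cases hw : w = v
        · rw [hw, h.diag_right]; simp
        · rw [(key' w hw).2.2.2]; simp [hw]
      · by_cases hw : w = w₁
        · subst hw
          rw [(key' v hv).2.2.1]; simp [hv]
        · rw [if_neg hv, if_neg hw]
          exact h.right_apply_eq_zero hp (k := 0) (by simp [(a0' v hv).1])
            (by simp [(a0' w hw).1])
    have eA : A = A'.submatrix id φ := by
      ext i w
      fin_cases i
      · change A 0 w = A' 0 (φ w)
        rw [hA0]
        simp only [hφ']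
        by_cases hw : w = w₁
        · rw [if_pos hw, hw, a0]
        · rw [if_neg hw, (a0' w hw).1]
      · change A 1 w = A' 1 (φ w)
        rw [hA1']
        simp only [hφ']
        by_cases hw : w = w₁
        · rw [if_pos hw, hw, hA1]
        · rw [if_neg hw, a1' w hw]
    have eB : B = B'.submatrix φ id := by
      ext w i
      fin_cases i
      · change B w 0 = B' (φ w) 0
        rw [hB0]
        simp only [hφ']
        by_cases hw : w = w₁
        · rw [if_pos hw, hw, h.right_eq_zero.2 a0]
        · rw [if_neg hw, (a0' w hw).2]
      · change B w 1 = B' (φ w) 1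
        rw [hB1']
        simp only [hφ']
        by_cases hw : w = w₁
        · rw [if_pos hw, hw, hB1]
        · rw [if_neg hw, h.right_eq_zero.2 (a1' w hw)]
    rw [eY, eA, eB]
    exact ofBlocks_relabel _ Y' A' B' (Equiv.refl _) φ
  have hp3 : p ≤ 3 := by rcases hpq with h | h <;> nlinarith
  have hq3 : q ≤ 3 := by rcases hpq with h | h <;> nlinarith
  have hcases : (p = 1 ∧ q = 2) ∨ (p = 2 ∧ q = 1) ∨ (p = 1 ∧ q = 3) ∨ (p = 3 ∧ q = 1) := by
    clear * - hp hq hp3 hq3 hpq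
    interval_cases p <;> interval_cases q <;> omega
  rcases hcases with ⟨rfl, rfl⟩ | ⟨rfl, rfl⟩ | ⟨rfl, rfl⟩ | ⟨rfl, rfl⟩
  · refine .bLtimesD 2 le_rfl ?_
    rw [bLtimesD_eq, show coxeterAdj (CartanMatrix.B 2)ᵀ = !![0, 1; 2, 0] by decide]
    exact hiso 3 0 (by omega) _ _ _
      (show ∀ i j, entry (coxeterAdj (CartanMatrix.D 3)) i j = _ by decide)
      (show ∀ j, entry (blockBD 2 le_rfl) 0 j = _ by decide)
      (show ∀ j, entry (blockBD 2 le_rfl) 1 j = _ by decide)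
      (show ∀ j, entry (blockDB 2) j 0 = _ by decide)
      (show ∀ j, entry (blockDB 2) j 1 = _ by decide)
  · refine .cLtimesD 2 le_rfl ?_
    rw [cLtimesD_eq, show coxeterAdj (CartanMatrix.C 2)ᵀ = !![0, 2; 1, 0] by decide]
    exact hiso 3 0 (by omega) _ _ _
      (show ∀ i j, entry (coxeterAdj (CartanMatrix.D 3)) i j = _ by decide)
      (show ∀ j, entry (blockDB 2)ᵀ 0 j = _ by decide)
      (show ∀ j, entry (blockDB 2)ᵀ 1 j = _ by decide)
      (show ∀ j, entry (blockBD 2 le_rfl)ᵀ j 0 = _ by decide)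
      (show ∀ j, entry (blockBD 2 le_rfl)ᵀ j 1 = _ by decide)
  · refine .gLtimesD₁ ?_
    rw [gLtimesD₁_eq, show coxeterAdj CartanMatrix.G₂ = !![0, 3; 1, 0] by decide]
    refine Iso.trans ?_ iso_reverse.symm
    exact hiso 4 1 (by omega) _ _ _
      (show ∀ i j, entry (coxeterAdj (CartanMatrix.D 4)) i j = _ by decide)
      (by decide) (by decide) (by decide) (by decide)
  · refine .gLtimesD₂ ?_
    rw [gLtimesD₂, gLtimesD₁_eq, ofBlocks_flip, coxeterAdj_D_transpose 4 (by norm_num),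
      show (coxeterAdj CartanMatrix.G₂)ᵀ = !![0, 1; 3, 0] by decide]
    refine Iso.trans ?_ iso_reverse.symm
    exact hiso 4 1 (by omega) _ _ _
      (show ∀ i j, entry (coxeterAdj (CartanMatrix.D 4)) i j = _ by decide)
      (by decide) (by decide) (by decide) (by decide)

/-- A double binding with a red component of type `B₂` or `G₂`, all of whose blue components with
a multiple edge have two vertices, is in the list. -/
theorem isListed_of_rankTwo [Nonempty W]
    (h2 : ∀ x y, 2 ≤ (fromBlocks 0 A B 0 : Matrix (Fin 2 ⊕ W) (Fin 2 ⊕ W) ℤ) x y →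
      ∀ z, χ z = χ x → z = x ∨ z = y)
    (hP : P.Iso (ofBlocks !![0, p; q, 0] Y A B)) : P.IsListed := by
  obtain ⟨c, hc1, hc3, hc⟩ := h.exists_degree hp
  rcases hc1.eq_or_lt with rfl | hc2
  · have hs : ∀ k, ∃ w, IsSingle A k w := fun k => exists_single_of_degree_one
      (fun w => mul_nonneg (h.left_nonneg k w) (h.right_nonneg k w)) (fun w => h.right_eq_zero)
      (hc k)
    obtain ⟨w₀, hw₀⟩ := hs 0
    obtain ⟨w₁, hw₁⟩ := hs 1
    exact h.isListed_of_single_single hp hq hpq hw₀ hw₁ hP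
  · rcases h.single_or_simple h2 0 with ⟨w₀, hw₀⟩ | h0 <;>
      rcases h.single_or_simple h2 1 with ⟨w₁, hw₁⟩ | h1
    · exact h.isListed_of_single_single hp hq hpq hw₀ hw₁ hP
    · exact h.reverse.isListed_of_simple_single hq hp (by rwa [mul_comm q p]) h1 hw₀ hc2
        (fun k => hc (Fin.revPerm k)) (hP.trans iso_reverse)
    · exact h.isListed_of_simple_single hp hq hpq h0 hw₁ hc2 hc hP
    · exfalso
      have : p = 1 ∨ q = 1 := by
        by_contra! hcon
        have h3 : 2 ≤ p := by omega
        have h4 : 2 ≤ q := by omega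
        rcases hpq with h | h <;> nlinarith
      rcases this with h5 | h5
      · exact h.false_of_simple_of_left hp h5 h0 h1 hc2 (hc 0)
      · exact h.reverse.false_of_simple_of_left hq h5 h1 h0 hc2 (hc 1)

end

end DoubleBlocks

/-! ### The classification -/

lemma DynkinType.rank_pos (X : DynkinType) : 0 < X.rank := by
  cases X <;> simp only [DynkinType.rank] <;> omega

namespace Biagram

variable {V : Type*} [Fintype V] [DecidableEq V]

lemma IsGood.isListed_of_isRedComponent_B {P : Biagram V} (hP : P.IsGood) {n : ℕ} (hn : 2 ≤ n)
    (h3 : 3 ≤ n) (hX : P.IsRedComponent (.B n hn)) : P.IsListed := by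
  obtain ⟨m, rfl⟩ : ∃ m, n = m + 2 := ⟨n - 2, by omega⟩
  obtain ⟨Y, A, B, χ, hiso, h, -⟩ := hP.exists_blocks hX
  exact isListed_of_B (m := m) (W := Fin Y.rank) (by omega) h hiso

/-- A component of rank at least three that is not simply laced determines the binding. -/
theorem IsGood.isListed_of_three_le {P : Biagram V} (hP : P.IsGood) {X : DynkinType}
    (hX : P.IsRedComponent X) (hADE : ¬ X.IsADE) (h3 : 3 ≤ X.rank) : P.IsListed := by
  cases X with
  | A n hn => exact absurd trivial hADE
  | B n hn => exact hP.isListed_of_isRedComponent_B hn h3 hX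
  | C n hn =>
    refine IsListed.of_flip (hP.flip.isListed_of_isRedComponent_B (n := n) (by omega) hn ?_)
    exact hX.flip (X' := .B n (by omega)) (Equiv.refl _)
      (congrArg transpose (coxeterAdj_C_eq_transpose n))
  | D n hn => exact absurd trivial hADE
  | E₆ => exact absurd trivial hADE
  | E₇ => exact absurd trivial hADE
  | E₈ => exact absurd trivial hADE
  | F₄ =>
    obtain ⟨Y, A, B, χ, hiso, h, -⟩ := hP.exists_blocks hX
    exact isListed_of_F₄ (W := Fin Y.rank) h hiso
  | G₂ => exact absurd h3 (by decide)

/-- The case of a red component of type `B₂` or `G₂` when no component of larger rank fails to be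
simply laced. -/
lemma IsGood.isListed_of_rank_two {P : Biagram V} (hP : P.IsGood)
    (hd : ∀ X, P.dual.IsRedComponent X → ¬ X.IsADE → X.rank < 3) {X : DynkinType}
    (hX : P.IsRedComponent X) (hADE : ¬ X.IsADE) (h2 : X.rank < 3) : P.IsListed := by
  obtain ⟨Y, A, B, χ, hiso, h, X', Y', f, hX', hY', hf, hχ⟩ := hP.exists_blocks hX
  have key : ∀ Z : DynkinType, (¬ Z.IsADE → Z.rank < 3) → ∀ a b c : Fin Z.rank, a ≠ b →
      2 ≤ Z.adj a b → c = a ∨ c = b := by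
    intro Z hZ a b c hab h2
    have h3 := hZ fun hA => by
      have := DynkinType.adj_le_one hA a b
      omega
    have ha := a.2
    have hb := b.2
    have hc := c.2
    rw [ne_eq, Fin.ext_iff] at hab
    rw [Fin.ext_iff, Fin.ext_iff]
    omega
  have hblue : ∀ x y, 2 ≤ fromBlocks 0 A B 0 x y → ∀ z, χ z = χ x → z = x ∨ z = y := by
    intro x y hxy z hz
    have hne : x ≠ y := by
      rintro rfl
      rcases x with x | x <;> simp at hxy
    rw [hf, submatrix_apply] at hxy
    rw [hχ, hχ] at hz
    have hne' : f x ≠ f y := fun hc => hne (f.injective hc)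
    rw [← f.injective.eq_iff, ← f.injective.eq_iff (a := z) (b := y)]
    revert hxy hz hne'
    rcases f x with a | a <;> rcases f y with b | b <;> rcases f z with c | c <;> intro hxy hz hne'
    · rcases key X' (hd X' hX') a b c (fun h => hne' (congrArg _ h)) hxy with h | h <;> simp [h]
    · simp at hz
    · simp at hxy
    · simp at hxy
    · simp at hxy
    · simp at hxy
    · simp at hz
    · rcases key Y' (hd Y' hY') a b c (fun h => hne' (congrArg _ h)) hxy with h | h <;> simp [h]
  have : Nonempty (Fin Y.rank) := ⟨⟨0, Y.rank_pos⟩⟩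
  cases X with
  | A n hn => exact absurd trivial hADE
  | B n hn =>
    obtain rfl : n = 2 := by
      change n < 3 at h2
      omega
    have e : coxeterAdj (CartanMatrix.B 2)ᵀ = !![0, 1; 2, 0] := by decide
    change DoubleBlocks (coxeterAdj (CartanMatrix.B 2)ᵀ) Y.adj A B χ at h
    change P.Iso (ofBlocks (coxeterAdj (CartanMatrix.B 2)ᵀ) Y.adj A B) at hiso
    rw [e] at h hiso
    exact DoubleBlocks.isListed_of_rankTwo (W := Fin Y.rank) h (by norm_num) (by norm_num)
      (by norm_num) hblue hiso
  | C n hn =>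
    change n < 3 at h2
    omega
  | D n hn => exact absurd trivial hADE
  | E₆ => exact absurd trivial hADE
  | E₇ => exact absurd trivial hADE
  | E₈ => exact absurd trivial hADE
  | F₄ => exact absurd h2 (by decide)
  | G₂ =>
    have e : coxeterAdj CartanMatrix.G₂ = !![0, 3; 1, 0] := by decide
    change DoubleBlocks (coxeterAdj CartanMatrix.G₂) Y.adj A B χ at h
    change P.Iso (ofBlocks (coxeterAdj CartanMatrix.G₂) Y.adj A B) at hiso
    rw [e] at h hiso
    exact DoubleBlocks.isListed_of_rankTwo (W := Fin Y.rank) h (by norm_num) (by norm_num)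
      (by norm_num) hblue hiso

/-- A multiple edge of the red matrix lies in a red component of rank at least three or of rank two.
In the second case the blue components with a multiple edge may be assumed to have rank two as well,
by duality. -/
lemma IsGood.isListed_of_red {P : Biagram V} (hP : P.IsGood) (h2 : ∃ i j, 2 ≤ P.red i j) :
    P.IsListed := by
  by_cases hr : ∃ X, P.IsRedComponent X ∧ ¬ X.IsADE ∧ 3 ≤ X.rank
  · obtain ⟨X, hX, hADE, h3⟩ := hr
    exact hP.isListed_of_three_le hX hADE h3
  by_cases hd : ∃ X, P.dual.IsRedComponent X ∧ ¬ X.IsADE ∧ 3 ≤ X.rank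
  · obtain ⟨X, hX, hADE, h3⟩ := hd
    exact (hP.dual.isListed_of_three_le hX hADE h3).of_dual
  push Not at hr hd
  obtain ⟨X, hX, hADE⟩ : ∃ X, P.IsRedComponent X ∧ ¬ X.IsADE := by
    obtain ⟨X, Y, e, h1, hb⟩ := hP.double.1
    obtain ⟨i, j, hij⟩ := h2
    by_contra! hc
    have hX := hc X ⟨Y, e, h1, hb⟩
    have hY := hc Y (.other e h1 hb)
    rw [h1, submatrix_apply] at hij
    revert hij
    rcases e i with a | a <;> rcases e j with b | b <;> intro hij
    · have := DynkinType.adj_le_one hX a b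
      rw [fromBlocks_apply₁₁] at hij
      omega
    · simp at hij
    · simp at hij
    · have := DynkinType.adj_le_one hY a b
      rw [fromBlocks_apply₂₂] at hij
      omega
  exact hP.isListed_of_rank_two hd hX hADE (hr X hX hADE)

theorem isListed_iff_isGood {P : Biagram V} : P.IsListed ↔ P.IsGood := by
  refine ⟨IsListed.isGood, fun hP => ?_⟩
  obtain ⟨i, j, h | h⟩ := hP.nonADE
  · exact hP.isListed_of_red ⟨i, j, h⟩
  · exact (hP.dual.isListed_of_red ⟨i, j, h⟩).of_dual

end Biagram

/-- The classification of the admissible non-ADE double bindings, up to isomorphism. -/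
theorem theorem3p5 {V : Type*} [Fintype V] [DecidableEq V] (P : Biagram V) :
    (P.IsDynkin ∧ P.IsDoubleBinding ∧ P.IsAdmissible ∧ ¬ P.IsADE) ↔
      (∃ X ∈ ({.A 2 one_le_two, .B 2 le_rfl, .G₂} : Set DynkinType),
        (X ≠ .A 2 one_le_two ∧ P.Iso (Biagram.parallel X)) ∨
          P.Iso (Biagram.parallel₂ X) ∨ P.Iso (Biagram.parallel₃ X)) ∨
      (∃ X : DynkinType, ¬ X.IsADE ∧ P.Iso (Biagram.twist X.adj)) ∨
      (∃ (n : ℕ) (hn : 2 ≤ n), P.Iso (Biagram.bLtimesD n hn)) ∨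
      (∃ (n : ℕ) (hn : 2 ≤ n), P.Iso (Biagram.cLtimesD n hn)) ∨
      (∃ (n : ℕ) (hn : 3 ≤ n), P.Iso (Biagram.bBowtieC n hn)) ∨
      P.Iso Biagram.gLtimesD₁ ∨ P.Iso Biagram.gLtimesD₂ ∨
      P.Iso Biagram.bBowtieG₁ ∨ P.Iso Biagram.bBowtieG₂ ∨
      P.Iso Biagram.cBowtieG₁ ∨ P.Iso Biagram.cBowtieG₂ ∨
      P.Iso Biagram.bBoxC := by
  rw [← Biagram.isGood_iff, ← Biagram.isListed_iff_isGood]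
  constructor
  · intro h
    cases h with
    | tensor X Y hX hY hXY e =>
      refine Or.inl ⟨X, hX, ?_⟩
      rcases hY with rfl | rfl | rfl
      · refine Or.inl ⟨?_, e⟩
        rintro rfl
        exact hXY ⟨trivial, trivial⟩
      · exact Or.inr (Or.inl e)
      · exact Or.inr (Or.inr e)
    | twist X hX e => exact .inr (.inl ⟨X, hX, e⟩)
    | bLtimesD n hn e => exact .inr (.inr (.inl ⟨n, hn, e⟩))
    | cLtimesD n hn e => exact .inr (.inr (.inr (.inl ⟨n, hn, e⟩)))
    | bBowtieC n hn e => exact .inr (.inr (.inr (.inr (.inl ⟨n, hn, e⟩))))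
    | gLtimesD₁ e => tauto
    | gLtimesD₂ e => tauto
    | bBowtieG₁ e => tauto
    | bBowtieG₂ e => tauto
    | cBowtieG₁ e => tauto
    | cBowtieG₂ e => tauto
    | bBoxC e => tauto
  · rintro (⟨X, hX, ⟨hne, e⟩ | e | e⟩ | ⟨X, hX, e⟩ | ⟨n, hn, e⟩ | ⟨n, hn, e⟩ | ⟨n, hn, e⟩ | e | e |
      e | e | e | e | e)
    · refine .tensor X (.A 2 one_le_two) hX (Or.inl rfl) ?_ e
      rintro ⟨hA, -⟩
      rcases hX with rfl | rfl | rfl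
      exacts [hne rfl, hA, hA]
    · exact .tensor X (.B 2 le_rfl) hX (Or.inr (Or.inl rfl)) (fun h => h.2) e
    · exact .tensor X .G₂ hX (Or.inr (Or.inr rfl)) (fun h => h.2) e
    exacts [.twist X hX e, .bLtimesD n hn e, .cLtimesD n hn e, .bBowtieC n hn e, .gLtimesD₁ e,
      .gLtimesD₂ e, .bBowtieG₁ e, .bBowtieG₂ e, .cBowtieG₁ e, .cBowtieG₂ e, .bBoxC e]
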